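/- **Proposition 2.5.** Let $N\ge 1$, $\hbar>0$ and $\boldsymbol\gamma_N=(\gamma_{N1},\dots,\gamma_{NN})\in\mathbb R^N$. Let $M$ be the space of meromorphic functions of the $\frac12N(N-1)$ complex variables $\boldsymbol\gamma=(\gamma_{nj})_{1\le j\le n\le N-1}$, on which $\mathfrak{gl}(N)$ acts by the operators $$E_{nn}=\frac1{i\hbar}\Big(\sum_{j=1}^n\gamma_{nj}-\sum_{j=1}^{n-1}\gamma_{n-1,j}\Big)\qquad(1\le n\le N),$$ $$E_{n,n+1}=-\frac1{i\hbar}\sum_{j=1}^n\frac{\prod_{r=1}^{n+1}(\gamma_{nj}-\gamma_{n+1,r}-\frac{i\hbar}2)}{\prod_{s\ne j}(\gamma_{nj}-\gamma_{ns})}\,e^{-i\hbar\partial_{\gamma_{nj}}},\qquad E_{n+1,n}=\frac1{i\hbar}\sum_{j=1}^n\frac{\prod_{r=1}^{n-1}(\gamma_{nj}-\gamma_{n-1,r}+\frac{i\hbar}2)}{\prod_{s\ne j}(\gamma_{nj}-\gamma_{ns})}\,e^{i\hbar\partial_{\gamma_{nj}}}\qquad(1\le n\le N-1),$$ and $E_{jk}=[E_{jm},E_{mk}]$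 for $j<m<k$ and for $j>m>k$; a matrix $X=(X_{jk})$ acts by $\sum_{j,k}X_{jk}E_{jk}$. Let $\mathcal U$ be the universal enveloping algebra of $\mathfrak{gl}(N)$ over $\mathbb C$, and let $W=\mathcal U w_N$ and $W'=\mathcal U w'_N$ be the Whittaker modules generated in $M$ by $w'_N=1$ and $$w_N=e^{-\frac\pi\hbar\sum_{n=1}^{N-1}(n-1)\sum_{j=1}^n\gamma_{nj}}\prod_{n=1}^{N-1}\prod_{k=1}^n\prod_{m=1}^{n+1}\hbar^{\frac{\gamma_{nk}-\gamma_{n+1,m}}{i\hbar}+\frac12}\,\Gamma\Big(\frac{\gamma_{nk}-\gamma_{n+1,m}}{i\hbar}+\frac12\Big).$$ For $\phi\in W'$ and $\psi\in W$ put $$\langle\phi,\psi\rangle=\int_{\mathbb R^{N(N-1)/2}}\mu_0(\boldsymbol\gamma)\,\overline{\phi(\boldsymbol\gamma)}\,\psi(\boldsymbol\gamma)\prod_{1\le j\le n\le N-1}d\gamma_{nj},\qquad \mu_0(\boldsymbol\gamma)=\prod_{n=2}^{N-1}\prod_{s<p}(\gamma_{ns}-\gamma_{np})\Big(e^{\frac{2\pi\gamma_{np}}\hbar}-e^{\frac{2\pi\gamma_{ns}}\hbar}\Big).$$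 Then $W$ and $W'$ are dual with respect to this pairing. That is: the integral converges absolutely for all $\phi\in W'$, $\psi\in W$; the resulting pairing $W'\times W\to\mathbb C$, conjugate-linear in $\phi$ and linear in $\psi$, is non-degenerate (if $\langle\phi,\psi\rangle=0$ for all $\psi\in W$ then $\phi=0$, and if $\langle\phi,\psi\rangle=0$ for all $\phi\in W'$ then $\psi=0$); and $$\langle\phi,X\psi\rangle=-\langle X\phi,\psi\rangle\qquad\text{for all }X\in\mathfrak{gl}(N,\mathbb R),\ \phi\in W',\ \psi\in W.$$ -/

import Mathlib

open scoped BigOperators ComplexConjugate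

noncomputable section

namespace GelfandZetlin

/-! ### Meromorphic functions of the triangular array of variables -/

/-- The labels `(n, j)`, `1 ≤ n ≤ N - 1`, of the variables `γ_{nj}`: the level `n` (the value of an
element of `Fin N`; level `0` carries no variable) holds `n` variables, numbered by `Fin n`.
There are `N (N - 1) / 2` labels. -/
abbrev Label (N : ℕ) : Type := (n : Fin N) × Fin (n : ℕ)

/-- The algebra of entire functions on `ℂ ^ (N (N - 1) / 2)`. -/
def Entire (N : ℕ) : Subalgebra ℂ ((Label N → ℂ) → ℂ) where
  carrier := {f | AnalyticOnNhd ℂ f Set.univ}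
  mul_mem' hf hg := hf.mul hg
  add_mem' hf hg := hf.add hg
  algebraMap_mem' _ := analyticOnNhd_const

instance entire_isDomain (N : ℕ) : IsDomain (Entire N) := by
  have : NoZeroDivisors (Entire N) := by
    refine ⟨fun {f g} h => ?_⟩
    by_contra! hne
    obtain ⟨hf, hg⟩ := hne
    have : ∃ z, f.1 z ≠ 0 := by
      by_contra! h0
      exact hf (Subtype.ext (funext h0))
    obtain ⟨z, hz⟩ := this
    have hev : ∀ᶠ y in nhds z, f.1 y ≠ 0 :=
      (f.2 z (Set.mem_univ z)).continuousAt.eventually_ne hz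
    apply hg
    apply Subtype.ext
    refine AnalyticOnNhd.eq_of_eventuallyEq (z₀ := z) g.2 (0 : Entire N).2 ?_
    filter_upwards [hev] with y hy
    have hm : f.1 y * g.1 y = 0 := congrFun (congrArg Subtype.val h) y
    exact (mul_eq_zero.mp hm).resolve_left hy
  exact NoZeroDivisors.to_isDomain _

/-- The space `M` of meromorphic functions in the variables `γ_{nj}`, `1 ≤ j ≤ n ≤ N - 1`. On an
affine space `ℂ ^ d` every meromorphic function is a quotient of two entire functions, so that this
is the quotient field of the ring of entire functions. -/
abbrev Mero (N : ℕ) : Type := FractionRing (Entire N)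

/-- An entire function, regarded as a meromorphic one. -/
abbrev toMero {N : ℕ} (f : Entire N) : Mero N := algebraMap (Entire N) (Mero N) f

/-- The value of a meromorphic function at a point `z`: if `F = f / g` with `f`, `g` entire and
`g z ≠ 0`, the value is `f z / g z`, whatever `f` and `g` (see `value_eq`); elsewhere `0`. -/
def value {N : ℕ} (F : Mero N) (z : Label N → ℂ) : ℂ :=
  open Classical in
  if h : ∃ q : Entire N × Entire N, q.2.1 z ≠ 0 ∧ F = toMero q.1 / toMero q.2 then
    h.choose.1.1 z / h.choose.2.1 z
  else 0

theorem value_eq {N : ℕ} (f g : Entire N) (z : Label N → ℂ) (hz : g.1 z ≠ 0) :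
    value (toMero f / toMero g) z = f.1 z / g.1 z := by
  have h : ∃ q : Entire N × Entire N,
      q.2.1 z ≠ 0 ∧ toMero f / toMero g = toMero q.1 / toMero q.2 := ⟨(f, g), hz, rfl⟩
  rw [value, dif_pos h]
  obtain ⟨h1, h2⟩ := h.choose_spec
  set q := h.choose
  have ne : ∀ k : Entire N, k.1 z ≠ 0 → toMero k ≠ 0 := by
    intro k hk h0
    rw [toMero, IsFractionRing.to_map_eq_zero_iff] at h0
    exact hk (by rw [h0]; rfl)
  rw [div_eq_div_iff (ne g hz) (ne q.2 h1), ← map_mul, ← map_mul] at h2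
  have h3 := congrFun (congrArg Subtype.val (IsFractionRing.injective (Entire N) (Mero N) h2)) z
  have h4 : f.1 z * q.2.1 z = q.1.1 z * g.1 z := h3
  rw [div_eq_div_iff h1 hz, h4]

/-- The composition `f ∘ u` of an entire function `f` of one variable with an entire `u`. -/
def Entire.comp {N : ℕ} (f : ℂ → ℂ) (hf : Differentiable ℂ f) (u : Entire N) : Entire N :=
  ⟨fun z => f (u.1 z), fun z hz => (hf.analyticAt (u.1 z)).comp (u.2 z hz)⟩

/-- The meromorphic function `exp u`. -/
def expM {N : ℕ} (u : Entire N) : Mero N :=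
  toMero (Entire.comp Complex.exp Complex.differentiable_exp u)

/-- The meromorphic function `Γ(u)`, the inverse of the entire function `1 / Γ(u)`. -/
def gammaM {N : ℕ} (u : Entire N) : Mero N :=
  (toMero (Entire.comp (fun s => (Complex.Gamma s)⁻¹) Complex.differentiable_one_div_Gamma u))⁻¹

/-- The complex constant `c`, as an entire function. -/
abbrev cst (N : ℕ) (c : ℂ) : Entire N := algebraMap ℂ (Entire N) c

/-- The coordinate function `γ ↦ γ_p`. -/
def coordinate {N : ℕ} (p : Label N) : Entire N :=
  ⟨fun z => z p, (ContinuousLinearMap.proj (R := ℂ) (φ := fun _ : Label N => ℂ) p).analyticOnNhd _⟩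

/-- The entry `γ_{nj}` of the triangular array: a variable for `n < N`, and the given complex number
`γ_{Nj}` (a constant function) for `n = N`. Levels `n > N` do not occur. -/
def entry {N : ℕ} (γN : Fin N → ℂ) (n : ℕ) (j : Fin n) : Entire N :=
  if h : n < N then coordinate ⟨⟨n, h⟩, j⟩
  else if h' : n = N then cst N (γN (Fin.cast h' j))
  else 0

/-- Translation of entire functions, `f(γ) ↦ f(γ + c e_p)`, as an algebra homomorphism. -/
def translateHom {N : ℕ} (p : Label N) (c : ℂ) : Entire N →ₐ[ℂ] Entire N where
  toFun f := ⟨fun z => f.1 (z + Pi.single p c), fun z _ =>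
    (f.2 (z + Pi.single p c) (Set.mem_univ _)).comp_of_eq (analyticAt_id.add analyticAt_const) rfl⟩
  map_one' := rfl
  map_mul' _ _ := rfl
  map_zero' := rfl
  map_add' _ _ := rfl
  commutes' _ := rfl

theorem translateHom_comp {N : ℕ} (p : Label N) (c d : ℂ) (h : c + d = 0) :
    (translateHom p c).comp (translateHom p d) = AlgHom.id ℂ (Entire N) := by
  apply AlgHom.ext
  intro f
  apply Subtype.ext
  funext z
  change f.1 (z + Pi.single p c + Pi.single p d) = f.1 z
  rw [add_assoc, ← Pi.single_add, h, Pi.single_zero, add_zero]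

/-- Translation of entire functions, `f(γ) ↦ f(γ + c e_p)`, as an algebra automorphism. -/
def translateEquiv {N : ℕ} (p : Label N) (c : ℂ) : Entire N ≃ₐ[ℂ] Entire N :=
  AlgEquiv.ofAlgHom (translateHom p c) (translateHom p (-c))
    (translateHom_comp p c (-c) (by ring)) (translateHom_comp p (-c) c (by ring))

/-- The shift operator `e^{c ∂/∂γ_p}` on meromorphic functions, `F(γ) ↦ F(γ + c e_p)`. -/
def shift {N : ℕ} (p : Label N) (c : ℂ) : Module.End ℂ (Mero N) :=
  (IsFractionRing.algEquivOfAlgEquiv (translateEquiv p c) : Mero N ≃ₐ[ℂ] Mero N).toLinearMap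

/-- The operator of multiplication by a meromorphic function. -/
abbrev mulBy {N : ℕ} (F : Mero N) : Module.End ℂ (Mero N) := LinearMap.mulLeft ℂ F

/-! ### The Gelfand-Zetlin operators -/

section Operators

variable {N : ℕ} (ħ : ℝ) (γN : Fin N → ℂ)

/-- `E_{nn}`, `1 ≤ n ≤ N`. -/
def diagE (n : ℕ) : Module.End ℂ (Mero N) :=
  (1 / (Complex.I * ħ)) •
    mulBy (∑ j : Fin n, toMero (entry γN n j) - ∑ j : Fin (n - 1), toMero (entry γN (n - 1) j))

/-- `E_{n,n+1}`, `1 ≤ n ≤ N - 1` (and `0` for other `n`). -/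
def upE (n : ℕ) : Module.End ℂ (Mero N) :=
  if h : n < N then
    (-(1 / (Complex.I * ħ))) • ∑ j : Fin n,
      mulBy ((∏ r : Fin (n + 1),
          toMero (entry γN n j - entry γN (n + 1) r - cst N (Complex.I * ħ / 2))) /
        ∏ s ∈ Finset.univ.erase j, toMero (entry γN n j - entry γN n s)) *
      shift ⟨⟨n, h⟩, j⟩ (-(Complex.I * ħ))
  else 0

/-- `E_{n+1,n}`, `1 ≤ n ≤ N - 1` (and `0` for other `n`). -/
def downE (n : ℕ) : Module.End ℂ (Mero N) :=
  if h : n < N then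
    (1 / (Complex.I * ħ)) • ∑ j : Fin n,
      mulBy ((∏ r : Fin (n - 1),
          toMero (entry γN n j - entry γN (n - 1) r + cst N (Complex.I * ħ / 2))) /
        ∏ s ∈ Finset.univ.erase j, toMero (entry γN n j - entry γN n s)) *
      shift ⟨⟨n, h⟩, j⟩ (Complex.I * ħ)
  else 0

/-- `E_{n,n+1+d}`, by `E_{n,n+d+2} = [E_{n,n+d+1}, E_{n+d+1,n+d+2}]`. -/
def upperE (n : ℕ) : ℕ → Module.End ℂ (Mero N)
  | 0 => upE ħ γN n
  | d + 1 => ⁅upperE n d, upE ħ γN (n + d + 1)⁆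

/-- `E_{n+1+d,n}`, by `E_{n+d+2,n} = [E_{n+d+2,n+d+1}, E_{n+d+1,n}]`. -/
def lowerE (n : ℕ) : ℕ → Module.End ℂ (Mero N)
  | 0 => downE ħ γN n
  | d + 1 => ⁅downE ħ γN (n + d + 1), lowerE n d⁆

/-- The operator on `M` of the matrix unit with row `j` and column `k`. The rows and columns are
counted from `0` by `Fin N`, and the operators above from `1`. -/
def unitE (j k : Fin N) : Module.End ℂ (Mero N) :=
  if j < k then upperE ħ γN (j + 1) (k - j - 1)
  else if k < j then lowerE ħ γN (k + 1) (j - k - 1)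
  else diagE ħ γN (j + 1)

/-- The action of `X = (X_{jk}) ∈ 𝔤𝔩(N, ℝ)` on `M`: the operator `∑ X_{jk} E_{jk}`. -/
def act (X : Matrix (Fin N) (Fin N) ℝ) : Module.End ℂ (Mero N) :=
  ∑ j, ∑ k, (X j k : ℂ) • unitE ħ γN j k

/-- The algebra of operators on `M` by which the universal enveloping algebra `𝓤(𝔤𝔩(N))` acts: the
unital complex algebra generated by the operators `E_{jk}`. -/
def envelope : Subalgebra ℂ (Module.End ℂ (Mero N)) :=
  Algebra.adjoin ℂ {T | ∃ j k, T = unitE ħ γN j k}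

/-- The cyclic module `𝓤 v` generated by a meromorphic function `v`. -/
def cyclic (v : Mero N) : Submodule ℂ (Mero N) :=
  (Subalgebra.toSubmodule (envelope ħ γN)).map (LinearMap.applyₗ v)

theorem act_mem_envelope (X : Matrix (Fin N) (Fin N) ℝ) : act ħ γN X ∈ envelope ħ γN :=
  sum_mem fun j _ => sum_mem fun k _ =>
    Subalgebra.smul_mem (envelope ħ γN)
      (Algebra.subset_adjoin (show unitE ħ γN j k ∈ {T | ∃ j k, T = unitE ħ γN j k} from
        ⟨j, k, rfl⟩)) _

theorem act_mem_cyclic (v : Mero N) (X : Matrix (Fin N) (Fin N) ℝ) (u : Mero N)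
    (hu : u ∈ cyclic ħ γN v) : act ħ γN X u ∈ cyclic ħ γN v := by
  obtain ⟨T, hT, rfl⟩ := hu
  exact ⟨act ħ γN X * T, (envelope ħ γN).mul_mem (act_mem_envelope ħ γN X) hT, rfl⟩

/-- The action of `X ∈ 𝔤𝔩(N, ℝ)` on the cyclic module `𝓤 v`. -/
def actOn (v : Mero N) (X : Matrix (Fin N) (Fin N) ℝ) : Module.End ℂ (cyclic ħ γN v) :=
  (act ħ γN X).restrict (act_mem_cyclic ħ γN v X)

/-! ### Whittaker vectors and Whittaker modules -/

/-- `(γ_{nk} - γ_{n+1,m}) / (i ħ) + 1/2`. -/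
def gammaArg (n : ℕ) (k : Fin n) (m : Fin (n + 1)) : Entire N :=
  (1 / (Complex.I * ħ)) • (entry γN n k - entry γN (n + 1) m) + cst N (1 / 2)

/-- `s_n(γ_n, γ_{n+1}) = ∏_k ∏_m ħ^u Γ(u)` with `u = (γ_{nk} - γ_{n+1,m}) / (i ħ) + 1/2`; the power
`ħ^u` is `exp (u log ħ)`. -/
def sFactor (n : ℕ) : Mero N :=
  ∏ k : Fin n, ∏ m : Fin (n + 1),
    expM ((Real.log ħ : ℂ) • gammaArg ħ γN n k m) * gammaM (gammaArg ħ γN n k m)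

/-- The Whittaker vector
`w_N = exp (-(π / ħ) ∑_{n=1}^{N-1} (n - 1) ∑_j γ_{nj}) ∏_{n=1}^{N-1} s_n(γ_n, γ_{n+1})`. -/
def whittakerVector : Mero N :=
  expM ((-(Real.pi / ħ) : ℂ) •
      ∑ n ∈ Finset.Ico 1 N, ((n : ℂ) - 1) • ∑ j : Fin n, entry γN n j) *
    ∏ n ∈ Finset.Ico 1 N, sFactor ħ γN n

/-- The Whittaker module `W = 𝓤 w_N`. -/
abbrev W : Submodule ℂ (Mero N) := cyclic ħ γN (whittakerVector ħ γN)

/-- The Whittaker module `W' = 𝓤 w_N'` generated by the Whittaker vector `w_N' = 1`. -/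
abbrev W' : Submodule ℂ (Mero N) := cyclic ħ γN 1

end Operators

/-! ### The integral pairing -/

/-- `μ₀(γ) = ∏_{n=2}^{N-1} ∏_{s<p} (γ_{ns} - γ_{np}) (e^{2πγ_{np}/ħ} - e^{2πγ_{ns}/ħ})`. -/
def μ₀ {N : ℕ} (ħ : ℝ) (x : Label N → ℝ) : ℝ :=
  ∏ n : Fin N, ∏ p : Fin (n : ℕ), ∏ s ∈ Finset.univ.filter (fun s => s < p),
    (x ⟨n, s⟩ - x ⟨n, p⟩) *
      (Real.exp (2 * Real.pi * x ⟨n, p⟩ / ħ) - Real.exp (2 * Real.pi * x ⟨n, s⟩ / ħ))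

/-- The integrand `μ₀(γ) conj(φ(γ)) ψ(γ)` of the pairing, a function on `ℝ ^ (N (N - 1) / 2)`. -/
def integrand {N : ℕ} (ħ : ℝ) (φ ψ : Mero N) (x : Label N → ℝ) : ℂ :=
  (μ₀ ħ x : ℂ) * conj (value φ (fun p => (x p : ℂ))) * value ψ (fun p => (x p : ℂ))

end GelfandZetlin

end

open scoped BigOperators ComplexConjugate

noncomputable section

namespace GelfandZetlin

/-! Both modules have a concrete form. Call a polynomial in the variables symmetric if it is
invariant under the permutations inside each level. Then `W'` is the space of symmetric polynomials
(`W'_eq`) and `W` is that space times w_N (`W_eq`), so that everything reduces to one explicit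
family of integrals.

The raising and lowering operators are divided differences in the variables of a level
(`sum_coefA_mul`, `sum_coefB_mul`), hence keep symmetric polynomials polynomial. Conversely, the
diagonal operators yield multiplication by the first power sums, and the commutator of the raising
operators of the levels n, …, n + d acts on f, up to lower weight, as multiplication by a divided
difference (`opX_commutator`, `exists_symbol`). Modulo products of elements of smaller weight, this
divided difference is a nonzero multiple of p_{m,d+2} - p_{m+1,d+2} with m = n + d
(`divDiff_nodePoly_mul_mem`). Descending from level N, whose entries are constants, every power sum
is reached (`p_mul_mem`, `symm_le`). By the functional equation of Γ, conjugation by w_N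
interchanges the coefficients of the two kinds of operators, so the same argument with the lowering
operators describes `W`.

Convergence: |Γ(1/2 + iy)| decays like exp(-π|y|/2), while μ₀ grows exponentially. The linear part
of this growth is cancelled by the exponential prefactor of w_N; what is left compares the distances
between neighbouring levels with the distances within the levels. Written as an integral over
thresholds, the excess has density z(z + 1) with z an integer (`energyDensity_eq`), so it is
nonnegative, and it bounds all variables in terms of the fixed level N (`abs_le_sum_energy`). The
integrand therefore decays exponentially (`exists_exponent_le`).

Skewness: multiplication by μ₀ removes the denominators of the operators and leaves a factor which
is iħ-periodic in the shifted variable. The two sides of the identity for a raising or lowering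
generator become integrals of one holomorphic function over contours differing by iħ. In between,
the arguments of Γ stay in the strip 1/2 ≤ Re u ≤ 3/2, so Cauchy's theorem applies
(`integral_raisedFun_shift`, `whittakerIntegral_adjoint`). Skewness passes to commutators and to
real linear combinations.

Non-degeneracy: a symmetric polynomial orthogonal to all symmetric ones is, by averaging over
permutations, orthogonal to all polynomials. A continuous function of exponential decay with this
property has zero Fourier transform (`integral_waveFun_step`, `eq_zero_of_integral_eval`). The
weight is nonzero off the diagonals and the Whittaker function has no zeros on real points, so the
polynomial is zero. -/

section

/-! ### Elementary symmetric functions, power sums and divided differences -/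

section Symmetric

open Polynomial Finset

variable {K : Type*} [Field K] {m : ℕ}

/-- The power sum `∑ v_j ^ k`. -/
def powerSum (v : Fin m → K) (k : ℕ) : K := ∑ j, v j ^ k

/-- The signed elementary symmetric function `(-1) ^ k e_k(v)`. -/
def signedEsymm (v : Fin m → K) (k : ℕ) : K := (-1) ^ k * (univ.val.map v).esymm k

/-- The polynomial `∏ (X - v_j)`. -/
def nodePoly (v : Fin m → K) : K[X] := ∏ j, (X - C (v j))

theorem nodePoly_eval (v : Fin m → K) (t : K) : (nodePoly v).eval t = ∏ j, (t - v j) := by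
  simp [nodePoly, eval_prod]

theorem nodePoly_monic (v : Fin m → K) : (nodePoly v).Monic :=
  monic_prod_of_monic _ _ fun j _ => monic_X_sub_C (v j)

theorem nodePoly_natDegree (v : Fin m → K) : (nodePoly v).natDegree = m := by
  simp [nodePoly, natDegree_prod_of_monic _ _ fun j _ => monic_X_sub_C (v j)]

theorem nodePoly_coeff (v : Fin m → K) {a : ℕ} (ha : a ≤ m) :
    (nodePoly v).coeff a = signedEsymm v (m - a) := by
  have h := Multiset.prod_X_sub_C_coeff (univ.val.map v) (k := a) (by simpa using ha)
  rw [Multiset.map_map, Multiset.card_map, card_val, card_univ, Fintype.card_fin] at h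
  exact h

theorem signedEsymm_zero (v : Fin m → K) : signedEsymm v 0 = 1 := by
  rw [signedEsymm, Multiset.esymm, Multiset.powersetCard_zero_left]
  simp

theorem signedEsymm_of_lt (v : Fin m → K) {k : ℕ} (hk : m < k) : signedEsymm v k = 0 := by
  have : (univ.val.map v).esymm k = 0 := by
    rw [Multiset.esymm, Multiset.powersetCard_eq_empty _ (by simpa using hk)]
    simp
  rw [signedEsymm, this, mul_zero]

/-- The sign built into `signedEsymm` absorbs the alternating signs of Newton's identities; one
global minus sign remains. -/
theorem newton_identity (v : Fin m → K) (k : ℕ) :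
    (k : K) * signedEsymm v k =
      -∑ a ∈ (antidiagonal k).filter (fun a => a.1 < k), signedEsymm v a.1 * powerSum v a.2 := by
  have h := congrArg (MvPolynomial.aeval v) (MvPolynomial.mul_esymm_eq_sum (Fin m) K k)
  simp only [map_mul, map_natCast, MvPolynomial.aeval_esymm_eq_multiset_esymm, map_pow, map_neg,
    map_one, map_sum, MvPolynomial.psum, MvPolynomial.aeval_X] at h
  have h2 : (k : K) * signedEsymm v k = (-1) ^ k * ((k : K) * (univ.val.map v).esymm k) := by
    rw [signedEsymm]; ring
  rw [h2, h, ← mul_assoc, ← pow_add, Odd.neg_one_pow ⟨k, by ring⟩, neg_one_mul]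
  rfl

/-- The functional `g ↦ ∑_j g(v_j) / ∏_{s ≠ j} (v_j - v_s)`. -/
def divDiff (v : Fin m → K) : K[X] →ₗ[K] K :=
  ∑ j, (∏ s ∈ univ.erase j, (v j - v s))⁻¹ • (Polynomial.leval (v j))

theorem divDiff_apply (v : Fin m → K) (g : K[X]) :
    divDiff v g = ∑ j, g.eval (v j) / ∏ s ∈ univ.erase j, (v j - v s) := by
  simp [divDiff, LinearMap.sum_apply, div_eq_inv_mul]

/-- A polynomial of degree below m is its own Lagrange interpolant at the m nodes, and `divDiff` is
the top coefficient of the interpolant. -/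
theorem divDiff_of_lt {v : Fin m → K} (hv : Function.Injective v) {g : K[X]}
    (hg : g.degree < m) : divDiff v g = g.coeff (m - 1) := by
  rw [divDiff_apply]
  have := Lagrange.coeff_eq_sum (s := (univ : Finset (Fin m))) (v := v) hv.injOn (P := g)
    (by simpa using hg)
  simpa using this.symm

theorem divDiff_nodePoly_mul (v : Fin m → K) (g : K[X]) : divDiff v (g * nodePoly v) = 0 := by
  rw [divDiff_apply]
  refine sum_eq_zero fun j _ => ?_
  have : (nodePoly v).eval (v j) = 0 := by
    rw [nodePoly_eval]
    exact prod_eq_zero (mem_univ j) (sub_self _)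
  simp [this]

theorem divDiff_C_mul (v : Fin m → K) (a : K) (g : K[X]) :
    divDiff v (C a * g) = a * divDiff v g := by
  rw [← smul_eq_C_mul, map_smul, smul_eq_mul]

theorem divDiff_X_pow_of_lt {v : Fin m → K} (hv : Function.Injective v) {i : ℕ} (hi : i + 1 < m) :
    divDiff v (X ^ i) = 0 := by
  rw [divDiff_of_lt hv (by rw [degree_X_pow]; exact_mod_cast (by omega : i < m)), coeff_X_pow,
    if_neg (by omega)]

theorem divDiff_X_pow_self {v : Fin m → K} (hv : Function.Injective v) {i : ℕ} (hi : i + 1 = m) :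
    divDiff v (X ^ i) = 1 := by
  rw [divDiff_of_lt hv (by rw [degree_X_pow]; exact_mod_cast (by omega : i < m)), coeff_X_pow,
    if_pos (by omega)]

/-- `divDiff` kills the multiples of the node polynomial. Expanding X ^ i times that polynomial
gives a linear recurrence, which makes the divided differences of powers polynomials in the
elementary symmetric functions. -/
theorem divDiff_X_pow_add (v : Fin m → K) (i : ℕ) :
    divDiff v (X ^ (i + m)) =
      -∑ a ∈ range m, signedEsymm v (m - a) * divDiff v (X ^ (i + a)) := by
  have h := divDiff_nodePoly_mul v (X ^ i)
  have h2 : nodePoly v = X ^ m + ∑ a ∈ range m, C (signedEsymm v (m - a)) * X ^ a := by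
    conv_lhs => rw [(nodePoly v).as_sum_range_C_mul_X_pow, nodePoly_natDegree, sum_range_succ]
    rw [nodePoly_coeff v le_rfl, Nat.sub_self, signedEsymm_zero, C_1, one_mul, add_comm]
    congr 1
    exact sum_congr rfl fun a ha => by rw [nodePoly_coeff v (mem_range.mp ha).le]
  rw [h2, mul_add, map_add, mul_sum, map_sum, ← pow_add] at h
  rw [eq_neg_of_add_eq_zero_left h]
  congr 1
  refine sum_congr rfl fun a _ => ?_
  rw [← divDiff_C_mul]
  congr 1
  ring

end Symmetric

/-! ### Triangular arrays in a field with shifts, and the filtration by weight -/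

/-- A triangular array `x n j` in a field, constant from level `N` on, with commuting
homomorphisms `τ n j` translating the single entry `x n j` by `b`. -/
structure ShiftArray (N : ℕ) (K : Type*) [Field K] [Algebra ℂ K] (b : ℂ) where
  x : (n : ℕ) → Fin n → K
  τ : (n : ℕ) → Fin n → K →ₐ[ℂ] K
  x_injective : ∀ n, n < N → Function.Injective (x n)
  x_top : ∀ n, N ≤ n → ∀ j, ∃ a : ℂ, x n j = algebraMap ℂ K a
  τ_self : ∀ n, n < N → ∀ j, τ n j (x n j) = x n j + algebraMap ℂ K b
  τ_of_ne : ∀ n j i, i ≠ j → τ n j (x n i) = x n i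
  τ_of_level_ne : ∀ n j m i, m ≠ n → τ n j (x m i) = x m i
  τ_comm : ∀ n j m i f, τ n j (τ m i f) = τ m i (τ n j f)
  -- This makes every factor in the numerator of `coefA` nonzero, so that a single factor can be
  -- cancelled.
  sub_ne : ∀ m, m < N → ∀ j l, ∀ a : ℂ, x m j - x (m + 1) l ≠ algebraMap ℂ K a

namespace ShiftArray

open Polynomial Finset

variable {N : ℕ} {K : Type*} [Field K] [Algebra ℂ K] {b : ℂ} (D : ShiftArray N K b)

/-- The power sum `∑_j x_{mj} ^ k`. -/
def p (m k : ℕ) : K := powerSum (D.x m) k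

/-- The span of the products of power sums of total weight at most `d`. -/
def filt (d : ℤ) : Submodule ℂ K :=
  Submodule.span ℂ {y | ∃ s : Multiset (ℕ × ℕ), (∀ i ∈ s, i.1 < N ∧ 1 ≤ i.2) ∧
    ((s.map Prod.snd).sum : ℤ) ≤ d ∧ y = (s.map fun i => D.p i.1 i.2).prod}

theorem filt_mono {d e : ℤ} (h : d ≤ e) : D.filt d ≤ D.filt e :=
  Submodule.span_mono fun _ ⟨s, h1, h2, h3⟩ => ⟨s, h1, h2.trans h, h3⟩

/-- Weights are integers so that degree counts can be subtracted without truncation. The vanishing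
in negative weight turns weight bounds into degree bounds and starts the induction on the weight. -/
theorem filt_neg {d : ℤ} (h : d < 0) {y : K} (hy : y ∈ D.filt d) : y = 0 := by
  have : D.filt d ≤ ⊥ := Submodule.span_le.mpr (by rintro _ ⟨s, _, h2, _⟩; omega)
  exact (Submodule.mem_bot ℂ).mp (this hy)

theorem one_mem_filt : (1 : K) ∈ D.filt 0 :=
  Submodule.subset_span ⟨0, by simp, by simp, by simp⟩

theorem algebraMap_mem_filt (a : ℂ) : algebraMap ℂ K a ∈ D.filt 0 := by
  rw [Algebra.algebraMap_eq_smul_one]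
  exact Submodule.smul_mem _ _ D.one_mem_filt

theorem filt_mul {d e : ℤ} {y z : K} (hy : y ∈ D.filt d) (hz : z ∈ D.filt e) :
    y * z ∈ D.filt (d + e) := by
  induction hy using Submodule.span_induction with
  | zero => simp
  | add u v _ _ hu hv => rw [add_mul]; exact add_mem hu hv
  | smul a u _ hu => rw [smul_mul_assoc]; exact Submodule.smul_mem _ _ hu
  | mem u hu =>
    obtain ⟨s, h1, h2, rfl⟩ := hu
    induction hz using Submodule.span_induction with
    | zero => simp
    | add u v _ _ hu hv => rw [mul_add]; exact add_mem hu hv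
    | smul a u _ hu => rw [mul_smul_comm]; exact Submodule.smul_mem _ _ hu
    | mem u hu =>
      obtain ⟨t, k1, k2, rfl⟩ := hu
      refine Submodule.subset_span ⟨s + t, ?_, ?_, by simp⟩
      · intro i hi
        rcases Multiset.mem_add.mp hi with h | h
        exacts [h1 i h, k1 i h]
      · rw [Multiset.map_add, Multiset.sum_add, Nat.cast_add]
        exact add_le_add h2 k2

theorem filt_prod_mem {d e f : ℤ} {y z : K} (hy : y ∈ D.filt d) (hz : z ∈ D.filt e)
    (h : d + e ≤ f) : y * z ∈ D.filt f := D.filt_mono h (D.filt_mul hy hz)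

/-- Entries of level N and above are constants, so their power sums weigh 0 instead of k. The
descent through the levels ends here. -/
theorem p_top (m k : ℕ) (hm : N ≤ m) : D.p m k ∈ D.filt 0 := by
  choose a ha using D.x_top m hm
  have : D.p m k = algebraMap ℂ K (∑ j, a j ^ k) := by simp [p, powerSum, ha]
  rw [this]
  exact D.algebraMap_mem_filt _

theorem p_mem (m k : ℕ) : D.p m k ∈ D.filt k := by
  rcases Nat.lt_or_ge m N with hm | hm
  · rcases Nat.eq_zero_or_pos k with rfl | hk
    · have : D.p m 0 = algebraMap ℂ K m := by simp [p, powerSum]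
      rw [this]
      exact D.algebraMap_mem_filt _
    · exact Submodule.subset_span ⟨{(m, k)}, by simp [hm]; omega, by simp, by simp⟩
  · exact D.filt_mono (by positivity) (D.p_top m k hm)

theorem natCast_ne_zero {K : Type*} [Field K] [Algebra ℂ K] {k : ℕ} (hk : k ≠ 0) : (k : K) ≠ 0 := by
  have : CharZero K := charZero_of_injective_algebraMap (algebraMap ℂ K).injective
  exact_mod_cast hk

theorem natCast_mul_mem {S : Submodule ℂ K} {k : ℕ} (hk : k ≠ 0) {y : K}
    (h : (k : K) * y ∈ S) : y ∈ S := by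
  have := S.smul_mem ((k : ℂ)⁻¹) h
  rwa [Algebra.smul_def, ← mul_assoc, map_inv₀, map_natCast,
    inv_mul_cancel₀ (natCast_ne_zero hk), one_mul] at this

theorem signedEsymm_mem (m k : ℕ) : signedEsymm (D.x m) k ∈ D.filt k := by
  induction k using Nat.strong_induction_on with
  | _ k ih =>
    rcases Nat.eq_zero_or_pos k with rfl | hk
    · rw [signedEsymm_zero]; exact D.one_mem_filt
    · refine natCast_mul_mem hk.ne' ?_
      rw [newton_identity]
      refine neg_mem (sum_mem fun a ha => ?_)
      rw [mem_filter, HasAntidiagonal.mem_antidiagonal] at ha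
      exact D.filt_prod_mem (ih a.1 ha.2) (D.p_mem m a.2) (by omega)

theorem divDiff_X_pow_mem {m : ℕ} (hm : m < N) (i : ℕ) :
    divDiff (D.x m) (X ^ i) ∈ D.filt (i - m + 1) := by
  induction i using Nat.strong_induction_on with
  | _ i ih =>
    rcases lt_trichotomy (i + 1) m with h | h | h
    · rw [divDiff_X_pow_of_lt (D.x_injective m hm) h]; exact zero_mem _
    · rw [divDiff_X_pow_self (D.x_injective m hm) h]
      exact D.filt_mono (by omega) D.one_mem_filt
    · obtain ⟨i, rfl⟩ : ∃ i', i = i' + m := ⟨i - m, by omega⟩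
      rw [divDiff_X_pow_add]
      refine neg_mem (sum_mem fun a ha => ?_)
      rw [mem_range] at ha
      exact D.filt_prod_mem (D.signedEsymm_mem m _) (ih (i + a) (by omega)) (by omega)

/-! #### Polynomials with coefficients in the filtration -/

/-- The polynomials of weight at most `d`, the variable having weight one. -/
def polyFilt (d : ℤ) : Submodule ℂ K[X] where
  carrier := {g | ∀ i : ℕ, g.coeff i ∈ D.filt (d - i)}
  add_mem' hf hg i := by rw [coeff_add]; exact add_mem (hf i) (hg i)
  zero_mem' i := by simp
  smul_mem' a g hg i := by rw [coeff_smul]; exact Submodule.smul_mem _ _ (hg i)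

theorem polyFilt_mono {d e : ℤ} (h : d ≤ e) : D.polyFilt d ≤ D.polyFilt e :=
  fun _ hg i => D.filt_mono (by omega) (hg i)

theorem C_mem {d : ℤ} {a : K} (ha : a ∈ D.filt d) : C a ∈ D.polyFilt d := by
  intro i
  rw [coeff_C]
  split_ifs with h
  · subst h; simpa using ha
  · exact zero_mem _

theorem X_mem : (X : K[X]) ∈ D.polyFilt 1 := by
  intro i
  rw [coeff_X]
  split_ifs with h
  · subst h; simpa using D.one_mem_filt
  · exact zero_mem _

theorem polyFilt_mul {d e : ℤ} {g h : K[X]} (hg : g ∈ D.polyFilt d) (hh : h ∈ D.polyFilt e) :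
    g * h ∈ D.polyFilt (d + e) := by
  intro i
  rw [coeff_mul]
  refine sum_mem fun a ha => ?_
  rw [HasAntidiagonal.mem_antidiagonal] at ha
  exact D.filt_prod_mem (hg a.1) (hh a.2) (by omega)

theorem polyFilt_mul_mem {d e f : ℤ} {g h : K[X]} (hg : g ∈ D.polyFilt d)
    (hh : h ∈ D.polyFilt e) (hf : d + e ≤ f) : g * h ∈ D.polyFilt f :=
  D.polyFilt_mono hf (D.polyFilt_mul hg hh)

theorem X_pow_mem (i : ℕ) : (X : K[X]) ^ i ∈ D.polyFilt i := by
  induction i with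
  | zero => simpa using D.C_mem D.one_mem_filt
  | succ i ih => rw [pow_succ]; exact D.polyFilt_mul_mem ih D.X_mem (by push_cast; rfl)

theorem coeff_eq_zero {d : ℤ} {g : K[X]} (hg : g ∈ D.polyFilt d) {i : ℕ} (hi : d < i) :
    g.coeff i = 0 := D.filt_neg (by omega) (hg i)

theorem nodePoly_mem (m : ℕ) : nodePoly (D.x m) ∈ D.polyFilt m := by
  intro i
  rcases Nat.lt_or_ge m i with h | h
  · rw [coeff_eq_zero_of_natDegree_lt (by rw [nodePoly_natDegree]; exact h)]
    exact zero_mem _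
  · rw [nodePoly_coeff _ h]
    exact D.filt_mono (by omega) (D.signedEsymm_mem m (m - i))

theorem divX_mem {d : ℤ} {g : K[X]} (hg : g ∈ D.polyFilt d) : g.divX ∈ D.polyFilt (d - 1) := by
  intro i
  rw [coeff_divX]
  exact D.filt_mono (by omega) (hg (i + 1))

theorem divX_iterate_mem {d : ℤ} {g : K[X]} (hg : g ∈ D.polyFilt d) (i : ℕ) :
    divX^[i] g ∈ D.polyFilt (d - i) := by
  induction i with
  | zero => simpa using hg
  | succ i ih =>
    rw [Function.iterate_succ_apply']
    exact D.polyFilt_mono (by push_cast; omega) (D.divX_mem ih)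

/-- The divided difference over a level with m variables lowers the weight by m - 1 and, although
written with denominators, has values in the symmetric polynomials. -/
theorem divDiff_mem {m : ℕ} (hm : m < N) {d : ℤ} {g : K[X]} (hg : g ∈ D.polyFilt d) :
    divDiff (D.x m) g ∈ D.filt (d - m + 1) := by
  rw [g.as_sum_range_C_mul_X_pow, map_sum]
  refine sum_mem fun i _ => ?_
  rw [divDiff_C_mul]
  exact D.filt_prod_mem (hg i) (D.divDiff_X_pow_mem hm i) (by omega)

/-- Translation `g(X) ↦ g(X + a)` by a constant. -/
def translate (a : ℂ) (g : K[X]) : K[X] := g.comp (X + C (algebraMap ℂ K a))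

theorem X_add_pow_sub_mem (a : ℂ) (i : ℕ) :
    (X + C (algebraMap ℂ K a)) ^ i - X ^ i ∈ D.polyFilt (i - 1) := by
  induction i with
  | zero => simp
  | succ i ih =>
    have h : (X + C (algebraMap ℂ K a)) ^ (i + 1) - X ^ (i + 1) =
        ((X + C (algebraMap ℂ K a)) ^ i - X ^ i) * (X + C (algebraMap ℂ K a)) +
          X ^ i * C (algebraMap ℂ K a) := by ring
    rw [h]
    refine add_mem (D.polyFilt_mul_mem ih (add_mem D.X_mem (D.polyFilt_mono zero_le_one
      (D.C_mem (D.algebraMap_mem_filt a)))) (by push_cast; omega)) ?_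
    exact D.polyFilt_mul_mem (D.X_pow_mem i) (D.C_mem (D.algebraMap_mem_filt a))
      (by push_cast; omega)

/-- Constants have weight 0, so a translation does not change leading terms; all shifts by b and b /
2 are invisible when leading terms are compared. -/
theorem translate_sub_mem (a : ℂ) {d : ℤ} {g : K[X]} (hg : g ∈ D.polyFilt d) :
    translate a g - g ∈ D.polyFilt (d - 1) := by
  have h : translate a g - g = ∑ i ∈ range (g.natDegree + 1),
      C (g.coeff i) * ((X + C (algebraMap ℂ K a)) ^ i - X ^ i) := by
    simp_rw [mul_sub, sum_sub_distrib]
    rw [← g.as_sum_range_C_mul_X_pow, translate, comp, eval₂_eq_sum_range]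
  rw [h]
  exact sum_mem fun i _ => D.polyFilt_mul_mem (D.C_mem (hg i)) (D.X_add_pow_sub_mem a i) (by omega)

theorem translate_mem (a : ℂ) {d : ℤ} {g : K[X]} (hg : g ∈ D.polyFilt d) :
    translate a g ∈ D.polyFilt d := by
  have := add_mem (D.polyFilt_mono (by omega) (D.translate_sub_mem a hg)) hg
  simpa using this

theorem translate_eval (a : ℂ) (g : K[X]) (t : K) :
    (translate a g).eval t = g.eval (t + algebraMap ℂ K a) := by
  simp [translate]

/-! #### Shifts of elements of the filtration -/

theorem τ_p_self {m : ℕ} (hm : m < N) (j : Fin m) (k : ℕ) :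
    D.τ m j (D.p m k) =
      D.p m k + ((D.x m j + algebraMap ℂ K b) ^ k - D.x m j ^ k) := by
  classical
  simp only [p, powerSum, map_sum, map_pow]
  rw [← add_sum_erase _ _ (mem_univ j), ← add_sum_erase _ (fun i => D.x m i ^ k) (mem_univ j),
    D.τ_self m hm j]
  rw [sum_congr rfl fun i hi => by rw [D.τ_of_ne m j i (ne_of_mem_erase hi)]]
  ring

theorem τ_p_of_ne {m n : ℕ} (h : n ≠ m) (j : Fin m) (k : ℕ) : D.τ m j (D.p n k) = D.p n k := by
  simp only [p, powerSum, map_sum, map_pow, D.τ_of_level_ne m j n _ h]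

theorem exists_poly_τ_p {m : ℕ} (hm : m < N) (n k : ℕ) :
    ∃ φ ∈ D.polyFilt k, (∀ j, D.τ m j (D.p n k) = φ.eval (D.x m j)) ∧
      φ - C (D.p n k) ∈ D.polyFilt (k - 1) := by
  rcases eq_or_ne n m with rfl | h
  · have h1 := D.X_add_pow_sub_mem b k
    refine ⟨C (D.p n k) + ((X + C (algebraMap ℂ K b)) ^ k - X ^ k),
      add_mem (D.C_mem (D.p_mem n k)) (D.polyFilt_mono (by omega) h1), fun j => ?_, by simpa using h1⟩
    rw [D.τ_p_self hm]
    simp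
  · exact ⟨C (D.p n k), D.C_mem (D.p_mem n k), fun j => by rw [D.τ_p_of_ne h]; simp, by simp⟩

/-- Shifting the single entry x_{mj} changes a symmetric polynomial by a polynomial in x_{mj} with
symmetric coefficients, and the same φ serves for all j. Sums over j of shifted elements thus become
divided differences. -/
theorem exists_poly_τ {m : ℕ} (hm : m < N) {d : ℤ} {f : K} (hf : f ∈ D.filt d) :
    ∃ φ ∈ D.polyFilt d, (∀ j, D.τ m j f = φ.eval (D.x m j)) ∧
      φ - C f ∈ D.polyFilt (d - 1) := by
  induction hf using Submodule.span_induction with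
  | zero => exact ⟨0, zero_mem _, by simp, by simp⟩
  | add u v _ _ hu hv =>
    obtain ⟨φ, h1, h2, h3⟩ := hu
    obtain ⟨ψ, k1, k2, k3⟩ := hv
    refine ⟨φ + ψ, add_mem h1 k1, fun j => by rw [map_add, eval_add, h2, k2], ?_⟩
    rw [C_add, add_sub_add_comm]
    exact add_mem h3 k3
  | smul a u _ hu =>
    obtain ⟨φ, h1, h2, h3⟩ := hu
    refine ⟨a • φ, Submodule.smul_mem _ _ h1, fun j => by rw [map_smul, eval_smul, h2], ?_⟩
    have : C (a • u) = a • C u := (Polynomial.smul_C a u).symm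
    rw [this, ← smul_sub]
    exact Submodule.smul_mem _ _ h3
  | mem u hu =>
    obtain ⟨s, h0, h2, rfl⟩ := hu
    -- The bound d is replaced by the exact weight of the monomial, which adds up when the factors
    -- are treated one at a time.
    suffices H : ∃ φ ∈ D.polyFilt ((s.map Prod.snd).sum : ℕ),
        (∀ j, D.τ m j (s.map fun i => D.p i.1 i.2).prod = φ.eval (D.x m j)) ∧
        φ - C (s.map fun i => D.p i.1 i.2).prod ∈ D.polyFilt ((s.map Prod.snd).sum - 1) by
      obtain ⟨φ, h1, h3, h4⟩ := H
      exact ⟨φ, D.polyFilt_mono h2 h1, h3, D.polyFilt_mono (by omega) h4⟩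
    clear h2 h0
    induction s using Multiset.induction_on with
    | empty => exact ⟨1, by simpa using D.C_mem D.one_mem_filt, by simp, by simp⟩
    | cons i s ih =>
      obtain ⟨φ, h1, h2, h3⟩ := ih
      obtain ⟨ψ, k1, k2, k3⟩ := D.exists_poly_τ_p hm i.1 i.2
      refine ⟨ψ * φ, ?_, fun j => ?_, ?_⟩
      · exact D.polyFilt_mul_mem k1 h1 (by simp)
      · rw [Multiset.map_cons, Multiset.prod_cons, map_mul, eval_mul, k2, h2]
      · rw [Multiset.map_cons, Multiset.map_cons, Multiset.prod_cons, C_mul]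
        have : ∀ x y z w : K[X], x * y - z * w = (x - z) * y + z * (y - w) := by intros; ring
        rw [this]
        refine add_mem (D.polyFilt_mul_mem k3 h1 ?_)
          (D.polyFilt_mul_mem (D.C_mem (D.p_mem i.1 i.2)) h3 ?_) <;> simp

end ShiftArray

end

section

namespace ShiftArray

open Polynomial Finset

variable {N : ℕ} {K : Type*} [Field K] [Algebra ℂ K] {b : ℂ} (D : ShiftArray N K b)

/-! #### The raising and lowering operators -/

/-- The denominator `∏_{s ≠ j} (x_{mj} - x_{ms})`. -/
def den (m : ℕ) (j : Fin m) : K := ∏ s ∈ univ.erase j, (D.x m j - D.x m s)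

/-- The coefficient `∏_r (x_{mj} - x_{m+1,r} + b / 2) / ∏_{s ≠ j} (x_{mj} - x_{ms})`. -/
def coefA (m : ℕ) (j : Fin m) : K :=
  (∏ r : Fin (m + 1), (D.x m j - D.x (m + 1) r + algebraMap ℂ K (b / 2))) / D.den m j

/-- The coefficient `∏_r (x_{mj} - x_{m-1,r} + b / 2) / ∏_{s ≠ j} (x_{mj} - x_{ms})`. -/
def coefB (m : ℕ) (j : Fin m) : K :=
  (∏ r : Fin (m - 1), (D.x m j - D.x (m - 1) r + algebraMap ℂ K (b / 2))) / D.den m j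

/-- The operator `∑_j coefA m j · τ m j`. -/
def opA (m : ℕ) : K →ₗ[ℂ] K :=
  ∑ j, LinearMap.mulLeft ℂ (D.coefA m j) ∘ₗ (D.τ m j).toLinearMap

/-- The operator `∑_j coefB m j · τ m j`. -/
def opB (m : ℕ) : K →ₗ[ℂ] K :=
  ∑ j, LinearMap.mulLeft ℂ (D.coefB m j) ∘ₗ (D.τ m j).toLinearMap

theorem opA_apply (m : ℕ) (f : K) : D.opA m f = ∑ j, D.coefA m j * D.τ m j f := by
  simp [opA, LinearMap.sum_apply]

theorem opB_apply (m : ℕ) (f : K) : D.opB m f = ∑ j, D.coefB m j * D.τ m j f := by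
  simp [opB, LinearMap.sum_apply]

/-- The numerator of `coefA m j` is the value at x_{mj} of one polynomial, the translated node
polynomial of level m + 1. Its coefficients do not depend on j, so the sum is a divided difference.
-/
theorem sum_coefA_mul (m : ℕ) (g : K[X]) :
    ∑ j, D.coefA m j * g.eval (D.x m j) =
      divDiff (D.x m) (translate (b / 2) (nodePoly (D.x (m + 1))) * g) := by
  rw [divDiff_apply]
  refine sum_congr rfl fun j _ => ?_
  rw [eval_mul, translate_eval, nodePoly_eval, coefA, den, div_mul_eq_mul_div]
  simp only [add_sub_right_comm]

theorem sum_coefB_mul (m : ℕ) (g : K[X]) :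
    ∑ j, D.coefB m j * g.eval (D.x m j) =
      divDiff (D.x m) (translate (b / 2) (nodePoly (D.x (m - 1))) * g) := by
  rw [divDiff_apply]
  refine sum_congr rfl fun j _ => ?_
  rw [eval_mul, translate_eval, nodePoly_eval, coefB, den, div_mul_eq_mul_div]
  simp only [add_sub_right_comm]

/-- The algebra of the polynomials symmetric in each level, as the union of the filtration. -/
def symm : Submodule ℂ K where
  carrier := {f | ∃ d, f ∈ D.filt d}
  add_mem' := by
    rintro f g ⟨d, hd⟩ ⟨e, he⟩
    exact ⟨max d e, add_mem (D.filt_mono (le_max_left _ _) hd) (D.filt_mono (le_max_right _ _) he)⟩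
  zero_mem' := ⟨0, zero_mem _⟩
  smul_mem' a f := fun ⟨d, hd⟩ => ⟨d, Submodule.smul_mem _ a hd⟩

theorem opA_mem {m : ℕ} (hm : m < N) {f : K} (hf : f ∈ D.symm) : D.opA m f ∈ D.symm := by
  obtain ⟨d, hd⟩ := hf
  obtain ⟨φ, h1, h2, -⟩ := D.exists_poly_τ hm hd
  have h3 := D.divDiff_mem hm
    (D.polyFilt_mul (D.translate_mem (b / 2) (D.nodePoly_mem (m + 1))) h1)
  rw [← sum_coefA_mul] at h3
  rw [opA_apply, sum_congr rfl fun j _ => by rw [h2 j]]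
  exact ⟨_, h3⟩

theorem opB_mem {m : ℕ} (hm : m < N) {f : K} (hf : f ∈ D.symm) : D.opB m f ∈ D.symm := by
  obtain ⟨d, hd⟩ := hf
  obtain ⟨φ, h1, h2, -⟩ := D.exists_poly_τ hm hd
  have h3 := D.divDiff_mem hm
    (D.polyFilt_mul (D.translate_mem (b / 2) (D.nodePoly_mem (m - 1))) h1)
  rw [← sum_coefB_mul] at h3
  rw [opB_apply, sum_congr rfl fun j _ => by rw [h2 j]]
  exact ⟨_, h3⟩

theorem one_mem_symm : (1 : K) ∈ D.symm := ⟨0, D.one_mem_filt⟩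

theorem symm_mul {f g : K} (hf : f ∈ D.symm) (hg : g ∈ D.symm) : f * g ∈ D.symm := by
  obtain ⟨d, hd⟩ := hf
  obtain ⟨e, he⟩ := hg
  exact ⟨_, D.filt_mul hd he⟩

theorem p_mem_symm (m k : ℕ) : D.p m k ∈ D.symm := ⟨_, D.p_mem m k⟩

/-! #### Iterated commutators of the raising operators -/

/-- The inner sums of the iterated commutators, see `opX`. -/
def inner (n : ℕ) : (d : ℕ) → Fin (n + d) → K →ₗ[ℂ] K
  | 0, _ => LinearMap.id
  | d + 1, l => b • ∑ j : Fin (n + d),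
      LinearMap.mulLeft ℂ (D.coefA (n + d) j /
        (D.x (n + d) j - D.x (n + d + 1) l + algebraMap ℂ K (b / 2))) ∘ₗ
        inner n d j ∘ₗ (D.τ (n + d) j).toLinearMap

theorem inner_succ (n d : ℕ) (l : Fin (n + d + 1)) (f : K) :
    D.inner n (d + 1) l f = algebraMap ℂ K b * ∑ j : Fin (n + d), D.coefA (n + d) j /
        (D.x (n + d) j - D.x (n + d + 1) l + algebraMap ℂ K (b / 2)) *
        D.inner n d j (D.τ (n + d) j f) := by
  rw [inner, LinearMap.smul_apply, LinearMap.sum_apply, Algebra.smul_def]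
  rfl

/-- The commutator of the raising operators of the levels `n`, …, `n + d`. -/
def opX (n d : ℕ) : K →ₗ[ℂ] K :=
  ∑ l : Fin (n + d),
    LinearMap.mulLeft ℂ (D.coefA (n + d) l) ∘ₗ D.inner n d l ∘ₗ (D.τ (n + d) l).toLinearMap

theorem opX_apply (n d : ℕ) (f : K) :
    D.opX n d f = ∑ l, D.coefA (n + d) l * D.inner n d l (D.τ (n + d) l f) := by
  simp [opX, LinearMap.sum_apply]

theorem τ_den {M m : ℕ} (h1 : m ≠ M) (i : Fin M) (j : Fin m) : D.τ M i (D.den m j) = D.den m j := by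
  simp only [den, map_prod, map_sub, D.τ_of_level_ne M i m _ h1]

theorem τ_coefA {M m : ℕ} (h1 : m ≠ M) (h2 : m + 1 ≠ M) (i : Fin M) (j : Fin m) :
    D.τ M i (D.coefA m j) = D.coefA m j := by
  rw [coefA, map_div₀, D.τ_den h1]
  simp only [map_prod, map_sub, map_add, D.τ_of_level_ne M i m _ h1,
    D.τ_of_level_ne M i (m + 1) _ h2, AlgHom.commutes]

theorem inner_mul (n d : ℕ) (l : Fin (n + d)) (y f : K)
    (hy : ∀ m < n + d, ∀ j : Fin m, D.τ m j y = y) :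
    D.inner n d l (y * f) = y * D.inner n d l f := by
  induction d generalizing f with
  | zero => rfl
  | succ d ih =>
    rw [inner_succ, inner_succ, mul_left_comm, mul_sum _ _ y]
    congr 1
    refine sum_congr rfl fun j _ => ?_
    rw [map_mul, hy (n + d) (by omega) j, ih j _ fun m hm => hy m (by omega)]
    rw [mul_left_comm]

theorem τ_inner (n d M : ℕ) (hM : n + d < M) (i : Fin M) (l : Fin (n + d)) (f : K) :
    D.τ M i (D.inner n d l f) = D.inner n d l (D.τ M i f) := by
  induction d generalizing f with
  | zero => rfl
  | succ d ih =>
    rw [inner_succ, inner_succ, map_mul, map_sum, AlgHom.commutes]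
    congr 1
    refine sum_congr rfl fun j _ => ?_
    rw [map_mul, ih (by omega), D.τ_comm, map_div₀ (D.τ M i), D.τ_coefA (by omega) (by omega), map_add,
      map_sub, D.τ_of_level_ne M i _ _ (by omega), D.τ_of_level_ne M i _ _ (by omega),
      AlgHom.commutes]

theorem add_ne_zero {m : ℕ} (hm : m < N) (j : Fin m) (l : Fin (m + 1)) (a : ℂ) :
    D.x m j - D.x (m + 1) l + algebraMap ℂ K a ≠ 0 := by
  intro h
  apply D.sub_ne m hm j l (-a)
  rw [map_neg]
  exact eq_neg_of_add_eq_zero_left h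

/-- Only the factor r = l of the numerator contains x_{m+1,l}, and the shift subtracts b from it.
The difference is b times the remaining factors, which is the coefficient used in `inner`. -/
theorem coefA_sub_τ {m : ℕ} (hm : m + 1 < N) (j : Fin m) (l : Fin (m + 1)) :
    D.coefA m j - D.τ (m + 1) l (D.coefA m j) = algebraMap ℂ K b * (D.coefA m j /
      (D.x m j - D.x (m + 1) l + algebraMap ℂ K (b / 2))) := by
  have h0 := D.add_ne_zero (by omega : m < N) j l (b / 2)
  have e : D.τ (m + 1) l (D.coefA m j) = (D.x m j - D.x (m + 1) l - algebraMap ℂ K b +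
      algebraMap ℂ K (b / 2)) * (∏ r ∈ univ.erase l,
        (D.x m j - D.x (m + 1) r + algebraMap ℂ K (b / 2))) / D.den m j := by
    rw [coefA, map_div₀ (D.τ (m + 1) l), D.τ_den (by omega), map_prod,
      ← mul_prod_erase _ _ (mem_univ l)]
    simp only [map_sub, map_add, AlgHom.commutes, D.τ_of_level_ne (m + 1) l m _ (by omega : m ≠ m + 1),
      D.τ_self (m + 1) hm l]
    congr 2
    · ring
    · exact prod_congr rfl fun r hr => by rw [D.τ_of_ne (m + 1) l r (ne_of_mem_erase hr)]
  rw [e, coefA, ← mul_prod_erase _ _ (mem_univ l)]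
  generalize (∏ r ∈ univ.erase l, (D.x m j - D.x (m + 1) r + algebraMap ℂ K (b / 2))) = P
  rw [div_right_comm, mul_div_assoc, mul_div_cancel_left₀ _ h0]
  ring

/-- Both compositions are double sums over l and j. They differ only in whether the shift of level n
+ d + 1 has acted on `coefA (n + d) j`, so `coefA_sub_τ` evaluates the difference term by term. -/
theorem opX_commutator {n d : ℕ} (h : n + d + 1 < N) (f : K) :
    D.opX n d (D.opA (n + d + 1) f) - D.opA (n + d + 1) (D.opX n d f) = D.opX n (d + 1) f := by
  have e1 : D.opX n d (D.opA (n + d + 1) f) = ∑ l : Fin (n + d + 1), ∑ j : Fin (n + d),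
      D.coefA (n + d + 1) l * (D.coefA (n + d) j *
        D.inner n d j (D.τ (n + d) j (D.τ (n + d + 1) l f))) := by
    rw [opX_apply, sum_comm]
    refine sum_congr rfl fun j _ => ?_
    rw [opA_apply, map_sum, map_sum, mul_sum]
    refine sum_congr rfl fun l _ => ?_
    rw [map_mul, D.τ_coefA (by omega) (by omega), D.inner_mul n d j _ _
      fun m hm i => D.τ_coefA (by omega) (by omega) i l]
    ring
  have e2 : D.opA (n + d + 1) (D.opX n d f) = ∑ l : Fin (n + d + 1), ∑ j : Fin (n + d),
      D.coefA (n + d + 1) l * (D.τ (n + d + 1) l (D.coefA (n + d) j) *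
        D.inner n d j (D.τ (n + d) j (D.τ (n + d + 1) l f))) := by
    rw [opA_apply]
    refine sum_congr rfl fun l _ => ?_
    rw [opX_apply, map_sum, mul_sum]
    refine sum_congr rfl fun j _ => ?_
    rw [map_mul, D.τ_inner n d _ (by omega), D.τ_comm]
  have e3 : D.opX n (d + 1) f = ∑ l : Fin (n + d + 1), ∑ j : Fin (n + d),
      D.coefA (n + d + 1) l * ((algebraMap ℂ K b * (D.coefA (n + d) j /
      (D.x (n + d) j - D.x (n + d + 1) l + algebraMap ℂ K (b / 2)))) *
        D.inner n d j (D.τ (n + d) j (D.τ (n + d + 1) l f))) := by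
    rw [opX_apply]
    refine sum_congr rfl fun l _ => ?_
    rw [inner_succ, mul_sum, mul_sum]
    refine sum_congr rfl fun j _ => ?_
    rw [mul_assoc (algebraMap ℂ K b)]
    rfl
  rw [e1, e2, e3, ← sum_sub_distrib]
  refine sum_congr rfl fun l _ => ?_
  rw [← sum_sub_distrib]
  refine sum_congr rfl fun j _ => ?_
  rw [← mul_sub, ← sub_mul, D.coefA_sub_τ h]

theorem opX_mem {V : Submodule ℂ K} (hA : ∀ m < N, ∀ f ∈ V, D.opA m f ∈ V) {n d : ℕ}
    (h : n + d < N) {f : K} (hf : f ∈ V) : D.opX n d f ∈ V := by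
  induction d generalizing f with
  | zero =>
    have : D.opX n 0 f = D.opA n f := by rw [opX_apply, opA_apply]; rfl
    rw [this]
    exact hA n h f hf
  | succ d ih =>
    rw [← D.opX_commutator h]
    exact sub_mem (ih (by omega) (hA _ h f hf)) (hA _ h _ (ih (by omega) hf))

/-! #### Leading terms -/

theorem divX_iterate_coeff {K : Type*} [Field K] (g : K[X]) (i k : ℕ) : (divX^[i] g).coeff k = g.coeff (k + i) := by
  induction i generalizing k with
  | zero => rfl
  | succ i ih => rw [Function.iterate_succ_apply', coeff_divX, ih, add_assoc, add_comm 1]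

/-- The difference quotient of g, expanded in powers of y: its coefficients are the Horner tails
`divX^[i + 1] g`. -/
theorem eval_sub_mul_sum_divX {K : Type*} [Field K] (g : K[X]) (y t : K) :
    g.eval t - g.eval y =
      (t - y) * ∑ i ∈ range (g.natDegree + 1), y ^ i * (divX^[i + 1] g).eval t := by
  have h : ∀ n, (t - y) * ∑ i ∈ range n, y ^ i * (divX^[i + 1] g).eval t =
      g.eval t - y ^ n * (divX^[n] g).eval t - ∑ i ∈ range n, g.coeff i * y ^ i := by
    intro n
    induction n with
    | zero => simp
    | succ n ih =>
      have e : (divX^[n] g).eval t = (divX^[n + 1] g).eval t * t + g.coeff n := by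
        conv_lhs => rw [← divX_mul_X_add (divX^[n] g)]
        rw [Function.iterate_succ_apply', divX_iterate_coeff, zero_add]
        simp
      rw [sum_range_succ, mul_add, ih, sum_range_succ, e]
      ring
  rw [h, ← eval_eq_sum_range]
  have : divX^[g.natDegree + 1] g = 0 := by
    ext k
    rw [divX_iterate_coeff, coeff_zero]
    exact coeff_eq_zero_of_natDegree_lt (by omega)
  rw [this]
  simp

/-- x_{m+1,l} is a root of the node polynomial of its level, so dividing out one factor yields a
difference quotient. Expanded in powers of x_{m+1,l}, it separates the two levels, and the inner
sums over j become divided differences again. -/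
theorem coefA_div {m : ℕ} (hm : m < N) (j : Fin m) (l : Fin (m + 1)) :
    D.coefA m j / (D.x m j - D.x (m + 1) l + algebraMap ℂ K (b / 2)) =
      (∑ i ∈ range (m + 2), D.x (m + 1) l ^ i *
        (translate (b / 2) (divX^[i + 1] (nodePoly (D.x (m + 1))))).eval (D.x m j)) /
        D.den m j := by
  have h0 := D.add_ne_zero hm j l (b / 2)
  have h := eval_sub_mul_sum_divX (nodePoly (D.x (m + 1))) (D.x (m + 1) l)
    (D.x m j + algebraMap ℂ K (b / 2))
  have h1 : (nodePoly (D.x (m + 1))).eval (D.x (m + 1) l) = 0 := by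
    rw [nodePoly_eval]; exact prod_eq_zero (mem_univ l) (sub_self _)
  rw [h1, sub_zero, nodePoly_natDegree, nodePoly_eval] at h
  simp only [translate_eval]
  rw [coefA, div_right_comm]
  congr 1
  rw [div_eq_iff h0, mul_comm, ← add_sub_right_comm, ← h]
  exact prod_congr rfl fun r _ => by ring

/-- The leading term of `inner n d`, as a polynomial. -/
def IsSymbol (n d : ℕ) (G : K[X]) : Prop :=
  ∀ (e : ℤ) (f : K), f ∈ D.filt e → ∃ g ∈ D.polyFilt (e + d),
    (∀ l, D.inner n d l (D.τ (n + d) l f) = g.eval (D.x (n + d) l)) ∧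
    g - C (algebraMap ℂ K (b ^ d) * f) * G ∈ D.polyFilt (e + d - 1)

/-- This is the step from d to d + 1 for the leading term, before the shift of level n + d + 1 is
applied to f. Replacing the translated tails of the node polynomial by the plain ones, and g by its
leading term, costs one unit of weight each time. -/
theorem exists_poly_inner_succ {n d : ℕ} (h : n + d + 1 < N) {G : K[X]} (hs : D.IsSymbol n d G) (e : ℤ) (f : K) (hf : f ∈ D.filt e) :
    ∃ ψ ∈ D.polyFilt (e + d + 1),
      (∀ l, D.inner n (d + 1) l f = ψ.eval (D.x (n + d + 1) l)) ∧
      ψ - C (algebraMap ℂ K (b ^ (d + 1)) * f) * (∑ i ∈ range (n + d + 2), X ^ i *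
        C (divDiff (D.x (n + d)) (divX^[i + 1] (nodePoly (D.x (n + d + 1))) * G))) ∈
        D.polyFilt (e + d) := by
  obtain ⟨g, h1, h2, h3⟩ := hs e f hf
  set m := n + d with hm
  have hm' : m < N := by omega
  set Q := nodePoly (D.x (m + 1)) with hQ
  have hQi : ∀ i : ℕ, divX^[i + 1] Q ∈ D.polyFilt (m - i) := fun i =>
    D.polyFilt_mono (by push_cast; omega) (D.divX_iterate_mem (D.nodePoly_mem (m + 1)) (i + 1))
  refine ⟨C (algebraMap ℂ K b) * ∑ i ∈ range (m + 2), X ^ i *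
      C (divDiff (D.x m) (translate (b / 2) (divX^[i + 1] Q) * g)), ?_, fun l => ?_, ?_⟩
  · refine D.polyFilt_mul_mem (D.C_mem (D.algebraMap_mem_filt b))
      (sum_mem fun i _ => D.polyFilt_mul_mem (D.X_pow_mem i) (D.C_mem (D.divDiff_mem hm'
        (D.polyFilt_mul (D.translate_mem _ (hQi i)) h1))) le_rfl |> D.polyFilt_mono ?_)
      (zero_add _).le
    omega
  · rw [inner_succ, eval_mul, eval_C]
    congr 1
    rw [eval_finsetSum]
    simp only [eval_mul, eval_pow, eval_X, eval_C, divDiff_apply, mul_sum]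
    rw [sum_comm]
    refine sum_congr rfl fun j _ => ?_
    have e := D.coefA_div hm' j l
    rw [h2 j]
    refine (congrArg (· * g.eval (D.x m j)) e).trans ?_
    rw [div_mul_eq_mul_div, sum_mul, sum_div]
    refine sum_congr rfl fun i _ => ?_
    rw [den]
    ring
  · have e1 : C (algebraMap ℂ K b) * ∑ i ∈ range (m + 2), X ^ i *
          C (divDiff (D.x m) (translate (b / 2) (divX^[i + 1] Q) * g)) -
        C (algebraMap ℂ K (b ^ (d + 1)) * f) * (∑ i ∈ range (m + 2), X ^ i *
          C (divDiff (D.x m) (divX^[i + 1] Q * G))) =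
        C (algebraMap ℂ K b) * ∑ i ∈ range (m + 2), X ^ i *
          C (divDiff (D.x m) ((translate (b / 2) (divX^[i + 1] Q) - divX^[i + 1] Q) * g +
            divX^[i + 1] Q * (g - C (algebraMap ℂ K (b ^ d) * f) * G))) := by
      rw [mul_sum, mul_sum, mul_sum, ← sum_sub_distrib]
      refine sum_congr rfl fun i _ => ?_
      have e2 : (translate (b / 2) (divX^[i + 1] Q) - divX^[i + 1] Q) * g +
            divX^[i + 1] Q * (g - C (algebraMap ℂ K (b ^ d) * f) * G) =
          translate (b / 2) (divX^[i + 1] Q) * g -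
            C (algebraMap ℂ K (b ^ d) * f) * (divX^[i + 1] Q * G) := by ring
      rw [e2, map_sub, divDiff_C_mul, pow_succ, map_mul (algebraMap ℂ K)]
      simp only [C_mul, C_sub]
      ring
    rw [e1]
    refine D.polyFilt_mul_mem (D.C_mem (D.algebraMap_mem_filt b))
      (sum_mem fun i _ => D.polyFilt_mono ?_ (D.polyFilt_mul (D.X_pow_mem i) (D.C_mem
        (D.divDiff_mem (d := m - i + (e + d) - 1) hm' (add_mem
          (D.polyFilt_mul_mem (D.translate_sub_mem _ (hQi i)) h1 (by omega))
          (D.polyFilt_mul_mem (hQi i) h3 (by omega)))))))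
      (zero_add _).le
    omega

theorem natDegree_le {d : ℕ} {g : K[X]} (hg : g ∈ D.polyFilt d) : g.natDegree ≤ d := by
  rw [natDegree_le_iff_coeff_eq_zero]
  exact fun i hi => D.coeff_eq_zero hg (by exact_mod_cast hi)

/-- The point is that the top coefficient of the symbol equals 1: this normalisation later gives the
new power sum a nonzero coefficient. -/
theorem exists_symbol (n d : ℕ) (hn : 1 ≤ n) (h : n + d < N) :
    ∃ G ∈ D.polyFilt d, G.coeff d = 1 ∧ D.IsSymbol n d G := by
  induction d with
  | zero =>
    refine ⟨1, by simpa using D.C_mem D.one_mem_filt, by simp, fun e f hf => ?_⟩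
    obtain ⟨φ, h1, h2, h3⟩ := D.exists_poly_τ (m := n + 0) h hf
    exact ⟨φ, by simpa using h1, h2, by simpa using h3⟩
  | succ d ih =>
    obtain ⟨G, hG, hG1, hs⟩ := ih (by omega)
    have hm' : n + d < N := by omega
    set m := n + d with hm
    set Q := nodePoly (D.x (m + 1)) with hQ
    have hQi : ∀ i : ℕ, divX^[i + 1] Q ∈ D.polyFilt (m - i) := fun i =>
      D.polyFilt_mono (by push_cast; omega) (D.divX_iterate_mem (D.nodePoly_mem (m + 1)) (i + 1))
    set G' : K[X] := ∑ i ∈ range (m + 2), X ^ i * C (divDiff (D.x m) (divX^[i + 1] Q * G)) with hG'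
    have hG'm : G' ∈ D.polyFilt (d + 1) := by
      refine sum_mem fun i _ => D.polyFilt_mono ?_ (D.polyFilt_mul (D.X_pow_mem i)
        (D.C_mem (D.divDiff_mem hm' (D.polyFilt_mul (hQi i) hG))))
      omega
    refine ⟨G', by exact_mod_cast hG'm, ?_, fun e f hf => ?_⟩
    -- The coefficient of X ^ (d + 1) is the divided difference of a monic polynomial of degree m -
    -- 1, which is 1. The condition 1 ≤ n ensures d + 1 ≤ m, so that m - 1 - d is not truncated.
    · rw [hG', finsetSum_coeff, sum_eq_single (d + 1)]
      · rw [coeff_mul_C, coeff_X_pow_self, one_mul]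
        have hQd : divX^[d + 1 + 1] Q ∈ D.polyFilt ((m - 1 - d : ℕ) : ℤ) :=
          D.polyFilt_mono (by push_cast; omega) (hQi (d + 1))
        have hdeg : (divX^[d + 1 + 1] Q * G).natDegree ≤ m - 1 := by
          refine natDegree_mul_le.trans ?_
          have := D.natDegree_le hQd
          have := D.natDegree_le hG
          omega
        rw [divDiff_of_lt (D.x_injective m hm')]
        · have := coeff_mul_add_eq_of_natDegree_le (D.natDegree_le hQd) (D.natDegree_le hG)
          rw [show m - 1 - d + d = m - 1 by omega] at this
          rw [this, hG1, mul_one, divX_iterate_coeff, show m - 1 - d + (d + 1 + 1) = m + 1 by omega]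
          have := (nodePoly_monic (D.x (m + 1))).coeff_natDegree
          rwa [nodePoly_natDegree] at this
        · refine lt_of_le_of_lt (degree_le_of_natDegree_le hdeg) ?_
          exact_mod_cast (by omega : m - 1 < m)
      · intro i _ hi
        rw [coeff_mul_C, coeff_X_pow, if_neg (Ne.symm hi), zero_mul]
      · intro hd
        rw [mem_range] at hd
        omega
    -- The shifted f is φ(x_{m+1,l}). The operators in `inner` shift only lower levels, so the
    -- powers of x_{m+1,l} come out and the previous step applies to each coefficient of φ, of
    -- weight e - i.
    · obtain ⟨φ, h1, h2, h3⟩ := D.exists_poly_τ (m := m + 1) h hf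
      choose ψ k1 k2 k3 using fun i : ℕ =>
        D.exists_poly_inner_succ h hs (e - i) (φ.coeff i) (h1 i)
      refine ⟨∑ i ∈ range (φ.natDegree + 1), X ^ i * ψ i, ?_, fun l => ?_, ?_⟩
      · refine sum_mem fun i _ => D.polyFilt_mul_mem (D.X_pow_mem i) (k1 i) ?_
        push_cast; omega
      · have e1 : D.τ (n + (d + 1)) l f = _ := h2 l
        rw [e1, eval_eq_sum_range, map_sum, eval_finsetSum]
        refine sum_congr rfl fun i _ => ?_
        have e2 := D.inner_mul n (d + 1) l (D.x (m + 1) l ^ i) (φ.coeff i) fun M hM j => by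
          rw [map_pow, D.τ_of_level_ne M j _ _ (by omega)]
        rw [mul_comm (φ.coeff i), e2, eval_mul, eval_pow, eval_X, k2 i]
        rfl
      · have e1 : ∑ i ∈ range (φ.natDegree + 1), X ^ i * ψ i -
            C (algebraMap ℂ K (b ^ (d + 1)) * f) * G' =
            ∑ i ∈ range (φ.natDegree + 1), X ^ i *
              (ψ i - C (algebraMap ℂ K (b ^ (d + 1)) * φ.coeff i) * G') +
            (φ - C f) * (C (algebraMap ℂ K (b ^ (d + 1))) * G') := by
          have e2 : ∑ i ∈ range (φ.natDegree + 1), X ^ i *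
              (C (algebraMap ℂ K (b ^ (d + 1)) * φ.coeff i) * G') =
              φ * (C (algebraMap ℂ K (b ^ (d + 1))) * G') := by
            conv_rhs => rw [φ.as_sum_range_C_mul_X_pow, sum_mul]
            refine sum_congr rfl fun i _ => ?_
            rw [C_mul]
            ring
          simp only [mul_sub, sum_sub_distrib]
          rw [e2, C_mul]
          ring
        rw [e1]
        refine add_mem (sum_mem fun i _ => D.polyFilt_mul_mem (D.X_pow_mem i) (k3 i) ?_)
          (D.polyFilt_mul_mem h3 (D.polyFilt_mul (D.C_mem (D.algebraMap_mem_filt _)) hG'm) ?_)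
        · push_cast; omega
        · push_cast; omega

end ShiftArray

end

section

namespace ShiftArray

open Polynomial Finset

variable {N : ℕ} {K : Type*} [Field K] [Algebra ℂ K] {b : ℂ} (D : ShiftArray N K b)

/-! #### Decomposable elements and cyclicity -/

/-- The decomposable elements of weight `k`, modulo terms of lower weight. -/
def decomp (k : ℕ) : Submodule ℂ K :=
  D.filt (k - 1) ⊔ Submodule.span ℂ {y | ∃ (m j : ℕ) (g : K),
    m < N ∧ 1 ≤ j ∧ j < k ∧ g ∈ D.filt (k - j) ∧ y = D.p m j * g}

theorem filt_le_decomp (k : ℕ) : D.filt (k - 1) ≤ D.decomp k := le_sup_left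

/-- The strict bounds on both factors are what matters: a nonconstant monomial of y offers a power
sum to split off, and a constant one leaves a multiple of z, of weight below k. -/
theorem mul_mem_decomp {d e : ℤ} {k : ℕ} {y z : K} (hy : y ∈ D.filt d) (hz : z ∈ D.filt e)
    (hd : d < k) (he : e < k) (h : d + e ≤ k) : y * z ∈ D.decomp k := by
  induction hy using Submodule.span_induction with
  | zero => simp
  | add u v _ _ hu hv => rw [add_mul]; exact add_mem hu hv
  | smul a u _ hu => rw [smul_mul_assoc]; exact Submodule.smul_mem _ _ hu
  | mem u hu =>
    obtain ⟨s, h1, h2, rfl⟩ := hu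
    induction s using Multiset.induction_on with
    | empty =>
      refine D.filt_le_decomp k ?_
      simpa using D.filt_mono (by omega) hz
    | cons i s _ =>
      have hi := h1 i (Multiset.mem_cons_self i s)
      rw [Multiset.map_cons, Multiset.sum_cons] at h2
      push_cast at h2
      have h3 : ((s.map Prod.snd).sum : ℤ) ≤ d - i.2 := by push_cast; linarith
      have hpos : (0 : ℤ) ≤ ((s.map Prod.snd).sum : ℕ) := by positivity
      refine (le_sup_right : _ ≤ D.decomp k) (Submodule.subset_span ⟨i.1, i.2,
        (s.map fun i => D.p i.1 i.2).prod * z, hi.1, hi.2, by omega, ?_, ?_⟩)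
      · exact D.filt_prod_mem (d := d - i.2) (Submodule.subset_span
          ⟨s, fun j hj => h1 j (Multiset.mem_cons_of_mem hj), h3, rfl⟩) hz (by omega)
      · rw [Multiset.map_cons, Multiset.prod_cons, mul_assoc]

/-- In Newton's identity every term except a = (0, k) is a product of two elements of weight below
k. -/
theorem mul_signedEsymm_add_p (m : ℕ) {k : ℕ} (hk : 1 ≤ k) :
    (k : K) * signedEsymm (D.x m) k + D.p m k ∈ D.decomp k := by
  rw [newton_identity]
  have h0 : ((0, k) : ℕ × ℕ) ∈ (antidiagonal k).filter (fun a => a.1 < k) := by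
    simp; omega
  rw [← add_sum_erase _ _ h0, signedEsymm_zero, one_mul, neg_add, add_right_comm]
  have : -powerSum (D.x m) k + D.p m k = 0 := by rw [p]; ring
  simp only [this, zero_add]
  refine neg_mem (sum_mem fun a ha => ?_)
  rw [mem_erase, mem_filter, HasAntidiagonal.mem_antidiagonal] at ha
  have h1 : 1 ≤ a.1 := by
    by_contra h
    exact ha.1 (Prod.ext (by simp; omega) (by simp; omega))
  exact D.mul_mem_decomp (D.signedEsymm_mem m a.1) (D.p_mem m a.2) (by omega) (by omega) (by omega)

/-- With fewer than k variables the elementary symmetric function of degree k is zero, so the power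
sum is decomposable. -/
theorem p_mem_decomp {m k : ℕ} (h : m < k) : D.p m k ∈ D.decomp k := by
  have := D.mul_signedEsymm_add_p m (by omega : 1 ≤ k)
  rwa [signedEsymm_of_lt _ h, mul_zero, zero_add] at this

/-- The divided difference of `X ^ (a + i)` of weight `k`, times a function of the complementary
weight, is decomposable unless one of the factors has weight zero. -/
theorem divDiff_add_signedEsymm {m k : ℕ} (hm : m < N) (hm1 : 1 ≤ m) (hk : 1 ≤ k) :
    divDiff (D.x m) (X ^ (m - 1 + k)) + signedEsymm (D.x m) k ∈ D.decomp k := by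
  have e : m - 1 + k = k - 1 + m := by omega
  rw [e, divDiff_X_pow_add]
  -- In the recurrence only a = m - k pairs a factor of full weight k with the constant 1. Smaller a
  -- give zero, and larger a give two factors of weight below k.
  have key : ∀ a ∈ range m, a + k ≠ m →
      signedEsymm (D.x m) (m - a) * divDiff (D.x m) (X ^ (k - 1 + a)) ∈ D.decomp k := by
    intro a ha hak
    rw [mem_range] at ha
    rcases lt_or_gt_of_ne hak with h | h
    · rw [divDiff_X_pow_of_lt (D.x_injective m hm) (by omega), mul_zero]
      exact zero_mem _
    · exact D.mul_mem_decomp (D.signedEsymm_mem m (m - a)) (D.divDiff_X_pow_mem hm _)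
        (by omega) (by omega) (by omega)
  rcases Nat.lt_or_ge m k with h | h
  · rw [signedEsymm_of_lt _ h, add_zero]
    exact neg_mem (sum_mem fun a ha => key a ha (by omega))
  · rw [← add_sum_erase _ _ (mem_range.mpr (by omega : m - k < m)),
      divDiff_X_pow_self (D.x_injective m hm) (by omega), show m - (m - k) = k by omega, mul_one,
      neg_add, add_right_comm, neg_add_cancel, zero_add]
    refine neg_mem (sum_mem fun a ha => ?_)
    rw [mem_erase] at ha
    exact key a ha.2 (by omega)

/-- After expansion of the node polynomial of level m + 1 two terms are not decomposable: a = m + 1,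
with coefficient 1, contributes the elementary symmetric function of level m, and a = m - 1 - d,
with divided difference 1, that of level m + 1. -/
theorem divDiff_nodePoly_X_pow {m d : ℕ} (hm : m < N) (hd : d + 1 ≤ m) :
    divDiff (D.x m) (nodePoly (D.x (m + 1)) * X ^ d) + signedEsymm (D.x m) (d + 2) -
      signedEsymm (D.x (m + 1)) (d + 2) ∈ D.decomp (d + 2) := by
  have h := D.divDiff_add_signedEsymm (k := d + 2) hm (by omega) (by omega)
  have e : divDiff (D.x m) (nodePoly (D.x (m + 1)) * X ^ d) =
      ∑ a ∈ range (m + 2), signedEsymm (D.x (m + 1)) (m + 1 - a) *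
        divDiff (D.x m) (X ^ (a + d)) := by
    rw [(nodePoly (D.x (m + 1))).as_sum_range_C_mul_X_pow, nodePoly_natDegree, sum_mul, map_sum]
    refine sum_congr rfl fun a ha => ?_
    rw [mem_range] at ha
    rw [nodePoly_coeff _ (by omega), mul_assoc, divDiff_C_mul, pow_add]
  have h1 : m + 1 ∈ range (m + 2) := by simp
  have h2 : m - 1 - d ∈ (range (m + 2)).erase (m + 1) := by simp; omega
  rw [e, ← add_sum_erase _ _ h1, ← add_sum_erase _ _ h2, Nat.sub_self, signedEsymm_zero, one_mul,
    divDiff_X_pow_self (i := m - 1 - d + d) (D.x_injective m hm) (by omega), mul_one,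
    show m + 1 - (m - 1 - d) = d + 2 by omega, show m + 1 + d = m - 1 + (d + 2) by omega]
  have hr : ∑ a ∈ ((range (m + 2)).erase (m + 1)).erase (m - 1 - d),
      signedEsymm (D.x (m + 1)) (m + 1 - a) * divDiff (D.x m) (X ^ (a + d)) ∈ D.decomp (d + 2) := by
    refine sum_mem fun a ha => ?_
    rw [mem_erase, mem_erase, mem_range] at ha
    obtain ⟨ha1, ha2, ha3⟩ := ha
    rcases lt_or_gt_of_ne ha1 with h | h
    · rw [divDiff_X_pow_of_lt (D.x_injective m hm) (by omega), mul_zero]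
      exact zero_mem _
    · exact D.mul_mem_decomp (D.signedEsymm_mem (m + 1) (m + 1 - a)) (D.divDiff_X_pow_mem hm _)
        (by push_cast; omega) (by push_cast; omega) (by push_cast; omega)
  convert add_mem h hr using 1
  ring

/-- The lower coefficients of G contribute only decomposable terms, and Newton's identity replaces
the elementary symmetric functions of both levels by power sums. -/
theorem divDiff_nodePoly_mul_mem {m d : ℕ} (hm : m < N) (hd : d + 1 ≤ m) {G : K[X]}
    (hG : G ∈ D.polyFilt d) (hG1 : G.coeff d = 1) :
    ((d + 2 : ℕ) : K) * divDiff (D.x m) (nodePoly (D.x (m + 1)) * G) - (D.p m (d + 2) -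
      D.p (m + 1) (d + 2)) ∈ D.decomp (d + 2) := by
  have h1 := D.divDiff_nodePoly_X_pow hm hd
  have h2 := D.mul_signedEsymm_add_p m (k := d + 2) (by omega)
  have h3 := D.mul_signedEsymm_add_p (m + 1) (k := d + 2) (by omega)
  have e : divDiff (D.x m) (nodePoly (D.x (m + 1)) * G) =
      divDiff (D.x m) (nodePoly (D.x (m + 1)) * X ^ d) + ∑ i ∈ range d, G.coeff i *
        divDiff (D.x m) (nodePoly (D.x (m + 1)) * X ^ i) := by
    conv_lhs => rw [G.as_sum_range_C_mul_X_pow' (n := d + 1)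
      (by have := D.natDegree_le hG; omega), sum_range_succ, hG1, C_1, one_mul, mul_add, map_add,
      add_comm, mul_sum, map_sum]
    congr 1
    refine sum_congr rfl fun i _ => ?_
    rw [mul_left_comm, divDiff_C_mul]
  have h4 : ∑ i ∈ range d, G.coeff i * divDiff (D.x m) (nodePoly (D.x (m + 1)) * X ^ i) ∈
      D.decomp (d + 2) := by
    refine sum_mem fun i hi => ?_
    rw [mem_range] at hi
    exact D.mul_mem_decomp (hG i) (D.divDiff_mem hm (D.polyFilt_mul (D.nodePoly_mem (m + 1))
      (D.X_pow_mem i))) (by push_cast; omega) (by push_cast; omega) (by push_cast; omega)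
  have h5 := Submodule.smul_mem _ ((d + 2 : ℕ) : ℂ) (add_mem h1 h4)
  rw [Algebra.smul_def, map_natCast] at h5
  rw [e]
  convert sub_mem (add_mem h5 h3) h2 using 1
  ring

theorem mul_mem_of_decomp {V : Submodule ℂ K} {k : ℕ} {e : ℤ} (hV : D.filt (e - 1) ≤ V)
    (hk : ∀ j < k, 1 ≤ j → ∀ m < N, ∀ f ∈ D.filt (e - j), D.p m j * f ∈ V)
    {y f : K} (hy : y ∈ D.decomp k) (hf : f ∈ D.filt (e - k)) : y * f ∈ V := by
  have : D.decomp k ≤ V.comap (LinearMap.mulRight ℂ f) := by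
    refine sup_le (fun z hz => hV (D.filt_prod_mem hz hf (by omega))) (Submodule.span_le.mpr ?_)
    rintro _ ⟨m, j, g, h1, h2, h3, h4, rfl⟩
    change D.p m j * g * f ∈ V
    rw [mul_assoc]
    exact hk j h3 h2 m h1 _ (D.filt_prod_mem h4 hf (by omega))
  exact this hy

/-- Strong induction on k disposes of decomposable elements. For k = d + 2 ≤ m the commutator `opX
(m - d) d` applied to f gives (p_{m,k} - p_{m+1,k}) f, up to a nonzero factor and elements already
in V. A second induction runs through the levels from the top; for m < k the power sum is itself
decomposable. -/
theorem p_mul_mem {V : Submodule ℂ K} (hb : b ≠ 0) (hA : ∀ m < N, ∀ f ∈ V, D.opA m f ∈ V)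
    (hp : ∀ m < N, ∀ f ∈ V, D.p m 1 * f ∈ V) {e : ℤ} (hV : D.filt (e - 1) ≤ V)
    (k : ℕ) (hk1 : 1 ≤ k) (m : ℕ) (hm : m < N) {f : K} (hf : f ∈ D.filt (e - k)) :
    D.p m k * f ∈ V := by
  induction k using Nat.strong_induction_on generalizing m f with
  | _ k ih =>
    have hfV : f ∈ V := hV (D.filt_mono (by omega) hf)
    obtain rfl | ⟨d, rfl⟩ : k = 1 ∨ ∃ d, k = d + 2 := by
      rcases k with _ | _ | d
      · omega
      · exact Or.inl rfl
      · exact Or.inr ⟨d, rfl⟩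
    · exact hp m hm f hfV
    have hJ : ∀ y ∈ D.decomp (d + 2), y * f ∈ V := fun y hy =>
      D.mul_mem_of_decomp hV (fun j hj hj1 m hm f hf => ih j hj hj1 m hm hf) hy hf
    have hstep : ∀ m < N, d + 2 ≤ m → (D.p m (d + 2) - D.p (m + 1) (d + 2)) * f ∈ V := by
      intro m hm hdm
      obtain ⟨n, rfl⟩ : ∃ n, m = n + d := ⟨m - d, by omega⟩
      obtain ⟨G, hG, hG1, hs⟩ := D.exists_symbol n d (by omega) hm
      obtain ⟨g, g1, g2, g3⟩ := hs _ f hf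
      have h1 : D.opX n d f = divDiff (D.x (n + d))
          (translate (b / 2) (nodePoly (D.x (n + d + 1))) * g) := by
        rw [opX_apply, ← sum_coefA_mul]
        exact sum_congr rfl fun l _ => by rw [g2 l]
      set Q := nodePoly (D.x (n + d + 1)) with hQ
      have hQm : Q ∈ D.polyFilt (n + d + 1 : ℕ) := D.nodePoly_mem _
      have h2 : algebraMap ℂ K (b ^ d) * (f * divDiff (D.x (n + d)) (Q * G)) ∈ V := by
        have e1 : translate (b / 2) Q * g = (translate (b / 2) Q - Q) * g +
            Q * (g - C (algebraMap ℂ K (b ^ d) * f) * G) +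
            C (algebraMap ℂ K (b ^ d) * f) * (Q * G) := by ring
        have h3 := D.opX_mem hA hm hfV
        rw [h1, e1, map_add, divDiff_C_mul] at h3
        have h4 : divDiff (D.x (n + d)) ((translate (b / 2) Q - Q) * g +
            Q * (g - C (algebraMap ℂ K (b ^ d) * f) * G)) ∈ V := by
          refine hV (D.filt_mono ?_ (D.divDiff_mem (d := e - (d + 2 : ℕ) + d + (n + d)) hm
            (add_mem (D.polyFilt_mul_mem (D.translate_sub_mem _ hQm) g1 ?_)
              (D.polyFilt_mul_mem hQm g3 ?_)))) <;> push_cast <;> omega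
        have h5 := sub_mem h3 h4
        rwa [add_sub_cancel_left, mul_assoc] at h5
      have h3 : f * divDiff (D.x (n + d)) (Q * G) ∈ V := by
        have := V.smul_mem (b ^ d)⁻¹ h2
        rwa [← Algebra.smul_def, smul_smul, inv_mul_cancel₀ (pow_ne_zero d hb), one_smul] at this
      have h4 := hJ _ (D.divDiff_nodePoly_mul_mem hm (by omega) hG hG1)
      have h5 := V.smul_mem ((d + 2 : ℕ) : ℂ) h3
      rw [Algebra.smul_def, map_natCast] at h5
      convert sub_mem h5 h4 using 1
      ring
    obtain ⟨t, ht⟩ : ∃ t, m + t + 1 = N := ⟨N - 1 - m, by omega⟩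
    induction t generalizing m with
    | zero =>
      rcases Nat.lt_or_ge m (d + 2) with h | h
      · exact hJ _ (D.p_mem_decomp h)
      -- Here m + 1 = N: the power sum of the constant level has weight 0, so the product lies in a
      -- lower step of the filtration.
      · have h1 : D.p (m + 1) (d + 2) * f ∈ V :=
          hV (D.filt_prod_mem (D.p_top _ _ (by omega)) hf (by push_cast; omega))
        have := add_mem (hstep m hm h) h1
        rwa [sub_mul, sub_add_cancel] at this
    | succ t iht =>
      rcases Nat.lt_or_ge m (d + 2) with h | h
      · exact hJ _ (D.p_mem_decomp h)
      · have := add_mem (hstep m hm h) (iht (m + 1) (by omega) (by omega))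
        rwa [sub_mul, sub_add_cancel] at this

/-- Induction on the weight: a monomial is a power sum times a monomial whose weight is smaller by
k, which is the situation of `p_mul_mem`. -/
theorem symm_le {V : Submodule ℂ K} (hb : b ≠ 0) (h1 : 1 ∈ V)
    (hA : ∀ m < N, ∀ f ∈ V, D.opA m f ∈ V)
    (hp : ∀ m < N, ∀ f ∈ V, D.p m 1 * f ∈ V) : D.symm ≤ V := by
  have key : ∀ e : ℕ, D.filt (e - 1) ≤ V := by
    intro e
    induction e with
    | zero =>
      intro y hy
      rw [D.filt_neg (by simp) hy]
      exact zero_mem _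
    | succ e ih =>
      rw [filt, Submodule.span_le]
      rintro _ ⟨s, h2, h3, rfl⟩
      induction s using Multiset.induction_on with
      | empty => simpa using h1
      | cons i s _ =>
        have hi := h2 i (Multiset.mem_cons_self i s)
        rw [Multiset.map_cons, Multiset.sum_cons] at h3
        rw [Multiset.map_cons, Multiset.prod_cons]
        push_cast at h3
        refine D.p_mul_mem hb hA hp ih i.2 hi.2 i.1 hi.1 (Submodule.subset_span
          ⟨s, fun j hj => h2 j (Multiset.mem_cons_of_mem hj), ?_, rfl⟩)
        push_cast
        linarith
  rintro f ⟨d, hd⟩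
  exact key (d + 1).toNat (D.filt_mono (by omega) hd)

end ShiftArray

end

/-! ### Both Whittaker modules in terms of symmetric polynomials. -/

section

open Finset

/-! ### The shift array of the meromorphic functions -/

variable {N : ℕ}

instance : CommRing (Entire N) := inferInstance
instance : Algebra ℂ (Entire N) := inferInstance
instance : Field (Mero N) := inferInstance
instance : CommRing (Mero N) := inferInstance
instance : Ring (Mero N) := inferInstance
instance : AddCommGroup (Mero N) := inferInstance
instance : AddCommMonoid (Mero N) := inferInstance
instance : Algebra ℂ (Mero N) := inferInstance
instance : Module ℂ (Mero N) := inferInstance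
instance : Algebra (Entire N) (Mero N) := inferInstance

instance {A : Type*} [Semiring A] [Algebra ℂ A] : CoeFun (A →ₐ[ℂ] Mero N) fun _ => A → Mero N :=
  ⟨DFunLike.coe⟩

instance {A : Type*} [Semiring A] [Algebra ℂ A] : CoeFun (A ≃ₐ[ℂ] Mero N) fun _ => A → Mero N :=
  ⟨DFunLike.coe⟩

/-- The shift `F(γ) ↦ F(γ + c e_p)`, as an algebra automorphism. -/
def shiftAlg (p : Label N) (c : ℂ) : Mero N ≃ₐ[ℂ] Mero N :=
  IsFractionRing.algEquivOfAlgEquiv (translateEquiv p c)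

theorem shift_apply (p : Label N) (c : ℂ) (F : Mero N) : shift p c F = shiftAlg p c F := rfl

theorem shiftAlg_toMero (p : Label N) (c : ℂ) (f : Entire N) :
    shiftAlg p c (toMero f) = toMero (translateHom p c f) :=
  IsFractionRing.algEquivOfAlgEquiv_algebraMap _ _

theorem toMero_injective : Function.Injective (toMero : Entire N → Mero N) :=
  IsFractionRing.injective (Entire N) (Mero N)

theorem algebraMap_mero (a : ℂ) : algebraMap ℂ (Mero N) a = toMero (cst N a) :=
  IsScalarTower.algebraMap_apply ℂ (Entire N) (Mero N) a

theorem entire_ext {f g : Entire N} (h : ∀ z, f.1 z = g.1 z) : f = g := Subtype.ext (funext h)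

theorem translateHom_apply (p : Label N) (c : ℂ) (f : Entire N) (z : Label N → ℂ) :
    (translateHom p c f).1 z = f.1 (z + Pi.single p c) := rfl

theorem cst_apply (a : ℂ) (z : Label N → ℂ) : (cst N a).1 z = a := rfl

theorem entire_add_apply (f g : Entire N) (z : Label N → ℂ) : (f + g).1 z = f.1 z + g.1 z := rfl

theorem entire_sub_apply (f g : Entire N) (z : Label N → ℂ) : (f - g).1 z = f.1 z - g.1 z := rfl

theorem entire_mul_apply (f g : Entire N) (z : Label N → ℂ) : (f * g).1 z = f.1 z * g.1 z := rfl

theorem entire_smul_apply (a : ℂ) (f : Entire N) (z : Label N → ℂ) : (a • f).1 z = a * f.1 z := rfl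

/-- Evaluation of entire functions at a point. -/
def evalHom (z : Label N → ℂ) : Entire N →ₐ[ℂ] ℂ where
  toFun f := f.1 z
  map_one' := rfl
  map_mul' _ _ := rfl
  map_zero' := rfl
  map_add' _ _ := rfl
  commutes' _ := rfl

theorem evalHom_apply (z : Label N → ℂ) (f : Entire N) : evalHom z f = f.1 z := rfl

variable (γN : Fin N → ℂ)

theorem entry_of_lt {n : ℕ} (h : n < N) (j : Fin n) :
    entry γN n j = coordinate ⟨⟨n, h⟩, j⟩ := dif_pos h

theorem entry_apply_of_lt {n : ℕ} (h : n < N) (j : Fin n) (z : Label N → ℂ) :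
    (entry γN n j).1 z = z ⟨⟨n, h⟩, j⟩ := by rw [entry_of_lt γN h]; rfl

theorem exists_entry_eq_cst {n : ℕ} (h : N ≤ n) (j : Fin n) : ∃ a, entry γN n j = cst N a := by
  rw [entry, dif_neg (by omega)]
  split_ifs with h'
  · exact ⟨_, rfl⟩
  · exact ⟨0, by rw [cst, map_zero]⟩

theorem translateHom_entry_self {n : ℕ} (h : n < N) (j : Fin n) (c : ℂ) :
    translateHom ⟨⟨n, h⟩, j⟩ c (entry γN n j) = entry γN n j + cst N c := by
  apply entire_ext
  intro z
  rw [translateHom_apply, entire_add_apply, entry_apply_of_lt γN h, entry_apply_of_lt γN h,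
    Pi.add_apply, Pi.single_eq_same, cst_apply]

theorem translateHom_entry_of_ne {n : ℕ} (h : n < N) (j i : Fin n) (hij : i ≠ j) (c : ℂ) :
    translateHom ⟨⟨n, h⟩, j⟩ c (entry γN n i) = entry γN n i := by
  apply entire_ext
  intro z
  rw [translateHom_apply, entry_apply_of_lt γN h, entry_apply_of_lt γN h,
    Pi.add_apply, Pi.single_eq_of_ne, add_zero]
  intro h
  rw [Sigma.mk.inj_iff] at h
  exact hij (eq_of_heq h.2)

theorem translateHom_entry_of_level_ne {n : ℕ} (h : n < N) (j : Fin n) (c : ℂ) {m : ℕ}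
    (hm : m ≠ n) (i : Fin m) :
    translateHom ⟨⟨n, h⟩, j⟩ c (entry γN m i) = entry γN m i := by
  rcases Nat.lt_or_ge m N with h' | h'
  · apply entire_ext
    intro z
    rw [translateHom_apply, entry_apply_of_lt γN h', entry_apply_of_lt γN h',
      Pi.add_apply, Pi.single_eq_of_ne, add_zero]
    intro h
    rw [Sigma.mk.inj_iff] at h
    exact hm (congrArg Fin.val h.1)
  · obtain ⟨a, ha⟩ := exists_entry_eq_cst γN h' i
    rw [ha]
    rfl

theorem shiftAlg_comm (p q : Label N) (c d : ℂ) (F : Mero N) :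
    shiftAlg p c (shiftAlg q d F) = shiftAlg q d (shiftAlg p c F) := by
  obtain ⟨f, g, _, rfl⟩ := IsFractionRing.div_surjective (A := Entire N) F
  have h : ∀ f : Entire N, shiftAlg p c (shiftAlg q d (toMero f)) =
      shiftAlg q d (shiftAlg p c (toMero f)) := by
    intro f
    simp only [shiftAlg_toMero]
    congr 1
    apply entire_ext
    intro z
    simp only [translateHom_apply]
    rw [add_right_comm]
  simp only [map_div₀]
  exact congrArg₂ (· / ·) (h f) (h g)

theorem entry_sub_ne {m : ℕ} (hm : m < N) (j : Fin m) (l : Fin (m + 1)) (a : ℂ) :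
    entry γN m j - entry γN (m + 1) l ≠ cst N a := by
  intro h
  have h1 := congrArg (translateHom ⟨⟨m, hm⟩, j⟩ 1) h
  rw [map_sub, translateHom_entry_self, translateHom_entry_of_level_ne γN hm j 1 (by omega)] at h1
  have h2 : translateHom (⟨⟨m, hm⟩, j⟩ : Label N) 1 (cst N a) = cst N a := rfl
  rw [h2, ← h, add_sub_right_comm, add_eq_left] at h1
  have := congrArg (evalHom 0) h1
  rw [map_zero] at this
  exact one_ne_zero this

/-- The array `γ_{nj}` in the field of meromorphic functions, with shifts by `b`. -/
def gzArray (b : ℂ) : ShiftArray N (Mero N) b where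
  x n j := toMero (entry γN n j)
  -- The identity is a default value on the constant levels, where no variable exists to be shifted.
  τ n j := if h : n < N then (shiftAlg ⟨⟨n, h⟩, j⟩ b).toAlgHom else AlgHom.id ℂ _
  x_injective n h j i hji := by
    by_contra hne
    have h1 := toMero_injective hji
    have h2 := translateHom_entry_of_ne γN h j i (Ne.symm hne) 1
    rw [← h1, translateHom_entry_self, add_eq_left] at h2
    have := congrArg (evalHom 0) h2
    rw [map_zero] at this
    exact one_ne_zero this
  x_top n h j := by
    obtain ⟨a, ha⟩ := exists_entry_eq_cst γN h j
    exact ⟨a, by rw [ha, algebraMap_mero]⟩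
  τ_self n h j := by
    rw [dif_pos h, algebraMap_mero, ← map_add, ← translateHom_entry_self γN h]
    exact shiftAlg_toMero _ _ _
  τ_of_ne n j i hij := by
    split_ifs with h
    · exact (shiftAlg_toMero _ _ _).trans
        (congrArg toMero (translateHom_entry_of_ne γN h j i hij b))
    · rfl
  τ_of_level_ne n j m i hm := by
    split_ifs with h
    · exact (shiftAlg_toMero _ _ _).trans
        (congrArg toMero (translateHom_entry_of_level_ne γN h j b hm i))
    · rfl
  τ_comm n j m i f := by
    split_ifs
    · exact shiftAlg_comm _ _ _ _ f
    all_goals rfl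
  sub_ne m hm j l a h := by
    rw [algebraMap_mero, ← map_sub] at h
    exact entry_sub_ne γN hm j l a (toMero_injective h)

theorem gzArray_x (b : ℂ) (n : ℕ) (j : Fin n) :
    (gzArray γN b).x n j = toMero (entry γN n j) := rfl

theorem gzArray_τ (b : ℂ) {n : ℕ} (h : n < N) (j : Fin n) (F : Mero N) :
    (gzArray γN b).τ n j F = shiftAlg ⟨⟨n, h⟩, j⟩ b F := by
  change (if h : n < N then (shiftAlg ⟨⟨n, h⟩, j⟩ b).toAlgHom else AlgHom.id ℂ _ :
    Mero N →ₐ[ℂ] Mero N) F = _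
  rw [dif_pos h]
  rfl

/-- The meromorphic functions given by the polynomials which are symmetric in each level. -/
def symmMero : Submodule ℂ (Mero N) := (gzArray γN 0).symm

variable (ħ : ℝ)

/-- The choice b = -iħ turns the shift -iħ/2 in the numerator into + b / 2, so that raising
operators with -iħ and lowering operators with iħ are instances of the same algebra. -/
theorem upE_apply {n : ℕ} (h : n < N) (F : Mero N) :
    upE ħ γN n F = (-(1 / (Complex.I * ħ))) • (gzArray γN (-(Complex.I * ħ))).opA n F := by
  rw [upE, dif_pos h, LinearMap.smul_apply, LinearMap.sum_apply, ShiftArray.opA_apply]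
  congr 1
  refine sum_congr rfl fun j _ => ?_
  rw [gzArray_τ γN _ h, Module.End.mul_apply, shift_apply, LinearMap.mulLeft_apply,
    ShiftArray.coefA, ShiftArray.den]
  congr 2
  · refine prod_congr rfl fun r _ => ?_
    rw [gzArray_x, gzArray_x, algebraMap_mero, ← map_sub, ← map_add, neg_div, sub_eq_add_neg _ (cst N _),
      ← map_neg (algebraMap ℂ (Entire N))]
  · exact prod_congr rfl fun s _ => map_sub _ _ _

theorem downE_apply {n : ℕ} (h : n < N) (F : Mero N) :
    downE ħ γN n F = (1 / (Complex.I * ħ)) • (gzArray γN (Complex.I * ħ)).opB n F := by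
  rw [downE, dif_pos h, LinearMap.smul_apply, LinearMap.sum_apply, ShiftArray.opB_apply]
  congr 1
  refine sum_congr rfl fun j _ => ?_
  rw [gzArray_τ γN _ h, Module.End.mul_apply, shift_apply, LinearMap.mulLeft_apply,
    ShiftArray.coefB, ShiftArray.den]
  congr 2
  · refine prod_congr rfl fun r _ => ?_
    rw [gzArray_x, gzArray_x, algebraMap_mero, ← map_sub, ← map_add]
  · exact prod_congr rfl fun s _ => map_sub _ _ _

theorem diagE_apply (n : ℕ) (F : Mero N) :
    diagE ħ γN n F = (1 / (Complex.I * ħ)) •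
      (((gzArray γN 0).p n 1 - (gzArray γN 0).p (n - 1) 1) * F) := by
  rw [diagE, LinearMap.smul_apply, LinearMap.mulLeft_apply]
  simp only [ShiftArray.p, powerSum, pow_one]
  rfl

/-! ### Subspaces stable under the generators -/

theorem upperE_mem {S : Submodule ℂ (Mero N)} (h : ∀ n, ∀ F ∈ S, upE ħ γN n F ∈ S) (n d : ℕ)
    (F : Mero N) (hF : F ∈ S) : upperE ħ γN n d F ∈ S := by
  induction d generalizing F with
  | zero => exact h n F hF
  | succ d ih => exact sub_mem (ih _ (h _ _ hF)) (h _ _ (ih _ hF))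

theorem lowerE_mem {S : Submodule ℂ (Mero N)} (h : ∀ n, ∀ F ∈ S, downE ħ γN n F ∈ S) (n d : ℕ)
    (F : Mero N) (hF : F ∈ S) : lowerE ħ γN n d F ∈ S := by
  induction d generalizing F with
  | zero => exact h n F hF
  | succ d ih => exact sub_mem (h _ _ (ih _ hF)) (ih _ (h _ _ hF))

theorem cyclic_le {S : Submodule ℂ (Mero N)} {v : Mero N} (hv : v ∈ S)
    (hu : ∀ n < N, ∀ F ∈ S, upE ħ γN n F ∈ S) (hd : ∀ n < N, ∀ F ∈ S, downE ħ γN n F ∈ S)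
    (hg : ∀ n, ∀ F ∈ S, diagE ħ γN n F ∈ S) : cyclic ħ γN v ≤ S := by
  have hu' : ∀ n, ∀ F ∈ S, upE ħ γN n F ∈ S := by
    intro n F hF
    by_cases h : n < N
    · exact hu n h F hF
    · rw [upE, dif_neg h]; exact zero_mem _
  have hd' : ∀ n, ∀ F ∈ S, downE ħ γN n F ∈ S := by
    intro n F hF
    by_cases h : n < N
    · exact hd n h F hF
    · rw [downE, dif_neg h]; exact zero_mem _
  rintro _ ⟨T, hT, rfl⟩
  change T v ∈ S
  suffices ∀ F ∈ S, T F ∈ S from this v hv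
  refine Algebra.adjoin_induction (p := fun T _ => ∀ F ∈ S, T F ∈ S) ?_ ?_ ?_ ?_ hT
  · rintro _ ⟨j, k, rfl⟩ F hF
    rw [unitE]
    split_ifs
    · exact upperE_mem γN ħ hu' _ _ F hF
    · exact lowerE_mem γN ħ hd' _ _ F hF
    · exact hg _ F hF
  · intro a F hF
    exact S.smul_mem a hF
  · intro T U _ _ h1 h2 F hF
    exact add_mem (h1 F hF) (h2 F hF)
  · intro T U _ _ h1 h2 F hF
    exact h1 _ (h2 F hF)

theorem mem_cyclic_self (v : Mero N) : v ∈ cyclic ħ γN v := ⟨1, (envelope ħ γN).one_mem, rfl⟩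

theorem unitE_mem_cyclic (v : Mero N) (j k : Fin N) {F : Mero N} (hF : F ∈ cyclic ħ γN v) :
    unitE ħ γN j k F ∈ cyclic ħ γN v := by
  obtain ⟨T, hT, rfl⟩ := hF
  exact ⟨unitE ħ γN j k * T,
    (envelope ħ γN).mul_mem (Algebra.subset_adjoin ⟨j, k, rfl⟩) hT, rfl⟩

theorem upE_mem_cyclic (v : Mero N) {n : ℕ} (h : n + 1 < N) {F : Mero N}
    (hF : F ∈ cyclic ħ γN v) : upE ħ γN (n + 1) F ∈ cyclic ħ γN v := by
  have := unitE_mem_cyclic γN ħ v ⟨n, by omega⟩ ⟨n + 1, h⟩ hF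
  rw [unitE, if_pos (by simp)] at this
  simpa [upperE] using this

theorem downE_mem_cyclic (v : Mero N) {n : ℕ} (h : n + 1 < N) {F : Mero N}
    (hF : F ∈ cyclic ħ γN v) : downE ħ γN (n + 1) F ∈ cyclic ħ γN v := by
  have := unitE_mem_cyclic γN ħ v ⟨n + 1, h⟩ ⟨n, by omega⟩ hF
  rw [unitE, if_neg (by simp), if_pos (by simp)] at this
  simpa [lowerE] using this

/-- The first n diagonal operators telescope, starting from the empty level 0, to multiplication by
a multiple of p_{n,1}. -/
theorem p_mul_mem_cyclic (hħ : ħ ≠ 0) (v : Mero N) (n : ℕ) (h : n < N) {F : Mero N}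
    (hF : F ∈ cyclic ħ γN v) : (gzArray γN 0).p n 1 * F ∈ cyclic ħ γN v := by
  induction n with
  | zero =>
    have : (gzArray γN 0).p 0 1 = 0 := by simp [ShiftArray.p, powerSum]
    rw [this, zero_mul]
    exact zero_mem _
  | succ n ih =>
    have h1 := unitE_mem_cyclic γN ħ v ⟨n, by omega⟩ ⟨n, by omega⟩ hF
    rw [unitE, if_neg (lt_irrefl _), if_neg (lt_irrefl _), diagE_apply] at h1
    have h2 := Submodule.smul_mem _ (Complex.I * ħ) h1
    have hc : Complex.I * (ħ : ℂ) ≠ 0 := mul_ne_zero Complex.I_ne_zero (by exact_mod_cast hħ)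
    rw [smul_smul, mul_one_div_cancel hc, one_smul, sub_mul] at h2
    have := add_mem h2 (ih (by omega))
    simpa using this

theorem one_mem_symmMero : (1 : Mero N) ∈ symmMero γN := (gzArray γN 0).one_mem_symm

theorem mul_mem_symmMero {F G : Mero N} (hF : F ∈ symmMero γN) (hG : G ∈ symmMero γN) :
    F * G ∈ symmMero γN := (gzArray γN 0).symm_mul hF hG

/-- The Whittaker module generated by `1` consists of the symmetric polynomials. -/
theorem W'_eq (hħ : ħ ≠ 0) : W' ħ γN = symmMero γN := by
  have hc : Complex.I * (ħ : ℂ) ≠ 0 := mul_ne_zero Complex.I_ne_zero (by exact_mod_cast hħ)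
  apply le_antisymm
  · refine cyclic_le γN ħ (one_mem_symmMero γN) (fun n h F hF => ?_) (fun n h F hF => ?_)
      fun n F hF => ?_
    · rw [upE_apply γN ħ h]
      -- The filtration depends on the entries only and not on the shift, so `symmMero`, defined
      -- with shift 0, is by definition the `symm` of every `gzArray γN b`.
      exact Submodule.smul_mem _ _ ((gzArray γN (-(Complex.I * ħ))).opA_mem h hF)
    · rw [downE_apply γN ħ h]
      exact Submodule.smul_mem _ _ ((gzArray γN (Complex.I * ħ)).opB_mem h hF)
    · rw [diagE_apply]
      exact Submodule.smul_mem _ _ (mul_mem_symmMero γN (sub_mem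
        ((gzArray γN 0).p_mem_symm _ _) ((gzArray γN 0).p_mem_symm _ _)) hF)
  · refine (gzArray γN (-(Complex.I * ħ))).symm_le (neg_ne_zero.mpr hc) (mem_cyclic_self γN ħ 1)
      (fun m hm F hF => ?_) (fun m hm F hF => p_mul_mem_cyclic γN ħ hħ 1 m hm hF)
    rcases m with _ | m
    · rw [ShiftArray.opA_apply]
      simp
    · have h1 := upE_mem_cyclic γN ħ 1 hm hF
      rw [upE_apply γN ħ hm] at h1
      have h2 := Submodule.smul_mem _ (-(Complex.I * ħ)) h1
      rwa [smul_smul, neg_mul_neg, mul_one_div_cancel hc, one_smul] at h2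

end

section

open Finset

/-! ### Shifts of the Whittaker vector -/

variable {N : ℕ} (γN : Fin N → ℂ) (ħ : ℝ)

theorem toMero_smul (a : ℂ) (u : Entire N) :
    toMero (a • u) = algebraMap ℂ (Mero N) a * toMero u := by
  rw [algebraMap_mero, ← map_mul]
  congr 1

theorem toMero_mul (u v : Entire N) : toMero (u * v) = toMero u * toMero v := map_mul _ u v

theorem toMero_add (u v : Entire N) : toMero (u + v) = toMero u + toMero v := map_add _ u v

theorem toMero_sub (u v : Entire N) : toMero (u - v) = toMero u - toMero v := map_sub _ u v

theorem cst_neg (a : ℂ) : cst N (-a) = -cst N a := map_neg _ a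

theorem prod_toMero_smul {n : ℕ} (a : ℂ) (u : Fin n → Entire N) :
    ∏ r, toMero (a • u r) = algebraMap ℂ (Mero N) a ^ n * ∏ r, toMero (u r) := by
  rw [prod_congr rfl fun r _ => toMero_smul a (u r), prod_mul_distrib, prod_const, card_univ,
    Fintype.card_fin]

theorem expM_add_cst (u : Entire N) (a : ℂ) :
    expM (u + cst N a) = algebraMap ℂ (Mero N) (Complex.exp a) * expM u := by
  rw [algebraMap_mero, expM, expM, ← map_mul]
  congr 1
  apply entire_ext
  intro z
  exact (Complex.exp_add _ _).trans (mul_comm _ _)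

theorem shiftAlg_expM (p : Label N) (c : ℂ) (u : Entire N) :
    shiftAlg p c (expM u) = expM (translateHom p c u) := shiftAlg_toMero p c _

theorem shiftAlg_gammaM (p : Label N) (c : ℂ) (u : Entire N) :
    shiftAlg p c (gammaM u) = gammaM (translateHom p c u) := by
  rw [gammaM, map_inv₀, shiftAlg_toMero]
  rfl

theorem gammaM_add_one {u : Entire N} (hu : u ≠ 0) :
    gammaM (u + cst N 1) = toMero u * gammaM u := by
  have h : Entire.comp (fun s => (Complex.Gamma s)⁻¹) Complex.differentiable_one_div_Gamma u =
      u * Entire.comp (fun s => (Complex.Gamma s)⁻¹) Complex.differentiable_one_div_Gamma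
        (u + cst N 1) := by
    apply entire_ext
    intro z
    exact Complex.one_div_Gamma_eq_self_mul_one_div_Gamma_add_one (u.1 z)
  have h0 : toMero u ≠ 0 := fun h => hu (toMero_injective (h.trans (map_zero _).symm))
  rw [gammaM, gammaM, h, toMero_mul, mul_inv, ← mul_assoc, mul_inv_cancel₀ h0, one_mul]

/-- The meromorphic function `ħ ^ u Γ(u)`. -/
def gFactor (u : Entire N) : Mero N := expM ((Real.log ħ : ℂ) • u) * gammaM u

theorem sFactor_eq (n : ℕ) :
    sFactor ħ γN n = ∏ k : Fin n, ∏ m : Fin (n + 1), gFactor ħ (gammaArg ħ γN n k m) := rfl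

theorem shiftAlg_gFactor (p : Label N) (c : ℂ) (u : Entire N) :
    shiftAlg p c (gFactor ħ u) = gFactor ħ (translateHom p c u) := by
  rw [gFactor, map_mul, shiftAlg_expM, shiftAlg_gammaM, map_smul]
  rfl

/-- The power ħ ^ u turns the factor u of the functional equation into ħ u, which up to a power of i
is a linear factor of the operators. -/
theorem gFactor_add_one (hħ : 0 < ħ) {u v : Entire N} (hu : u ≠ 0) (hv : v = u + cst N 1) :
    gFactor ħ v = toMero ((ħ : ℂ) • u) * gFactor ħ u := by
  have h1 : (Real.log ħ : ℂ) • (u + cst N 1) = (Real.log ħ : ℂ) • u + cst N (Real.log ħ : ℂ) := by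
    rw [smul_add]
    congr 1
    apply entire_ext
    intro z
    exact mul_one _
  have h2 : Complex.exp (Real.log ħ : ℂ) = ħ := by
    rw [← Complex.ofReal_exp, Real.exp_log hħ]
  rw [hv, gFactor, gFactor, gammaM_add_one hu, h1, expM_add_cst, h2, toMero_smul]
  ring

theorem translateHom_gammaArg_of_ne {n : ℕ} (h : n < N) (j : Fin n) (c : ℂ) {n' : ℕ}
    (h1 : n' ≠ n) (h2 : n' + 1 ≠ n) (k : Fin n') (m : Fin (n' + 1)) :
    translateHom ⟨⟨n, h⟩, j⟩ c (gammaArg ħ γN n' k m) = gammaArg ħ γN n' k m := by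
  rw [gammaArg, map_add, map_smul, map_sub, translateHom_entry_of_level_ne γN h j c h1,
    translateHom_entry_of_level_ne γN h j c h2]
  rfl

theorem translateHom_gammaArg_same {n : ℕ} (h : n < N) (j : Fin n) (c : ℂ) (m : Fin (n + 1)) :
    translateHom ⟨⟨n, h⟩, j⟩ c (gammaArg ħ γN n j m) =
      gammaArg ħ γN n j m + cst N (c / (Complex.I * ħ)) := by
  rw [gammaArg, map_add, map_smul, map_sub, translateHom_entry_self γN h j c,
    translateHom_entry_of_level_ne γN h j c (by omega)]
  apply entire_ext
  intro z
  simp only [entire_add_apply, entire_smul_apply, entire_sub_apply, translateHom_apply, cst_apply]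
  ring

theorem translateHom_gammaArg_same_of_ne {n : ℕ} (h : n < N) (j k : Fin n) (hk : k ≠ j) (c : ℂ)
    (m : Fin (n + 1)) :
    translateHom ⟨⟨n, h⟩, j⟩ c (gammaArg ħ γN n k m) = gammaArg ħ γN n k m := by
  rw [gammaArg, map_add, map_smul, map_sub, translateHom_entry_of_ne γN h j k hk c,
    translateHom_entry_of_level_ne γN h j c (by omega)]
  rfl

theorem translateHom_gammaArg_prev {n : ℕ} (h : n + 1 < N) (j : Fin (n + 1)) (c : ℂ) (k : Fin n) :
    translateHom ⟨⟨n + 1, h⟩, j⟩ c (gammaArg ħ γN n k j) =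
      gammaArg ħ γN n k j - cst N (c / (Complex.I * ħ)) := by
  rw [gammaArg, map_add, map_smul, map_sub, translateHom_entry_self γN h j c,
    translateHom_entry_of_level_ne γN h j c (by omega)]
  apply entire_ext
  intro z
  simp only [entire_add_apply, entire_smul_apply, entire_sub_apply, translateHom_apply, cst_apply]
  ring

theorem translateHom_gammaArg_prev_of_ne {n : ℕ} (h : n + 1 < N) (j m : Fin (n + 1)) (hm : m ≠ j)
    (c : ℂ) (k : Fin n) :
    translateHom ⟨⟨n + 1, h⟩, j⟩ c (gammaArg ħ γN n k m) = gammaArg ħ γN n k m := by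
  rw [gammaArg, map_add, map_smul, map_sub, translateHom_entry_of_ne γN h j m hm c,
    translateHom_entry_of_level_ne γN h j c (by omega)]
  rfl

theorem gammaArg_ne_cst (hħ : ħ ≠ 0) {n : ℕ} (h : n < N) (k : Fin n) (m : Fin (n + 1)) (a : ℂ) :
    gammaArg ħ γN n k m ≠ cst N a := by
  intro h0
  have hc : Complex.I * (ħ : ℂ) ≠ 0 := mul_ne_zero Complex.I_ne_zero (by exact_mod_cast hħ)
  apply entry_sub_ne γN h k m ((a - 1 / 2) * (Complex.I * ħ))
  apply entire_ext
  intro z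
  have h1 := congrArg (fun f : Entire N => f.1 z) h0
  simp only [gammaArg, entire_add_apply, entire_smul_apply, entire_sub_apply, cst_apply] at h1
  rw [entire_sub_apply, cst_apply, ← h1, add_sub_cancel_right, mul_right_comm,
    one_div_mul_cancel hc, one_mul]

theorem gammaArg_ne_zero (hħ : ħ ≠ 0) {n : ℕ} (h : n < N) (k : Fin n) (m : Fin (n + 1)) :
    gammaArg ħ γN n k m ≠ 0 := by
  have := gammaArg_ne_cst γN ħ hħ h k m 0
  rwa [cst, map_zero] at this

theorem gammaArg_sub_one_ne_zero (hħ : ħ ≠ 0) {n : ℕ} (h : n < N) (k : Fin n) (m : Fin (n + 1)) :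
    gammaArg ħ γN n k m - cst N 1 ≠ 0 :=
  fun h0 => gammaArg_ne_cst γN ħ hħ h k m 1 (sub_eq_zero.mp h0)

section shifts

variable (hħ : 0 < ħ)
include hħ

/-- The shift lowers the arguments by one, so the functional equation divides. The factors are kept
on the other side to avoid inverses. -/
theorem shiftAlg_sFactor_self_neg {n : ℕ} (h : n < N) (j : Fin n) :
    (∏ m, toMero ((ħ : ℂ) • (gammaArg ħ γN n j m - cst N 1))) *
      shiftAlg ⟨⟨n, h⟩, j⟩ (-(Complex.I * ħ)) (sFactor ħ γN n) = sFactor ħ γN n := by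
  have hc : Complex.I * (ħ : ℂ) ≠ 0 := mul_ne_zero Complex.I_ne_zero (by exact_mod_cast hħ.ne')
  rw [sFactor_eq, map_prod, ← mul_prod_erase _ _ (mem_univ j), ← mul_assoc, map_prod,
    ← prod_mul_distrib, ← mul_prod_erase univ (fun k => ∏ m, gFactor ħ (gammaArg ħ γN n k m))
      (mem_univ j)]
  congr 1
  · refine prod_congr rfl fun m _ => ?_
    rw [shiftAlg_gFactor, translateHom_gammaArg_same, neg_div, div_self hc, cst_neg,
      ← sub_eq_add_neg]
    exact (gFactor_add_one ħ hħ (gammaArg_sub_one_ne_zero γN ħ hħ.ne' h j m)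
      (sub_add_cancel _ _).symm).symm
  · refine prod_congr rfl fun k hk => ?_
    rw [map_prod]
    refine prod_congr rfl fun m _ => ?_
    rw [shiftAlg_gFactor, translateHom_gammaArg_same_of_ne γN ħ h j k (ne_of_mem_erase hk)]

theorem shiftAlg_sFactor_self_pos {n : ℕ} (h : n < N) (j : Fin n) :
    shiftAlg ⟨⟨n, h⟩, j⟩ (Complex.I * ħ) (sFactor ħ γN n) =
      (∏ m, toMero ((ħ : ℂ) • gammaArg ħ γN n j m)) * sFactor ħ γN n := by
  have hc : Complex.I * (ħ : ℂ) ≠ 0 := mul_ne_zero Complex.I_ne_zero (by exact_mod_cast hħ.ne')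
  rw [sFactor_eq, map_prod, ← mul_prod_erase _ _ (mem_univ j), map_prod,
    ← mul_prod_erase univ (fun k => ∏ m, gFactor ħ (gammaArg ħ γN n k m))
      (mem_univ j), ← mul_assoc, ← prod_mul_distrib]
  congr 1
  · refine prod_congr rfl fun m _ => ?_
    rw [shiftAlg_gFactor, translateHom_gammaArg_same, div_self hc]
    exact gFactor_add_one ħ hħ (gammaArg_ne_zero γN ħ hħ.ne' h j m) rfl
  · refine prod_congr rfl fun k hk => ?_
    rw [map_prod]
    refine prod_congr rfl fun m _ => ?_
    rw [shiftAlg_gFactor, translateHom_gammaArg_same_of_ne γN ħ h j k (ne_of_mem_erase hk)]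

theorem shiftAlg_sFactor_prev_neg {n : ℕ} (h : n + 1 < N) (j : Fin (n + 1)) :
    shiftAlg ⟨⟨n + 1, h⟩, j⟩ (-(Complex.I * ħ)) (sFactor ħ γN n) =
      (∏ k, toMero ((ħ : ℂ) • gammaArg ħ γN n k j)) * sFactor ħ γN n := by
  have hc : Complex.I * (ħ : ℂ) ≠ 0 := mul_ne_zero Complex.I_ne_zero (by exact_mod_cast hħ.ne')
  rw [sFactor_eq, map_prod, ← prod_mul_distrib]
  refine prod_congr rfl fun k _ => ?_
  rw [map_prod, ← mul_prod_erase _ _ (mem_univ j),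
    ← mul_prod_erase univ (fun m => gFactor ħ (gammaArg ħ γN n k m)) (mem_univ j), ← mul_assoc]
  congr 1
  · rw [shiftAlg_gFactor, translateHom_gammaArg_prev, neg_div, div_self hc, cst_neg,
      sub_neg_eq_add]
    exact gFactor_add_one ħ hħ (gammaArg_ne_zero γN ħ hħ.ne' (by omega) k j) rfl
  · refine prod_congr rfl fun m hm => ?_
    rw [shiftAlg_gFactor, translateHom_gammaArg_prev_of_ne γN ħ h j m (ne_of_mem_erase hm)]

theorem shiftAlg_sFactor_prev_pos {n : ℕ} (h : n + 1 < N) (j : Fin (n + 1)) :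
    (∏ k, toMero ((ħ : ℂ) • (gammaArg ħ γN n k j - cst N 1))) *
      shiftAlg ⟨⟨n + 1, h⟩, j⟩ (Complex.I * ħ) (sFactor ħ γN n) = sFactor ħ γN n := by
  have hc : Complex.I * (ħ : ℂ) ≠ 0 := mul_ne_zero Complex.I_ne_zero (by exact_mod_cast hħ.ne')
  rw [sFactor_eq, map_prod, ← prod_mul_distrib]
  refine prod_congr rfl fun k _ => ?_
  rw [map_prod, ← mul_prod_erase _ _ (mem_univ j),
    ← mul_prod_erase univ (fun m => gFactor ħ (gammaArg ħ γN n k m)) (mem_univ j), ← mul_assoc]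
  congr 1
  · rw [shiftAlg_gFactor, translateHom_gammaArg_prev, div_self hc]
    exact (gFactor_add_one ħ hħ (gammaArg_sub_one_ne_zero γN ħ hħ.ne' (by omega) k j)
      (sub_add_cancel _ _).symm).symm
  · refine prod_congr rfl fun m hm => ?_
    rw [shiftAlg_gFactor, translateHom_gammaArg_prev_of_ne γN ħ h j m (ne_of_mem_erase hm)]

end shifts

theorem shiftAlg_sFactor_of_ne {n : ℕ} (h : n < N) (j : Fin n) (c : ℂ) {n' : ℕ}
    (h1 : n' ≠ n) (h2 : n' + 1 ≠ n) :
    shiftAlg ⟨⟨n, h⟩, j⟩ c (sFactor ħ γN n') = sFactor ħ γN n' := by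
  rw [sFactor_eq, map_prod]
  refine prod_congr rfl fun k _ => ?_
  rw [map_prod]
  refine prod_congr rfl fun m _ => ?_
  rw [shiftAlg_gFactor, translateHom_gammaArg_of_ne γN ħ h j c h1 h2]

/-- The exponent in the definition of the Whittaker vector. -/
def whittakerExponent : Entire N :=
  (-(Real.pi / ħ) : ℂ) • ∑ n ∈ Finset.Ico 1 N, ((n : ℂ) - 1) • ∑ j : Fin n, entry γN n j

theorem whittakerVector_eq {n : ℕ} (h : n + 1 < N) :
    whittakerVector ħ γN = expM (whittakerExponent γN ħ) * (sFactor ħ γN (n + 1) *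
      (sFactor ħ γN n * ∏ n' ∈ ((range N).erase (n + 1)).erase n, sFactor ħ γN n')) := by
  have h1 : n ∈ (range N).erase (n + 1) := by simp; omega
  have h2 : sFactor ħ γN 0 = 1 := by rw [sFactor_eq, univ_eq_empty, prod_empty]
  have h3 : ∏ n' ∈ range N, sFactor ħ γN n' = ∏ n' ∈ Ico 1 N, sFactor ħ γN n' := by
    rw [range_eq_Ico, prod_eq_prod_Ico_succ_bot (by omega : 0 < N), h2, one_mul]
  rw [mul_prod_erase _ _ h1, mul_prod_erase _ _ (mem_range.mpr h), h3]
  rfl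

/-- The variable has level n + 1, so its coefficient in the exponent is (n + 1) - 1 = n. -/
theorem translateHom_whittakerExponent {n : ℕ} (h : n + 1 < N) (j : Fin (n + 1)) (c : ℂ) :
    translateHom ⟨⟨n + 1, h⟩, j⟩ c (whittakerExponent γN ħ) =
      whittakerExponent γN ħ + cst N (-(Real.pi / ħ) * n * c) := by
  have h1 : n + 1 ∈ Ico 1 N := by simp; omega
  have h2 : ∀ n', n' ≠ n + 1 → translateHom ⟨⟨n + 1, h⟩, j⟩ c (∑ i : Fin n', entry γN n' i) =
      ∑ i : Fin n', entry γN n' i := fun n' hn => by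
    rw [map_sum]
    exact sum_congr rfl fun i _ => translateHom_entry_of_level_ne γN h j c hn i
  have h3 : translateHom ⟨⟨n + 1, h⟩, j⟩ c (∑ i : Fin (n + 1), entry γN (n + 1) i) =
      ∑ i : Fin (n + 1), entry γN (n + 1) i + cst N c := by
    rw [map_sum, ← add_sum_erase _ _ (mem_univ j),
      ← add_sum_erase univ (fun i => entry γN (n + 1) i) (mem_univ j), translateHom_entry_self]
    rw [sum_congr rfl fun i hi => translateHom_entry_of_ne γN h j i (ne_of_mem_erase hi) c]
    ring
  rw [whittakerExponent, map_smul, map_sum, ← add_sum_erase _ _ h1,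
    ← add_sum_erase (Ico 1 N) (fun n => ((n : ℂ) - 1) • ∑ j : Fin n, entry γN n j) h1, map_smul, h3]
  have h4 : ∑ n' ∈ (Ico 1 N).erase (n + 1), translateHom ⟨⟨n + 1, h⟩, j⟩ c
      (((n' : ℂ) - 1) • ∑ i : Fin n', entry γN n' i) =
      ∑ n' ∈ (Ico 1 N).erase (n + 1), ((n' : ℂ) - 1) • ∑ i : Fin n', entry γN n' i :=
    sum_congr rfl fun n' hn => by rw [map_smul, h2 n' (ne_of_mem_erase hn)]
  rw [h4]
  apply entire_ext
  intro z
  simp only [entire_add_apply, entire_smul_apply, cst_apply]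
  push_cast
  ring

theorem gammaArg_apply (n : ℕ) (k : Fin n) (m : Fin (n + 1)) (z : Label N → ℂ) :
    (gammaArg ħ γN n k m).1 z =
      -Complex.I * (ħ : ℂ)⁻¹ * ((entry γN n k).1 z - (entry γN (n + 1) m).1 z) + 1 / 2 := by
  have : (gammaArg ħ γN n k m).1 z =
      1 / (Complex.I * ħ) * ((entry γN n k).1 z - (entry γN (n + 1) m).1 z) + 1 / 2 := rfl
  rw [this, one_div, mul_inv, Complex.inv_I]

/-- This and the next three identities match the linear factors in the numerators with those of the
functional equation of Γ: they are ħ u or ħ (u - 1), times i towards the next level and times i⁻¹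
towards the previous one. -/
theorem gammaArg_next_neg (hħ : ħ ≠ 0) (n : ℕ) (k : Fin n) (m : Fin (n + 1)) :
    entry γN n k - entry γN (n + 1) m + cst N (-(Complex.I * ħ) / 2) =
      Complex.I • ((ħ : ℂ) • (gammaArg ħ γN n k m - cst N 1)) := by
  have h : (ħ : ℂ) * (ħ : ℂ)⁻¹ = 1 := mul_inv_cancel₀ (by exact_mod_cast hħ)
  apply entire_ext
  intro z
  simp only [gammaArg_apply, entire_add_apply, entire_smul_apply, entire_sub_apply, cst_apply]
  linear_combination ((entry γN n k).1 z - (entry γN (n + 1) m).1 z) *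
    (Complex.I ^ 2 * h + Complex.I_sq)

theorem gammaArg_next_pos (hħ : ħ ≠ 0) (n : ℕ) (k : Fin n) (m : Fin (n + 1)) :
    entry γN n k - entry γN (n + 1) m + cst N (Complex.I * ħ / 2) =
      Complex.I • ((ħ : ℂ) • gammaArg ħ γN n k m) := by
  have h : (ħ : ℂ) * (ħ : ℂ)⁻¹ = 1 := mul_inv_cancel₀ (by exact_mod_cast hħ)
  apply entire_ext
  intro z
  simp only [gammaArg_apply, entire_add_apply, entire_smul_apply, entire_sub_apply, cst_apply]
  linear_combination ((entry γN n k).1 z - (entry γN (n + 1) m).1 z) *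
    (Complex.I ^ 2 * h + Complex.I_sq)

theorem gammaArg_prev_neg (hħ : ħ ≠ 0) (n : ℕ) (k : Fin n) (m : Fin (n + 1)) :
    entry γN (n + 1) m - entry γN n k + cst N (-(Complex.I * ħ) / 2) =
      Complex.I⁻¹ • ((ħ : ℂ) • gammaArg ħ γN n k m) := by
  have h : (ħ : ℂ) * (ħ : ℂ)⁻¹ = 1 := mul_inv_cancel₀ (by exact_mod_cast hħ)
  apply entire_ext
  intro z
  simp only [gammaArg_apply, entire_add_apply, entire_smul_apply, entire_sub_apply, cst_apply,
    Complex.inv_I]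
  linear_combination -((entry γN n k).1 z - (entry γN (n + 1) m).1 z) *
    (Complex.I ^ 2 * h + Complex.I_sq)

theorem gammaArg_prev_pos (hħ : ħ ≠ 0) (n : ℕ) (k : Fin n) (m : Fin (n + 1)) :
    entry γN (n + 1) m - entry γN n k + cst N (Complex.I * ħ / 2) =
      Complex.I⁻¹ • ((ħ : ℂ) • (gammaArg ħ γN n k m - cst N 1)) := by
  have h : (ħ : ℂ) * (ħ : ℂ)⁻¹ = 1 := mul_inv_cancel₀ (by exact_mod_cast hħ)
  apply entire_ext
  intro z
  simp only [gammaArg_apply, entire_add_apply, entire_smul_apply, entire_sub_apply, cst_apply,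
    Complex.inv_I]
  linear_combination -((entry γN n k).1 z - (entry γN (n + 1) m).1 z) *
    (Complex.I ^ 2 * h + Complex.I_sq)

theorem gzArray_coefA (b : ℂ) (n : ℕ) (j : Fin n) :
    (gzArray γN b).coefA n j = (∏ r : Fin (n + 1),
      toMero (entry γN n j - entry γN (n + 1) r + cst N (b / 2))) / (gzArray γN b).den n j := by
  rw [ShiftArray.coefA]
  congr 1
  refine prod_congr rfl fun r _ => ?_
  rw [toMero_add, toMero_sub, algebraMap_mero]
  rfl

theorem gzArray_coefB (b : ℂ) (n : ℕ) (j : Fin (n + 1)) :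
    (gzArray γN b).coefB (n + 1) j = (∏ r : Fin n,
      toMero (entry γN (n + 1) j - entry γN n r + cst N (b / 2))) /
        (gzArray γN b).den (n + 1) j := by
  rw [ShiftArray.coefB]
  congr 1
  refine prod_congr rfl fun r _ => ?_
  rw [toMero_add, toMero_sub, algebraMap_mero]
  rfl

/-- The factor in the relation of the raising operators on both modules. -/
def upConst (n : ℕ) : ℂ :=
  Complex.I ^ (n + 2) * Complex.I ^ n * Complex.exp (-(Real.pi / ħ) * n * -(Complex.I * ħ))

/-- The factor in the relation of the lowering operators on both modules. -/
def downConst (n : ℕ) : ℂ :=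
  Complex.I⁻¹ ^ (n + 2) * Complex.I⁻¹ ^ n * Complex.exp (-(Real.pi / ħ) * n * (Complex.I * ħ))

theorem downConst_ne_zero (n : ℕ) : downConst ħ n ≠ 0 := by
  simp [downConst, Complex.exp_ne_zero]

theorem shiftAlg_whittakerVector {n : ℕ} (h : n + 1 < N) (j : Fin (n + 1)) (c : ℂ) :
    shiftAlg ⟨⟨n + 1, h⟩, j⟩ c (whittakerVector ħ γN) =
      algebraMap ℂ (Mero N) (Complex.exp (-(Real.pi / ħ) * n * c)) *
        expM (whittakerExponent γN ħ) * (shiftAlg ⟨⟨n + 1, h⟩, j⟩ c (sFactor ħ γN (n + 1)) *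
          (shiftAlg ⟨⟨n + 1, h⟩, j⟩ c (sFactor ħ γN n) *
            ∏ n' ∈ ((range N).erase (n + 1)).erase n, sFactor ħ γN n')) := by
  have hrest : shiftAlg ⟨⟨n + 1, h⟩, j⟩ c
      (∏ n' ∈ ((range N).erase (n + 1)).erase n, sFactor ħ γN n') =
      ∏ n' ∈ ((range N).erase (n + 1)).erase n, sFactor ħ γN n' := by
    rw [map_prod]
    refine prod_congr rfl fun n' hn => ?_
    rw [mem_erase, mem_erase] at hn
    exact shiftAlg_sFactor_of_ne γN ħ h j _ hn.2.1 (by omega)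
  rw [whittakerVector_eq γN ħ h, map_mul, map_mul, map_mul, hrest, shiftAlg_expM,
    translateHom_whittakerExponent, expM_add_cst]

theorem algebraMap_I_inv_mul (n : ℕ) :
    algebraMap ℂ (Mero N) Complex.I⁻¹ ^ n * algebraMap ℂ (Mero N) Complex.I ^ n = 1 := by
  rw [← mul_pow, ← map_mul, inv_mul_cancel₀ Complex.I_ne_zero, map_one, one_pow]

/-- Shifting by -iħ lowers the arguments joining level n + 1 to n + 2, which cancels the numerator
of `coefA`, and raises those joining level n to n + 1, which creates the numerator of `coefB`.
Conjugation by w_N thus changes the coefficient but not the shift. -/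
theorem coefA_mul_shift_whittakerVector (hħ : 0 < ħ) {n : ℕ} (h : n + 1 < N) (j : Fin (n + 1)) :
    (gzArray γN (-(Complex.I * ħ))).coefA (n + 1) j *
      shiftAlg ⟨⟨n + 1, h⟩, j⟩ (-(Complex.I * ħ)) (whittakerVector ħ γN) =
    algebraMap ℂ (Mero N) (upConst ħ n) * (gzArray γN (-(Complex.I * ħ))).coefB (n + 1) j *
      whittakerVector ħ γN := by
  have hself := shiftAlg_sFactor_self_neg γN ħ hħ h j
  have hI := algebraMap_I_inv_mul (N := N) n
  rw [shiftAlg_whittakerVector, shiftAlg_sFactor_prev_neg γN ħ hħ h j, gzArray_coefA,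
    gzArray_coefB, whittakerVector_eq γN ħ h,
    prod_congr rfl fun r _ => congrArg toMero (gammaArg_next_neg γN ħ hħ.ne' (n + 1) j r),
    prod_congr rfl fun r _ => congrArg toMero (gammaArg_prev_neg γN ħ hħ.ne' n r j),
    prod_toMero_smul Complex.I, prod_toMero_smul Complex.I⁻¹, upConst, map_mul, map_mul, map_pow, map_pow]
  generalize shiftAlg ⟨⟨n + 1, h⟩, j⟩ (-(Complex.I * ħ)) (sFactor ħ γN (n + 1)) = S at *
  -- The unshifted product is rewritten as P times the shifted one. After this both sides agree
  -- except for the powers of i, which `hI` cancels.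
  rw [← hself]
  generalize ∏ m, toMero ((ħ : ℂ) • (gammaArg ħ γN (n + 1) j m - cst N 1)) = P at *
  generalize ∏ n' ∈ ((range N).erase (n + 1)).erase n, sFactor ħ γN n' = Q
  generalize ∏ k, toMero ((ħ : ℂ) • gammaArg ħ γN n k j) = R
  generalize algebraMap ℂ (Mero N) Complex.I ^ n = I1 at *
  generalize algebraMap ℂ (Mero N) Complex.I⁻¹ ^ n = I2 at *
  linear_combination (-(algebraMap ℂ (Mero N) Complex.I ^ (n + 2) * P /
    (gzArray γN (-(Complex.I * ħ))).den (n + 1) j * (algebraMap ℂ (Mero N)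
    (Complex.exp (-(Real.pi / ħ) * n * -(Complex.I * ħ))) * expM (whittakerExponent γN ħ) *
    (S * (R * sFactor ħ γN n * Q))))) * hI

theorem coefB_mul_shift_whittakerVector (hħ : 0 < ħ) {n : ℕ} (h : n + 1 < N) (j : Fin (n + 1)) :
    (gzArray γN (Complex.I * ħ)).coefB (n + 1) j *
      shiftAlg ⟨⟨n + 1, h⟩, j⟩ (Complex.I * ħ) (whittakerVector ħ γN) =
    algebraMap ℂ (Mero N) (downConst ħ n) * (gzArray γN (Complex.I * ħ)).coefA (n + 1) j *
      whittakerVector ħ γN := by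
  have hself := shiftAlg_sFactor_prev_pos γN ħ hħ h j
  have hI := algebraMap_I_inv_mul (N := N) (n + 2)
  rw [shiftAlg_whittakerVector, shiftAlg_sFactor_self_pos γN ħ hħ h j, gzArray_coefA,
    gzArray_coefB, whittakerVector_eq γN ħ h,
    prod_congr rfl fun r _ => congrArg toMero (gammaArg_next_pos γN ħ hħ.ne' (n + 1) j r),
    prod_congr rfl fun r _ => congrArg toMero (gammaArg_prev_pos γN ħ hħ.ne' n r j),
    prod_toMero_smul Complex.I, prod_toMero_smul Complex.I⁻¹, downConst, map_mul, map_mul, map_pow, map_pow]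
  generalize shiftAlg ⟨⟨n + 1, h⟩, j⟩ (Complex.I * ħ) (sFactor ħ γN n) = S at *
  rw [← hself]
  generalize ∏ k, toMero ((ħ : ℂ) • (gammaArg ħ γN n k j - cst N 1)) = P at *
  generalize ∏ n' ∈ ((range N).erase (n + 1)).erase n, sFactor ħ γN n' = Q
  generalize ∏ m, toMero ((ħ : ℂ) • gammaArg ħ γN (n + 1) j m) = R
  generalize algebraMap ℂ (Mero N) Complex.I ^ (n + 2) = I1 at *
  generalize algebraMap ℂ (Mero N) Complex.I⁻¹ ^ (n + 2) = I2 at *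
  linear_combination (-(algebraMap ℂ (Mero N) Complex.I⁻¹ ^ n * P /
    (gzArray γN (Complex.I * ħ)).den (n + 1) j * (algebraMap ℂ (Mero N)
    (Complex.exp (-(Real.pi / ħ) * n * (Complex.I * ħ))) * expM (whittakerExponent γN ħ) *
    (R * sFactor ħ γN (n + 1) * (S * Q))))) * hI

theorem opA_mul_whittakerVector (hħ : 0 < ħ) {n : ℕ} (h : n + 1 < N) (F : Mero N) :
    (gzArray γN (-(Complex.I * ħ))).opA (n + 1) (F * whittakerVector ħ γN) =
      upConst ħ n • ((gzArray γN (-(Complex.I * ħ))).opB (n + 1) F * whittakerVector ħ γN) := by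
  rw [ShiftArray.opA_apply, ShiftArray.opB_apply, sum_mul, smul_sum]
  refine sum_congr rfl fun j _ => ?_
  rw [gzArray_τ γN _ h, gzArray_τ γN _ h, map_mul, mul_left_comm,
    coefA_mul_shift_whittakerVector γN ħ hħ h, Algebra.smul_def]
  ring

theorem opB_mul_whittakerVector (hħ : 0 < ħ) {n : ℕ} (h : n + 1 < N) (F : Mero N) :
    (gzArray γN (Complex.I * ħ)).opB (n + 1) (F * whittakerVector ħ γN) =
      downConst ħ n • ((gzArray γN (Complex.I * ħ)).opA (n + 1) F * whittakerVector ħ γN) := by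
  rw [ShiftArray.opA_apply, ShiftArray.opB_apply, sum_mul, smul_sum]
  refine sum_congr rfl fun j _ => ?_
  rw [gzArray_τ γN _ h, gzArray_τ γN _ h, map_mul, mul_left_comm,
    coefB_mul_shift_whittakerVector γN ħ hħ h, Algebra.smul_def]
  ring

/-- The Whittaker module `W` consists of the symmetric polynomials times the Whittaker vector. -/
theorem W_eq (hħ : 0 < ħ) :
    W ħ γN = (symmMero γN).map (LinearMap.mulRight ℂ (whittakerVector ħ γN)) := by
  have hc : Complex.I * (ħ : ℂ) ≠ 0 := mul_ne_zero Complex.I_ne_zero (by exact_mod_cast hħ.ne')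
  apply le_antisymm
  · refine cyclic_le γN ħ ⟨1, one_mem_symmMero γN, one_mul _⟩ ?_ ?_ ?_
    · rintro n h _ ⟨F, hF, rfl⟩
      rw [LinearMap.mulRight_apply, upE_apply γN ħ h]
      apply Submodule.smul_mem
      rcases n with _ | n
      · rw [ShiftArray.opA_apply, univ_eq_empty, sum_empty]
        exact zero_mem _
      · rw [opA_mul_whittakerVector γN ħ hħ h]
        exact Submodule.smul_mem _ _ ⟨_, (gzArray γN (-(Complex.I * ħ))).opB_mem h hF, rfl⟩
    · rintro n h _ ⟨F, hF, rfl⟩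
      rw [LinearMap.mulRight_apply, downE_apply γN ħ h]
      apply Submodule.smul_mem
      rcases n with _ | n
      · rw [ShiftArray.opB_apply, univ_eq_empty, sum_empty]
        exact zero_mem _
      · rw [opB_mul_whittakerVector γN ħ hħ h]
        exact Submodule.smul_mem _ _ ⟨_, (gzArray γN (Complex.I * ħ)).opA_mem h hF, rfl⟩
    · rintro n _ ⟨F, hF, rfl⟩
      rw [LinearMap.mulRight_apply, diagE_apply, ← mul_assoc]
      exact Submodule.smul_mem _ _ ⟨_, mul_mem_symmMero γN (sub_mem
        ((gzArray γN 0).p_mem_symm n 1) ((gzArray γN 0).p_mem_symm (n - 1) 1)) hF, rfl⟩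
  · rw [Submodule.map_le_iff_le_comap]
    -- On multiples of w_N it is the lowering operators that act by `opA` on the symmetric factor,
    -- so the generation argument runs with b = iħ.
    refine (gzArray γN (Complex.I * ħ)).symm_le hc ?_ (fun m hm F hF => ?_) (fun m hm F hF => ?_)
    · change 1 * whittakerVector ħ γN ∈ W ħ γN
      rw [one_mul]
      exact mem_cyclic_self γN ħ _
    · change _ * whittakerVector ħ γN ∈ W ħ γN
      change F * whittakerVector ħ γN ∈ W ħ γN at hF
      rcases m with _ | m
      · rw [ShiftArray.opA_apply, univ_eq_empty, sum_empty, zero_mul]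
        exact zero_mem _
      · have h1 := downE_mem_cyclic γN ħ _ hm hF
        rw [downE_apply γN ħ hm, opB_mul_whittakerVector γN ħ hħ hm, smul_smul] at h1
        have h2 := Submodule.smul_mem _ (1 / (Complex.I * ħ) * downConst ħ m)⁻¹ h1
        rwa [smul_smul, inv_mul_cancel₀ (mul_ne_zero (one_div_ne_zero hc) (downConst_ne_zero ħ m)),
          one_smul] at h2
    · change _ * whittakerVector ħ γN ∈ W ħ γN
      rw [mul_assoc]
      exact p_mul_mem_cyclic γN ħ hħ.ne' _ m hm hF

end

section

open Finset

theorem ShiftArray.esymm_mem {N : ℕ} {K : Type*} [Field K] [Algebra ℂ K] {b : ℂ}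
    (D : ShiftArray N K b) (m k : ℕ) : (univ.val.map (D.x m)).esymm k ∈ D.filt k := by
  have h : (univ.val.map (D.x m)).esymm k =
      algebraMap ℂ K ((-1) ^ k) * signedEsymm (D.x m) k := by
    rw [signedEsymm, map_pow, map_neg, map_one, ← mul_assoc, ← mul_pow, neg_one_mul, neg_neg,
      one_pow, one_mul]
  rw [h]
  exact D.filt_prod_mem (D.algebraMap_mem_filt _) (D.signedEsymm_mem m k) (zero_add _).le

/-! ### Symmetric polynomials in the variables -/

variable {N : ℕ} (γN : Fin N → ℂ)

/-- A polynomial, as an entire function. -/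
def polyE : MvPolynomial (Label N) ℂ →ₐ[ℂ] Entire N := MvPolynomial.aeval coordinate

theorem polyE_apply (f : MvPolynomial (Label N) ℂ) (z : Label N → ℂ) :
    (polyE f).1 z = MvPolynomial.eval z f := by
  have : (evalHom z).comp polyE = MvPolynomial.aeval z :=
    MvPolynomial.algHom_ext fun i => by
      rw [AlgHom.comp_apply, polyE, MvPolynomial.aeval_X, MvPolynomial.aeval_X]
      rfl
  exact DFunLike.congr_fun this f

/-- A polynomial, as a meromorphic function. -/
def polyM : MvPolynomial (Label N) ℂ →ₐ[ℂ] Mero N :=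
  (IsScalarTower.toAlgHom ℂ (Entire N) (Mero N)).comp polyE

theorem polyM_apply (f : MvPolynomial (Label N) ℂ) : polyM f = toMero (polyE f) := rfl

theorem polyM_X {n : ℕ} (h : n < N) (j : Fin n) :
    polyM (MvPolynomial.X (⟨⟨n, h⟩, j⟩ : Label N)) = toMero (entry γN n j) := by
  rw [polyM_apply, polyE, MvPolynomial.aeval_X, entry_of_lt γN h]

/-- The permutation of the labels by a permutation of each level. -/
def levelPerm (σ : (n : Fin N) → Equiv.Perm (Fin (n : ℕ))) : Equiv.Perm (Label N) :=
  Equiv.sigmaCongrRight σ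

/-- Invariance of a polynomial under the permutations of each level. -/
def IsLevelSymmetric (f : MvPolynomial (Label N) ℂ) : Prop :=
  ∀ σ, MvPolynomial.rename (levelPerm σ) f = f

theorem IsLevelSymmetric.eval {f : MvPolynomial (Label N) ℂ} (hf : IsLevelSymmetric f) (σ)
    (z : Label N → ℂ) : MvPolynomial.eval (z ∘ levelPerm σ) f = MvPolynomial.eval z f := by
  conv_rhs => rw [← hf σ, MvPolynomial.eval_rename]

theorem isLevelSymmetric_powerSum {n : ℕ} (h : n < N) (k : ℕ) : IsLevelSymmetric
    (∑ j : Fin n, (MvPolynomial.X (⟨⟨n, h⟩, j⟩ : Label N) : MvPolynomial (Label N) ℂ) ^ k) := by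
  intro σ
  rw [map_sum]
  simp only [map_pow, MvPolynomial.rename_X]
  exact Equiv.sum_comp (σ ⟨n, h⟩)
    (fun j => (MvPolynomial.X (⟨⟨n, h⟩, j⟩ : Label N) : MvPolynomial (Label N) ℂ) ^ k)

theorem polyM_powerSum {n : ℕ} (h : n < N) (k : ℕ) :
    polyM (∑ j : Fin n, (MvPolynomial.X (⟨⟨n, h⟩, j⟩ : Label N)) ^ k) =
      (gzArray γN 0).p n k := by
  rw [map_sum, ShiftArray.p, powerSum]
  refine sum_congr rfl fun j _ => ?_
  rw [map_pow, polyM_X γN h, gzArray_x]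

theorem exists_polyM_of_mem {F : Mero N} (hF : F ∈ symmMero γN) :
    ∃ f, IsLevelSymmetric f ∧ F = polyM f := by
  obtain ⟨d, hd⟩ := hF
  induction hd using Submodule.span_induction with
  | zero => exact ⟨0, fun σ => map_zero _, (map_zero _).symm⟩
  | add u v _ _ hu hv =>
    obtain ⟨f, hf, rfl⟩ := hu
    obtain ⟨g, hg, rfl⟩ := hv
    exact ⟨f + g, fun σ => by rw [map_add, hf, hg], (map_add _ f g).symm⟩
  | smul a u _ hu =>
    obtain ⟨f, hf, rfl⟩ := hu
    exact ⟨a • f, fun σ => by rw [map_smul, hf], (map_smul _ a f).symm⟩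
  | mem u hu =>
    obtain ⟨s, h1, -, rfl⟩ := hu
    induction s using Multiset.induction_on with
    | empty =>
      refine ⟨1, fun σ => map_one _, ?_⟩
      rw [Multiset.map_zero, Multiset.prod_zero, map_one]
    | cons i s ih =>
      obtain ⟨f, hf, h2⟩ := ih fun i hi => h1 i (Multiset.mem_cons_of_mem hi)
      have hi := (h1 i (Multiset.mem_cons_self i s)).1
      refine ⟨(∑ j : Fin i.1, (MvPolynomial.X (⟨⟨i.1, hi⟩, j⟩ : Label N)) ^ i.2) * f, fun σ => ?_, ?_⟩
      · rw [map_mul, hf, isLevelSymmetric_powerSum hi]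
      · rw [Multiset.map_cons, Multiset.prod_cons, map_mul, polyM_powerSum γN, h2]

/-- The polynomials in the variables of level `n`. -/
def levelPoly {n : ℕ} (h : n < N) : MvPolynomial (Fin n) ℂ →ₐ[ℂ] MvPolynomial (Label N) ℂ :=
  MvPolynomial.rename fun j => (⟨⟨n, h⟩, j⟩ : Label N)

theorem polyM_levelPoly_esymm {n : ℕ} (h : n < N) (k : ℕ) :
    polyM (levelPoly h (MvPolynomial.esymm (Fin n) ℂ k)) ∈ symmMero γN := by
  have h1 : polyM (levelPoly h (MvPolynomial.esymm (Fin n) ℂ k)) =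
      (univ.val.map ((gzArray γN 0).x n)).esymm k := by
    have h2 : polyM.comp (levelPoly h) = MvPolynomial.aeval ((gzArray γN 0).x n) :=
      MvPolynomial.algHom_ext fun i => by
        rw [MvPolynomial.aeval_X, AlgHom.comp_apply, levelPoly, MvPolynomial.rename_X,
          polyM_X γN h, gzArray_x]
    have h3 := DFunLike.congr_fun h2 (MvPolynomial.esymm (Fin n) ℂ k)
    rw [MvPolynomial.aeval_esymm_eq_multiset_esymm] at h3
    exact h3
  rw [h1]
  exact ⟨_, (gzArray γN 0).esymm_mem n k⟩

/-- By the fundamental theorem of symmetric polynomials it suffices to treat the elementary ones,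
which Newton's identities express by power sums. -/
theorem polyM_levelPoly_mem {n : ℕ} (h : n < N) {f : MvPolynomial (Fin n) ℂ}
    (hf : f.IsSymmetric) : polyM (levelPoly h f) ∈ symmMero γN := by
  obtain ⟨g, hg⟩ := MvPolynomial.esymmAlgHom_fin_surjective ℂ (le_refl n) ⟨f, hf⟩
  have hg' : f = ((MvPolynomial.esymmAlgHom (Fin n) ℂ n) g).1 := by rw [hg]
  rw [hg', MvPolynomial.esymmAlgHom_apply]
  clear hg hg' hf f
  induction g using MvPolynomial.induction_on with
  | C a =>
    rw [MvPolynomial.aeval_C, AlgHom.commutes, AlgHom.commutes]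
    exact ⟨0, (gzArray γN 0).algebraMap_mem_filt a⟩
  | add p q hp hq => rw [map_add, map_add, map_add]; exact add_mem hp hq
  | mul_X p i hp =>
    rw [map_mul, map_mul, map_mul, MvPolynomial.aeval_X]
    exact mul_mem_symmMero γN hp (polyM_levelPoly_esymm γN h _)

/-- The sum of the images of a polynomial under the permutations of each level. -/
def levelSum (f : MvPolynomial (Label N) ℂ) : MvPolynomial (Label N) ℂ :=
  ∑ σ, MvPolynomial.rename (levelPerm σ) f

/-- The sum over a product of symmetric groups factors into sums over the single levels, each
symmetric in its own variables. -/
theorem levelSum_monomial (a : Label N →₀ ℕ) : levelSum (MvPolynomial.monomial a 1) =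
    ∏ n : Fin N, levelPoly n.2 (∑ σ : Equiv.Perm (Fin (n : ℕ)),
      ∏ j, MvPolynomial.X (σ j) ^ a ⟨n, j⟩) := by
  have h1 : ∀ n : Fin N, levelPoly n.2 (∑ σ : Equiv.Perm (Fin (n : ℕ)),
      ∏ j, MvPolynomial.X (σ j) ^ a ⟨n, j⟩) = ∑ σ : Equiv.Perm (Fin (n : ℕ)),
      ∏ j, MvPolynomial.X (⟨n, σ j⟩ : Label N) ^ a ⟨n, j⟩ := by
    intro n
    rw [map_sum]
    refine sum_congr rfl fun σ _ => ?_
    rw [map_prod]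
    refine prod_congr rfl fun j _ => ?_
    rw [map_pow, levelPoly, MvPolynomial.rename_X]
  rw [prod_congr rfl fun n _ => h1 n, prod_univ_sum, Fintype.piFinset_univ, levelSum]
  refine sum_congr rfl fun σ _ => ?_
  rw [MvPolynomial.monomial_eq, MvPolynomial.C_1, one_mul, Finsupp.prod_fintype _ _ (by simp),
    map_prod, Fintype.prod_sigma]
  refine prod_congr rfl fun n _ => prod_congr rfl fun j _ => ?_
  rw [map_pow, MvPolynomial.rename_X]
  rfl

theorem polyM_levelSum_mem (f : MvPolynomial (Label N) ℂ) : polyM (levelSum f) ∈ symmMero γN := by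
  induction f using MvPolynomial.induction_on' with
  | monomial a c =>
    have h : levelSum (MvPolynomial.monomial a c) =
        c • levelSum (MvPolynomial.monomial a (1 : ℂ)) := by
      rw [levelSum, levelSum, smul_sum]
      refine sum_congr rfl fun σ _ => ?_
      rw [← map_smul, MvPolynomial.smul_monomial, smul_eq_mul, mul_one]
    rw [h, map_smul, levelSum_monomial, map_prod]
    refine Submodule.smul_mem _ _ ?_
    refine prod_induction _ (· ∈ symmMero γN) (fun _ _ => mul_mem_symmMero γN)
      (one_mem_symmMero γN) fun n _ => polyM_levelPoly_mem γN n.2 fun τ => ?_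
    rw [map_sum]
    refine Fintype.sum_equiv (Equiv.mulLeft τ) _ _ fun σ => ?_
    rw [map_prod]
    refine prod_congr rfl fun j _ => ?_
    rw [map_pow, MvPolynomial.rename_X]
    rfl
  | add p q hp hq =>
    have : levelSum (p + q) = levelSum p + levelSum q := by
      simp only [levelSum, map_add, sum_add_distrib]
    rw [this, map_add]
    exact add_mem hp hq

/-! ### Evaluation of the operators -/

theorem toMero_ne_zero_of_apply {f : Entire N} {z : Label N → ℂ} (h : f.1 z ≠ 0) :
    toMero f ≠ 0 := by
  intro h0
  have : f = 0 := toMero_injective (h0.trans (map_zero _).symm)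
  rw [this] at h
  exact h rfl

/-- Clearing denominators turns an identity of fractions into one of entire functions, which can be
evaluated wherever the denominators do not vanish. -/
theorem eval_of_eq_sum_div {ι : Type*} (s : Finset ι) (a : Entire N) (f g : ι → Entire N)
    (h : toMero a = ∑ i ∈ s, toMero (f i) / toMero (g i)) (z : Label N → ℂ)
    (hz : ∀ i ∈ s, (g i).1 z ≠ 0) : a.1 z = ∑ i ∈ s, (f i).1 z / (g i).1 z := by
  classical
  let φ : Entire N →ₐ[ℂ] Mero N := IsScalarTower.toAlgHom ℂ (Entire N) (Mero N)
  have hφ : ∀ u, toMero u = φ u := fun _ => rfl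
  have hg : ∀ i ∈ s, φ (g i) ≠ 0 := fun i hi => toMero_ne_zero_of_apply (hz i hi)
  have h1 : a * ∏ i ∈ s, g i = ∑ i ∈ s, f i * ∏ j ∈ s.erase i, g j := by
    apply toMero_injective
    simp only [hφ] at h ⊢
    rw [map_mul, h, sum_mul, map_sum]
    refine sum_congr rfl fun i hi => ?_
    rw [map_mul, ← mul_prod_erase _ _ hi, map_mul, ← mul_assoc, div_mul_cancel₀ _ (hg i hi)]
  have h2 := congrArg (evalHom z) h1
  rw [map_mul, map_prod, map_sum] at h2
  have h3 : ∏ i ∈ s, evalHom z (g i) ≠ 0 := prod_ne_zero_iff.mpr hz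
  have h4 : evalHom z a = ∑ i ∈ s, evalHom z (f i) / evalHom z (g i) := by
    rw [eq_div_of_mul_eq h3 h2, sum_div]
    refine sum_congr rfl fun i hi => ?_
    rw [map_mul, ← mul_prod_erase _ _ hi, map_prod]
    have h5 : ∏ j ∈ s.erase i, evalHom z (g j) ≠ 0 :=
      prod_ne_zero_iff.mpr fun j hj => hz j (mem_of_mem_erase hj)
    rw [mul_div_mul_right _ _ h5]
  exact h4

/-- The value of an entry of the array at a point. -/
def entryVal (z : Label N → ℂ) (n : ℕ) (j : Fin n) : ℂ := (entry γN n j).1 z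

/-- The value of the numerator of `coefA`. -/
def numA (b : ℂ) (n : ℕ) (j : Fin n) (z : Label N → ℂ) : ℂ :=
  ∏ r : Fin (n + 1), (entryVal γN z n j - entryVal γN z (n + 1) r + b / 2)

/-- The value of the numerator of `coefB (n + 1)`. -/
def numB (b : ℂ) (n : ℕ) (j : Fin (n + 1)) (z : Label N → ℂ) : ℂ :=
  ∏ r : Fin n, (entryVal γN z (n + 1) j - entryVal γN z n r + b / 2)

/-- The value of `∏_{s ≠ j} (γ_{nj} - γ_{ns})`. -/
def denVal (n : ℕ) (j : Fin n) (z : Label N → ℂ) : ℂ :=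
  ∏ s ∈ univ.erase j, (entryVal γN z n j - entryVal γN z n s)

theorem gzArray_den (b : ℂ) (n : ℕ) (j : Fin n) :
    (gzArray γN b).den n j = toMero (∏ s ∈ univ.erase j, (entry γN n j - entry γN n s)) := by
  let φ : Entire N →ₐ[ℂ] Mero N := IsScalarTower.toAlgHom ℂ (Entire N) (Mero N)
  change _ = φ _
  rw [map_prod, ShiftArray.den]
  exact prod_congr rfl fun s _ => (map_sub φ _ _).symm

theorem translateHom_polyE (p : Label N) (c : ℂ) (f : MvPolynomial (Label N) ℂ)
    (z : Label N → ℂ) :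
    (translateHom p c (polyE f)).1 z = MvPolynomial.eval (z + Pi.single p c) f := by
  rw [translateHom_apply, polyE_apply]

theorem eval_opA {b : ℂ} {n : ℕ} (h : n < N) {f a : MvPolynomial (Label N) ℂ}
    (ha : (gzArray γN b).opA n (polyM f) = polyM a) (z : Label N → ℂ)
    (hz : ∀ j, denVal γN n j z ≠ 0) :
    MvPolynomial.eval z a = ∑ j, numA γN b n j z *
      MvPolynomial.eval (z + Pi.single ⟨⟨n, h⟩, j⟩ b) f / denVal γN n j z := by
  let φ : Entire N →ₐ[ℂ] Mero N := IsScalarTower.toAlgHom ℂ (Entire N) (Mero N)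
  have hev : ∀ j, evalHom z (∏ s ∈ univ.erase j, (entry γN n j - entry γN n s)) =
      denVal γN n j z := fun j => by
    rw [map_prod]; rfl
  have h1 : toMero (polyE a) = ∑ j, toMero ((∏ r : Fin (n + 1), (entry γN n j -
      entry γN (n + 1) r + cst N (b / 2))) * translateHom ⟨⟨n, h⟩, j⟩ b (polyE f)) /
      toMero (∏ s ∈ univ.erase j, (entry γN n j - entry γN n s)) := by
    rw [← polyM_apply, ← ha, ShiftArray.opA_apply]
    refine sum_congr rfl fun j _ => ?_
    rw [gzArray_coefA, gzArray_τ γN b h, polyM_apply, shiftAlg_toMero, gzArray_den, toMero_mul,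
      div_mul_eq_mul_div]
    congr 2
    exact (map_prod φ _ _).symm
  have h2 := eval_of_eq_sum_div univ _ _ _ h1 z fun j _ => by
    have := hz j
    rwa [← hev] at this
  rw [polyE_apply] at h2
  rw [h2]
  refine sum_congr rfl fun j _ => ?_
  rw [entire_mul_apply, translateHom_polyE, ← hev]
  congr 2
  change evalHom z _ = _
  rw [map_prod]
  rfl

theorem eval_opB {b : ℂ} {n : ℕ} (h : n + 1 < N) {f a : MvPolynomial (Label N) ℂ}
    (ha : (gzArray γN b).opB (n + 1) (polyM f) = polyM a) (z : Label N → ℂ)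
    (hz : ∀ j, denVal γN (n + 1) j z ≠ 0) :
    MvPolynomial.eval z a = ∑ j, numB γN b n j z *
      MvPolynomial.eval (z + Pi.single ⟨⟨n + 1, h⟩, j⟩ b) f / denVal γN (n + 1) j z := by
  let φ : Entire N →ₐ[ℂ] Mero N := IsScalarTower.toAlgHom ℂ (Entire N) (Mero N)
  have hev : ∀ j, evalHom z (∏ s ∈ univ.erase j, (entry γN (n + 1) j - entry γN (n + 1) s)) =
      denVal γN (n + 1) j z := fun j => by
    rw [map_prod]; rfl
  have h1 : toMero (polyE a) = ∑ j, toMero ((∏ r : Fin n, (entry γN (n + 1) j -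
      entry γN n r + cst N (b / 2))) * translateHom ⟨⟨n + 1, h⟩, j⟩ b (polyE f)) /
      toMero (∏ s ∈ univ.erase j, (entry γN (n + 1) j - entry γN (n + 1) s)) := by
    rw [← polyM_apply, ← ha, ShiftArray.opB_apply]
    refine sum_congr rfl fun j _ => ?_
    rw [gzArray_coefB, gzArray_τ γN b h, polyM_apply, shiftAlg_toMero, gzArray_den, toMero_mul,
      div_mul_eq_mul_div]
    congr 2
    exact (map_prod φ _ _).symm
  have h2 := eval_of_eq_sum_div univ _ _ _ h1 z fun j _ => by
    have := hz j
    rwa [← hev] at this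
  rw [polyE_apply] at h2
  rw [h2]
  refine sum_congr rfl fun j _ => ?_
  rw [entire_mul_apply, translateHom_polyE, ← hev]
  congr 2
  change evalHom z _ = _
  rw [map_prod]
  rfl

end

/-! ### Analytic estimates and contour shifts. -/

section

open MeasureTheory Set Filter Topology

/-! ### Decay of the Gamma function -/

theorem norm_GammaSeq (σ y : ℝ) {n : ℕ} (hn : n ≠ 0) :
    ‖Complex.GammaSeq (σ + y * Complex.I) n‖ = (n : ℝ) ^ σ * n.factorial /
      ∏ j ∈ Finset.range (n + 1), ‖((σ + j : ℝ) : ℂ) + y * Complex.I‖ := by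
  rw [Complex.GammaSeq, norm_div, norm_mul, norm_prod]
  refine congrArg₂ _ (congrArg₂ _ ?_ ?_) ?_
  · rw [show (n : ℂ) = ((n : ℝ) : ℂ) by norm_cast,
      Complex.norm_cpow_eq_rpow_re_of_pos (by exact_mod_cast Nat.pos_of_ne_zero hn)]
    simp
  · exact Complex.norm_natCast _
  · refine Finset.prod_congr rfl fun j _ => ?_
    congr 1
    push_cast
    ring

/-- The quotient `|Γ(σ + iy)| / Γ(σ)` increases with `σ > 0`. -/
theorem norm_Gamma_mul_le {σ τ : ℝ} (hσ : 0 < σ) (hτ : σ ≤ τ) (y : ℝ) :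
    ‖Complex.Gamma (σ + y * Complex.I)‖ * ‖Complex.Gamma τ‖ ≤
      ‖Complex.Gamma σ‖ * ‖Complex.Gamma (τ + y * Complex.I)‖ := by
  -- In Euler's limit formula the powers of n and the factorials agree on both sides, so the
  -- denominators can be compared factor by factor.
  have h1 := (Complex.GammaSeq_tendsto_Gamma (σ + y * Complex.I)).norm.mul
    (Complex.GammaSeq_tendsto_Gamma τ).norm
  have h2 := (Complex.GammaSeq_tendsto_Gamma σ).norm.mul
    (Complex.GammaSeq_tendsto_Gamma (τ + y * Complex.I)).norm
  refine le_of_tendsto_of_tendsto h1 h2 ?_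
  filter_upwards [eventually_ne_atTop 0] with n hn
  have e0 : ∀ s : ℝ, ‖Complex.GammaSeq s n‖ = (n : ℝ) ^ s * n.factorial /
      ∏ j ∈ Finset.range (n + 1), ‖((s + j : ℝ) : ℂ) + (0 : ℝ) * Complex.I‖ := fun s => by
    rw [← norm_GammaSeq s 0 hn]; simp
  rw [e0, e0, norm_GammaSeq _ _ hn, norm_GammaSeq _ _ hn, div_mul_div_comm, div_mul_div_comm,
    ← Finset.prod_mul_distrib, ← Finset.prod_mul_distrib,
    mul_comm ((n : ℝ) ^ σ * n.factorial)]
  have pos : ∀ s : ℝ, 0 < s → ∀ (j : ℕ) (v : ℝ), 0 < ‖((s + j : ℝ) : ℂ) + v * Complex.I‖ := by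
    intro s hs j v
    rw [norm_pos_iff]
    intro h
    have := congrArg Complex.re h
    simp at this
    have hj : (0 : ℝ) ≤ j := j.cast_nonneg
    linarith
  have hτ0 := hσ.trans_le hτ
  rw [mul_comm ((n : ℝ) ^ τ * _)]
  refine div_le_div_of_nonneg_left (by positivity)
    (Finset.prod_pos fun j _ => mul_pos (pos _ hσ _ _) (pos _ hτ0 _ _))
    (Finset.prod_le_prod (fun j _ => by positivity) fun j _ => ?_)
  rw [← abs_of_nonneg (norm_nonneg (((σ + j : ℝ) : ℂ) + (0 : ℝ) * Complex.I)),
    ← abs_of_nonneg (norm_nonneg (((σ + j : ℝ) : ℂ) + y * Complex.I)),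
    ← abs_of_nonneg (norm_nonneg (((τ + j : ℝ) : ℂ) + (0 : ℝ) * Complex.I)),
    ← abs_of_nonneg (norm_nonneg (((τ + j : ℝ) : ℂ) + y * Complex.I)), ← abs_mul, ← abs_mul]
  -- After squaring and expanding, the claim is (σ + j)² y² ≤ (τ + j)² y².
  apply sq_le_sq.mp
  rw [mul_pow, mul_pow]
  simp only [← Complex.normSq_eq_norm_sq, Complex.normSq_add_mul_I]
  have hj : (0 : ℝ) ≤ j := j.cast_nonneg
  have h3 : (σ + j) ^ 2 ≤ (τ + j) ^ 2 := by
    apply pow_le_pow_left₀ <;> linarith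
  nlinarith [mul_le_mul_of_nonneg_right h3 (sq_nonneg y)]

/-- On the line Re u = 1/2 one has 1 - u = conj u, so the reflection formula computes |Γ(u)|². -/
theorem norm_Gamma_half_sq (y : ℝ) :
    ‖Complex.Gamma (1 / 2 + y * Complex.I)‖ ^ 2 = Real.pi / Real.cosh (Real.pi * y) := by
  have h := Complex.Gamma_mul_Gamma_one_sub (1 / 2 + y * Complex.I)
  have h1 : 1 - (1 / 2 + y * Complex.I) = conj (1 / 2 + y * Complex.I) := by
    simp only [map_add, map_mul, Complex.conj_I, Complex.conj_ofReal, map_div₀, map_one]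
    rw [Complex.conj_ofNat]
    ring
  rw [h1, Complex.Gamma_conj, Complex.mul_conj, Complex.normSq_eq_norm_sq] at h
  have h2 : Complex.sin (Real.pi * (1 / 2 + y * Complex.I)) =
      ((Real.cosh (Real.pi * y) : ℝ) : ℂ) := by
    rw [mul_add, show (Real.pi : ℂ) * (1 / 2) = Real.pi / 2 by ring, add_comm,
      Complex.sin_add_pi_div_two, ← mul_assoc, Complex.cos_mul_I]
    push_cast
    rfl
  rw [h2] at h
  exact_mod_cast h

theorem norm_Gamma_half_le (y : ℝ) :
    ‖Complex.Gamma (1 / 2 + y * Complex.I)‖ ≤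
      Real.sqrt (2 * Real.pi) * Real.exp (-(Real.pi / 2) * |y|) := by
  apply le_of_sq_le_sq _ (by positivity)
  rw [norm_Gamma_half_sq, mul_pow, Real.sq_sqrt (by positivity), ← Real.exp_nat_mul,
    div_le_iff₀ (Real.cosh_pos _), ← Real.cosh_abs, abs_mul, abs_of_pos Real.pi_pos,
    Real.cosh_eq]
  have h1 : Real.exp ((2 : ℕ) * (-(Real.pi / 2) * |y|)) * Real.exp (Real.pi * |y|) = 1 := by
    rw [← Real.exp_add, Real.exp_eq_one_iff]; push_cast; ring
  have h2 : 0 < Real.exp ((2 : ℕ) * (-(Real.pi / 2) * |y|)) * Real.exp (-(Real.pi * |y|)) := by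
    positivity
  nlinarith [Real.pi_pos]

/-- In the strip `1/2 ≤ Re u ≤ 3/2` the Gamma function decays like `exp (-(π/2 - δ) |Im u|)`. -/
theorem exists_norm_Gamma_le {δ : ℝ} (hδ : 0 < δ) : ∃ C, 0 ≤ C ∧ ∀ u : ℂ, 1 / 2 ≤ u.re →
    u.re ≤ 3 / 2 → ‖Complex.Gamma u‖ ≤ C * Real.exp (-(Real.pi / 2) * |u.im| + δ * |u.im|) := by
  obtain ⟨C₀, hC₀⟩ : ∃ C₀, ∀ σ ∈ Icc (1 / 2 : ℝ) (3 / 2), ‖Complex.Gamma σ‖ ≤ C₀ := by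
    refine isCompact_Icc.exists_bound_of_continuousOn fun σ hσ => ?_
    refine (ContinuousAt.comp (Complex.differentiableAt_Gamma _ fun m h => ?_).continuousAt
      Complex.continuous_ofReal.continuousAt).continuousWithinAt
    have h' := congrArg Complex.re h
    simp at h'
    have : (0 : ℝ) ≤ m := m.cast_nonneg
    linarith [hσ.1]
  have hC₀' : 0 ≤ C₀ := (norm_nonneg _).trans (hC₀ 1 ⟨by norm_num, by norm_num⟩)
  have hG : 0 < ‖Complex.Gamma (3 / 2 : ℝ)‖ := by
    rw [norm_pos_iff]
    exact Complex.Gamma_ne_zero_of_re_pos (by rw [Complex.ofReal_re]; norm_num)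
  set G := ‖Complex.Gamma (3 / 2 : ℝ)‖
  refine ⟨C₀ / G * ((1 + δ⁻¹) * Real.sqrt (2 * Real.pi)), by positivity, fun u h1 h2 => ?_⟩
  -- Monotonicity moves u to the line Re u = 3/2. The functional equation leads from there to Re u =
  -- 1/2, where the decay is known, and the linear factor it costs is absorbed by exp (δ |Im u|).
  have h3 := norm_Gamma_mul_le (by linarith) h2 u.im
  rw [Complex.re_add_im] at h3
  have h4 : ‖Complex.Gamma ((3 / 2 : ℝ) + u.im * Complex.I)‖ ≤
      (1 / 2 + |u.im|) * (Real.sqrt (2 * Real.pi) * Real.exp (-(Real.pi / 2) * |u.im|)) := by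
    have hne : (1 / 2 + u.im * Complex.I : ℂ) ≠ 0 := fun h => by
      have := congrArg Complex.re h
      simp at this
    rw [show (((3 / 2 : ℝ) : ℂ) + u.im * Complex.I) = (1 / 2 + u.im * Complex.I) + 1 by
      push_cast; ring, Complex.Gamma_add_one _ hne, norm_mul]
    refine mul_le_mul ?_ (norm_Gamma_half_le _) (norm_nonneg _) (by positivity)
    refine (norm_add_le _ _).trans ?_
    rw [norm_mul, Complex.norm_I, mul_one, Complex.norm_real, Real.norm_eq_abs]
    norm_num
  have h5 : (1 / 2 + |u.im|) ≤ (1 + δ⁻¹) * Real.exp (δ * |u.im|) := by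
    have h6 := Real.add_one_le_exp (δ * |u.im|)
    have h7 : |u.im| ≤ δ⁻¹ * Real.exp (δ * |u.im|) := by
      rw [inv_mul_eq_div, le_div_iff₀ hδ]; linarith
    have h8 : 1 ≤ Real.exp (δ * |u.im|) := Real.one_le_exp (by positivity)
    linarith
  rw [Real.exp_add]
  have h9 : ‖Complex.Gamma u‖ ≤ C₀ / G * ‖Complex.Gamma ((3 / 2 : ℝ) + u.im * Complex.I)‖ := by
    rw [div_mul_eq_mul_div, le_div_iff₀ hG]
    exact h3.trans (mul_le_mul_of_nonneg_right (hC₀ _ ⟨h1, h2⟩) (norm_nonneg _))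
  refine h9.trans ?_
  rw [mul_assoc]
  refine mul_le_mul_of_nonneg_left (h4.trans ?_) (by positivity)
  refine (mul_le_mul_of_nonneg_right h5 (by positivity)).trans (le_of_eq ?_)
  ring

end

section

open MeasureTheory Set Filter Topology

/-! ### The energy of two neighbouring levels -/

section Energy

/-- The indicator of `t < x`. -/
def step (t x : ℝ) : ℝ := if t < x then 1 else 0

theorem step_sq (t x : ℝ) : step t x ^ 2 = step t x := by
  unfold step; split_ifs <;> norm_num

theorem step_sub_sq (x y : ℝ) : (fun t => (step t x - step t y) ^ 2) =
    (Ico (min x y) (max x y)).indicator fun _ => (1 : ℝ) := by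
  funext t
  simp only [step, indicator, mem_Ico, min_le_iff, lt_max_iff]
  split_ifs with h1 h2 h3 h3 h3 h3 <;> first | (norm_num; done) | (exfalso; grind)

theorem integrable_step_sub_sq (x y : ℝ) : Integrable fun t => (step t x - step t y) ^ 2 := by
  rw [step_sub_sq, integrable_indicator_iff measurableSet_Ico]
  exact integrableOn_const (by simp)

theorem integral_step_sub_sq (x y : ℝ) : ∫ t, (step t x - step t y) ^ 2 = |x - y| := by
  rw [step_sub_sq, integral_indicator measurableSet_Ico]
  simp [max_sub_min_eq_abs']

variable {α β : Type*} [Fintype α] [Fintype β]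

/-- The sum of the distances between the points of two families. -/
def gap (a : α → ℝ) (b : β → ℝ) : ℝ := ∑ k, ∑ m, |a k - b m|

/-- The excess of the distances between two families over those within each of them. -/
def energy (a : α → ℝ) (b : β → ℝ) : ℝ := gap a b - gap a a / 2 - gap b b / 2

theorem gap_nonneg (a : α → ℝ) (b : β → ℝ) : 0 ≤ gap a b :=
  Finset.sum_nonneg fun _ _ => Finset.sum_nonneg fun _ _ => abs_nonneg _

/-- The density in the representation of `gap` as an integral over thresholds. -/
def gapDensity (a : α → ℝ) (b : β → ℝ) (t : ℝ) : ℝ :=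
  ∑ k, ∑ m, (step t (a k) - step t (b m)) ^ 2

theorem integrable_gapDensity (a : α → ℝ) (b : β → ℝ) : Integrable (gapDensity a b) :=
  integrable_finsetSum _ fun _ _ => integrable_finsetSum _ fun _ _ => integrable_step_sub_sq _ _

theorem integral_gapDensity (a : α → ℝ) (b : β → ℝ) : ∫ t, gapDensity a b t = gap a b := by
  unfold gapDensity gap
  rw [integral_finsetSum _ fun _ _ => integrable_finsetSum _ fun _ _ => integrable_step_sub_sq _ _]
  refine Finset.sum_congr rfl fun k _ => ?_
  rw [integral_finsetSum _ fun _ _ => integrable_step_sub_sq _ _]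
  exact Finset.sum_congr rfl fun m _ => integral_step_sub_sq _ _

theorem gapDensity_eq (a : α → ℝ) (b : β → ℝ) (t : ℝ) : gapDensity a b t =
    Fintype.card β * ∑ k, step t (a k) + Fintype.card α * ∑ m, step t (b m) -
      2 * (∑ k, step t (a k)) * ∑ m, step t (b m) := by
  have h : ∀ k m, (step t (a k) - step t (b m)) ^ 2 =
      step t (a k) + step t (b m) - 2 * (step t (a k) * step t (b m)) := fun k m => by
    linear_combination step_sq t (a k) + step_sq t (b m)
  simp only [gapDensity, h, Finset.sum_add_distrib, Finset.sum_sub_distrib, Finset.sum_const,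
    Finset.card_univ, nsmul_eq_mul, ← Finset.mul_sum]
  rw [mul_assoc 2, Finset.sum_mul]

theorem energy_eq_integral (a : α → ℝ) (b : β → ℝ) : energy a b =
    ∫ t, (gapDensity a b t - gapDensity a a t / 2 - gapDensity b b t / 2) := by
  rw [integral_sub (f := fun t => gapDensity a b t - gapDensity a a t / 2)
    ((integrable_gapDensity a b).sub ((integrable_gapDensity a a).div_const 2))
    ((integrable_gapDensity b b).div_const 2), integral_sub (integrable_gapDensity a b)
    ((integrable_gapDensity a a).div_const 2), integral_div, integral_div, integral_gapDensity,
    integral_gapDensity, integral_gapDensity, energy]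

variable (hc : Fintype.card β = Fintype.card α + 1)
include hc

/-- The density depends only on the numbers of points of a and b above the threshold t. As b has
exactly one point more than a, it equals z(z + 1) with z the difference of these numbers,
nonnegative because z is an integer. -/
theorem energyDensity_eq (a : α → ℝ) (b : β → ℝ) (t : ℝ) :
    gapDensity a b t - gapDensity a a t / 2 - gapDensity b b t / 2 =
      (∑ k, step t (a k) - ∑ m, step t (b m)) * (∑ k, step t (a k) - ∑ m, step t (b m) + 1) := by
  rw [gapDensity_eq, gapDensity_eq, gapDensity_eq, hc]
  push_cast
  ring

theorem energyDensity_nonneg (a : α → ℝ) (b : β → ℝ) (t : ℝ) :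
    0 ≤ gapDensity a b t - gapDensity a a t / 2 - gapDensity b b t / 2 := by
  rw [energyDensity_eq hc]
  obtain ⟨z, hz⟩ : ∃ z : ℤ, (z : ℝ) = ∑ k, step t (a k) - ∑ m, step t (b m) := by
    refine ⟨∑ k, (if t < a k then 1 else 0) - ∑ m, (if t < b m then 1 else 0), ?_⟩
    push_cast
    rfl
  rw [← hz]
  have h : 0 ≤ z * (z + 1) := by
    rcases le_or_gt 0 z with h | h
    · positivity
    · nlinarith
  exact_mod_cast h

theorem energy_nonneg (a : α → ℝ) (b : β → ℝ) : 0 ≤ energy a b := by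
  rw [energy_eq_integral]
  exact integral_nonneg fun t => energyDensity_nonneg hc a b t

/-- For thresholds between M and a k no point of b lies above, while a k does; there z ≥ 1, the
density is at least 2, and the length of the interval is at most half the energy. -/
theorem le_of_forall_le (a : α → ℝ) (b : β → ℝ) {M : ℝ} (h : ∀ m, b m ≤ M) (k : α) :
    a k ≤ M + energy a b / 2 := by
  have h1 : ∫ t, (Ico M (a k)).indicator (fun _ => (2 : ℝ)) t ≤ energy a b := by
    rw [energy_eq_integral]
    refine integral_mono ?_ (((integrable_gapDensity a b).sub
      ((integrable_gapDensity a a).div_const 2)).sub ((integrable_gapDensity b b).div_const 2)) ?_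
    · rw [integrable_indicator_iff measurableSet_Ico]
      exact integrableOn_const (by simp)
    · intro t
      by_cases ht : t ∈ Ico M (a k)
      · change _ ≤ gapDensity a b t - gapDensity a a t / 2 - gapDensity b b t / 2
        rw [indicator_of_mem ht, energyDensity_eq hc]
        have h2 : ∑ m, step t (b m) = 0 := Finset.sum_eq_zero fun m _ =>
          if_neg (not_lt.mpr ((h m).trans ht.1))
        have h3 : (1 : ℝ) ≤ ∑ k, step t (a k) := by
          have h4 : step t (a k) = 1 := if_pos ht.2
          rw [← h4]
          refine Finset.single_le_sum (f := fun k => step t (a k)) (fun k _ => ?_)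
            (Finset.mem_univ k)
          unfold step; split_ifs <;> norm_num
        rw [h2]
        nlinarith
      · rw [indicator_of_notMem ht]
        exact energyDensity_nonneg hc a b t
  rw [integral_indicator measurableSet_Ico] at h1
  simp at h1
  have := le_max_left (a k - M) 0
  linarith

theorem ge_of_forall_ge (a : α → ℝ) (b : β → ℝ) {M : ℝ} (h : ∀ m, -M ≤ b m) (k : α) :
    -M - energy a b / 2 ≤ a k := by
  have e : energy (-a) (-b) = energy a b := by
    have : ∀ x y : ℝ, |(-x) - -y| = |x - y| := fun x y => by rw [← abs_neg]; congr 1; ring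
    simp only [energy, gap, Pi.neg_apply, this]
  have h1 := le_of_forall_le hc (-a) (-b) (M := M) (fun m => by
    have := h m
    simp only [Pi.neg_apply]; linarith) k
  rw [e] at h1
  simp only [Pi.neg_apply] at h1
  linarith

theorem abs_le_of_forall_abs_le (a : α → ℝ) (b : β → ℝ) {M : ℝ} (h : ∀ m, |b m| ≤ M) (k : α) :
    |a k| ≤ M + energy a b / 2 :=
  abs_le.mpr ⟨by linarith [ge_of_forall_ge hc a b (fun m => (abs_le.mp (h m)).1) k],
    le_of_forall_le hc a b (fun m => (abs_le.mp (h m)).2) k⟩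

end Energy

/-- Descending through the levels, the sum of the energies bounds all entries of an array. -/
theorem abs_le_sum_energy {N : ℕ} (a : (n : ℕ) → Fin n → ℝ) {M : ℝ} (h : ∀ k, |a N k| ≤ M)
    {n : ℕ} (hn : n ≤ N) (k : Fin n) :
    |a n k| ≤ M + (∑ l ∈ Finset.Ico n N, energy (a l) (a (l + 1))) / 2 := by
  induction hn using Nat.decreasingInduction with
  | self => rw [Finset.Ico_self, Finset.sum_empty, zero_div, add_zero]; exact h k
  | of_succ l hl ih =>
    have h1 := abs_le_of_forall_abs_le (by simp) (a l) (a (l + 1)) (fun m => ih m) k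
    rw [← Finset.add_sum_Ioo_eq_sum_Ico hl]
    rw [show Finset.Ico (l + 1) N = Finset.Ioo l N by ext; simp] at h1
    linarith

/-- The telescoping of the energies: distances between neighbouring levels against distances within
the levels below the top. -/
theorem sum_energy_le {N : ℕ} (a : (n : ℕ) → Fin n → ℝ) :
    ∑ n ∈ Finset.Ico 1 N, energy (a n) (a (n + 1)) ≤
      ∑ n ∈ Finset.Ico 1 N, gap (a n) (a (n + 1)) - ∑ n ∈ Finset.Ico 1 N, gap (a n) (a n) := by
  have h1 : ∀ N, ∑ n ∈ Finset.Ico 1 N, gap (a n) (a n) ≤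
      ∑ n ∈ Finset.Ico 1 N, (gap (a n) (a n) / 2 + gap (a (n + 1)) (a (n + 1)) / 2) := by
    intro N
    rcases Nat.lt_or_ge N 1 with hN | hN
    · simp [Finset.Ico_eq_empty_of_le hN.le]
    -- Level 1 has a single point and hence no gap. Half the gap of level N is left over; it is
    -- nonnegative and can be dropped.
    · have h2 : ∑ n ∈ Finset.Ico 1 N, gap (a n) (a n) + gap (a N) (a N) / 2 =
        ∑ n ∈ Finset.Ico 1 N, (gap (a n) (a n) / 2 + gap (a (n + 1)) (a (n + 1)) / 2) := by
        induction N, hN using Nat.le_induction with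
        | base => simp [gap]
        | succ l hl ih =>
          rw [Finset.sum_Ico_succ_top hl, Finset.sum_Ico_succ_top hl, ← ih]
          ring
      linarith [gap_nonneg (a N) (a N)]
  have h3 := h1 N
  simp only [energy, Finset.sum_sub_distrib, Finset.sum_add_distrib] at h3 ⊢
  linarith

end

section

open MeasureTheory Set Filter Topology

/-! ### Exponentially decaying functions of several real variables -/

section Decay

variable {ι : Type*} [Fintype ι]

/-- The norm `∑ |x_i|`. -/
def absSum (x : ι → ℝ) : ℝ := ∑ i, |x i|

theorem absSum_nonneg (x : ι → ℝ) : 0 ≤ absSum x := Finset.sum_nonneg fun _ _ => abs_nonneg _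

theorem abs_le_absSum (x : ι → ℝ) (i : ι) : |x i| ≤ absSum x :=
  Finset.single_le_sum (f := fun i => |x i|) (fun _ _ => abs_nonneg _) (Finset.mem_univ i)

theorem integrable_exp_neg_abs {ε : ℝ} (hε : 0 < ε) :
    Integrable fun x : ℝ => Real.exp (-ε * |x|) := by
  have h1 : IntegrableOn (fun x : ℝ => Real.exp (-ε * |x|)) (Ici 0) := by
    rw [integrableOn_Ici_iff_integrableOn_Ioi]
    refine (exp_neg_integrableOn_Ioi 0 hε).congr_fun (fun x hx => ?_) measurableSet_Ioi
    simp only [abs_of_pos (mem_Ioi.mp hx)]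
  have h2 : IntegrableOn (fun x : ℝ => Real.exp (-ε * |x|)) (Iic 0) := by
    have h3 := (neg_zero (G := ℝ).symm ▸ h1).comp_neg_Iic
    refine h3.congr_fun (fun x _ => ?_) measurableSet_Iic
    simp only [abs_neg]
  rw [← integrableOn_univ, ← Iic_union_Ici (a := (0 : ℝ))]
  exact h2.union h1

theorem integrable_exp_neg_absSum {ε : ℝ} (hε : 0 < ε) :
    Integrable fun x : ι → ℝ => Real.exp (-ε * absSum x) := by
  have h := Integrable.fintype_prod (ι := ι) (f := fun _ x => Real.exp (-ε * |x|))
    (μ := fun _ => volume) fun _ => integrable_exp_neg_abs hε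
  refine h.congr (Eventually.of_forall fun x => ?_)
  simp only [absSum, Finset.mul_sum, Real.exp_sum]

/-- `f` is bounded by a multiple of `exp (A + δ S)` for every `δ > 0`. -/
def ExpBound {X : Type*} (S : X → ℝ) (f : X → ℂ) (A : X → ℝ) : Prop :=
  ∀ δ > 0, ∃ C, 0 ≤ C ∧ ∀ x, ‖f x‖ ≤ C * Real.exp (A x + δ * S x)

namespace ExpBound

variable {X : Type*} {S : X → ℝ}

theorem mul {f g : X → ℂ} {A B : X → ℝ} (hf : ExpBound S f A) (hg : ExpBound S g B) :
    ExpBound S (fun x => f x * g x) (fun x => A x + B x) := by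
  intro δ hδ
  obtain ⟨C, hC, h1⟩ := hf (δ / 2) (half_pos hδ)
  obtain ⟨D, hD, h2⟩ := hg (δ / 2) (half_pos hδ)
  refine ⟨C * D, mul_nonneg hC hD, fun x => ?_⟩
  rw [norm_mul]
  refine (mul_le_mul (h1 x) (h2 x) (norm_nonneg _) (by positivity)).trans (le_of_eq ?_)
  rw [mul_mul_mul_comm, ← Real.exp_add]
  congr 2
  ring

theorem mono {f : X → ℂ} {A B : X → ℝ} (hf : ExpBound S f A) {c : ℝ} (h : ∀ x, A x ≤ B x + c) :
    ExpBound S f B := by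
  intro δ hδ
  obtain ⟨C, hC, h1⟩ := hf δ hδ
  refine ⟨C * Real.exp c, by positivity, fun x => (h1 x).trans ?_⟩
  rw [mul_assoc, ← Real.exp_add]
  refine mul_le_mul_of_nonneg_left (Real.exp_le_exp.mpr ?_) hC
  linarith [h x]

theorem const (hS : ∀ x, 0 ≤ S x) (c : ℂ) : ExpBound S (fun _ => c) (fun _ => 0) := by
  intro δ hδ
  refine ⟨‖c‖, norm_nonneg _, fun x => ?_⟩
  refine le_mul_of_one_le_right (norm_nonneg _) (Real.one_le_exp ?_)
  have := hS x
  positivity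

theorem of_norm_le {f g : X → ℂ} {A : X → ℝ} (hf : ExpBound S f A) (h : ∀ x, ‖g x‖ ≤ ‖f x‖) :
    ExpBound S g A := by
  intro δ hδ
  obtain ⟨C, hC, h1⟩ := hf δ hδ
  exact ⟨C, hC, fun x => (h x).trans (h1 x)⟩

theorem of_norm_le_exp (hS : ∀ x, 0 ≤ S x) {f : X → ℂ} {A : X → ℝ} {C : ℝ}
    (h : ∀ x, ‖f x‖ ≤ C * Real.exp (A x)) : ExpBound S f A := by
  intro δ hδ
  refine ⟨|C|, abs_nonneg _, fun x => (h x).trans ?_⟩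
  refine mul_le_mul (le_abs_self _) (Real.exp_le_exp.mpr ?_) (Real.exp_nonneg _) (abs_nonneg _)
  have := mul_nonneg hδ.le (hS x)
  linarith

theorem prod (hS : ∀ x, 0 ≤ S x) {κ : Type*} (s : Finset κ) {f : κ → X → ℂ} {A : κ → X → ℝ}
    (h : ∀ i ∈ s, ExpBound S (f i) (A i)) :
    ExpBound S (fun x => ∏ i ∈ s, f i x) (fun x => ∑ i ∈ s, A i x) := by
  classical
  induction s using Finset.induction_on with
  | empty => simpa using const hS 1
  | insert i s hi ih =>
    simp only [Finset.prod_insert hi, Finset.sum_insert hi]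
    exact (h i (Finset.mem_insert_self i s)).mul
      (ih fun j hj => h j (Finset.mem_insert_of_mem hj))

theorem add {f g : X → ℂ} {A : X → ℝ} (hf : ExpBound S f A) (hg : ExpBound S g A) :
    ExpBound S (fun x => f x + g x) A := by
  intro δ hδ
  obtain ⟨C, hC, h1⟩ := hf δ hδ
  obtain ⟨D, hD, h2⟩ := hg δ hδ
  refine ⟨C + D, add_nonneg hC hD, fun x => (norm_add_le _ _).trans ?_⟩
  rw [add_mul]
  exact add_le_add (h1 x) (h2 x)

/-- A linearly bounded function is subexponential. -/
theorem of_norm_le_linear (hS : ∀ x, 0 ≤ S x) {f : X → ℂ} {c d : ℝ}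
    (h : ∀ x, ‖f x‖ ≤ c + d * S x) : ExpBound S f (fun _ => 0) := by
  intro δ hδ
  refine ⟨|c| + |d| * δ⁻¹, by positivity, fun x => (h x).trans ?_⟩
  rw [zero_add, add_mul]
  have h1 : 1 ≤ Real.exp (δ * S x) := Real.one_le_exp (mul_nonneg hδ.le (hS x))
  have h2 : S x ≤ δ⁻¹ * Real.exp (δ * S x) := by
    rw [inv_mul_eq_div, le_div_iff₀ hδ]
    linarith [Real.add_one_le_exp (δ * S x)]
  refine add_le_add ((le_abs_self c).trans (le_mul_of_one_le_right (abs_nonneg _) h1)) ?_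
  rw [mul_assoc]
  exact mul_le_mul (le_abs_self d) h2 (hS x) (abs_nonneg _)

/-- Polynomials in subexponential functions are subexponential. -/
theorem eval (hS : ∀ x, 0 ≤ S x) {κ : Type*} {z : X → κ → ℂ}
    (hz : ∀ i, ExpBound S (fun x => z x i) (fun _ => 0)) (r : MvPolynomial κ ℂ) :
    ExpBound S (fun x => MvPolynomial.eval (z x) r) (fun _ => 0) := by
  induction r using MvPolynomial.induction_on with
  | C a => simpa using const hS a
  | add p q hp hq => simpa using hp.add hq
  | mul_X p i hp => simpa using hp.mul (hz i)

end ExpBound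

/-- An exponentially decaying measurable function is integrable. -/
theorem integrable_of_norm_le {f : (ι → ℝ) → ℂ} (hf : AEStronglyMeasurable f) {C ε : ℝ}
    (hε : 0 < ε) (h : ∀ x, ‖f x‖ ≤ C * Real.exp (-ε * absSum x)) : Integrable f :=
  ((integrable_exp_neg_absSum hε).const_mul C).mono' hf (Eventually.of_forall h)

end Decay

end

section

open MeasureTheory Set Filter Topology

/-! ### Shifts of the contour of integration -/

/-- The integral of a decaying holomorphic function over a horizontal line in a strip does not
depend on the line. -/
theorem integral_eq_integral_add_mul_I {f : ℂ → ℂ} {h C ε : ℝ} (hh : 0 ≤ h) (hε : 0 < ε)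
    (hf : ∀ z : ℂ, 0 ≤ z.im → z.im ≤ h → DifferentiableAt ℂ f z)
    (hC : ∀ z : ℂ, 0 ≤ z.im → z.im ≤ h → ‖f z‖ ≤ C * Real.exp (-ε * |z.re|)) :
    ∫ x : ℝ, f x = ∫ x : ℝ, f (x + h * Complex.I) := by
  have hint : ∀ s : ℝ, 0 ≤ s → s ≤ h → Integrable fun x : ℝ => f (x + s * Complex.I) := by
    intro s h0 h1
    refine ((integrable_exp_neg_abs hε).const_mul C).mono' ?_ (Eventually.of_forall fun x => ?_)
    · refine Continuous.aestronglyMeasurable (continuous_iff_continuousAt.mpr fun x => ?_)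
      exact ContinuousAt.comp (f := fun x : ℝ => (x : ℂ) + s * Complex.I)
        (hf _ (by simpa using h0) (by simpa using h1)).continuousAt (by fun_prop)
    · simpa using hC (x + s * Complex.I) (by simpa using h0) (by simpa using h1)
  have h0 : Integrable fun x : ℝ => f x := by simpa using hint 0 le_rfl hh
  have hC0 : 0 ≤ C := by
    have := (norm_nonneg _).trans (hC 0 (by simp) (by simpa using hh))
    simpa using this
  have t1 := intervalIntegral_tendsto_integral h0 tendsto_neg_atTop_atBot tendsto_id
  have t2 := intervalIntegral_tendsto_integral (hint h hh le_rfl) tendsto_neg_atTop_atBot tendsto_id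
  have t3 : Tendsto (fun R : ℝ => (∫ x in (-R)..R, f x) -
      ∫ x in (-R)..R, f (x + h * Complex.I)) atTop (𝓝 0) := by
    refine squeeze_zero_norm' (a := fun R : ℝ => 2 * (C * Real.exp (-ε * R) * h)) ?_ ?_
    · filter_upwards [eventually_ge_atTop 0] with R hR
      have key := Complex.integral_boundary_rect_eq_zero_of_differentiableOn f ((-R : ℝ) : ℂ)
        (R + h * Complex.I) (fun z hz => by
          have hz2 := hz.2
          simp [uIcc_of_le hh] at hz2
          exact (hf z hz2.1 hz2.2).differentiableWithinAt)
      simp only [Complex.ofReal_re, Complex.ofReal_im, Complex.add_re, Complex.mul_re, Complex.I_re,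
        Complex.I_im, Complex.add_im, Complex.mul_im, mul_zero, mul_one, zero_mul, sub_zero,
        zero_add, add_zero, Complex.ofReal_zero] at key
      have bd : ∀ x : ℝ, |x| = R → ‖∫ y in (0 : ℝ)..h, f (x + y * Complex.I)‖ ≤
          C * Real.exp (-ε * R) * h := by
        intro x hx
        refine (intervalIntegral.norm_integral_le_of_norm_le_const (C := C * Real.exp (-ε * R))
          fun y hy => ?_).trans (by rw [sub_zero, abs_of_nonneg hh])
        rw [uIoc_of_le hh] at hy
        simpa [hx] using hC (x + y * Complex.I) (by simpa using hy.1.le) (by simpa using hy.2)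
      have b1 := bd R (abs_of_nonneg hR)
      have b2 := bd (-R) (by rw [abs_neg, abs_of_nonneg hR])
      have e : (∫ x in (-R)..R, f x) - ∫ x in (-R)..R, f (x + h * Complex.I) =
          Complex.I * (∫ y in (0 : ℝ)..h, f ((-R : ℝ) + y * Complex.I)) -
          Complex.I * ∫ y in (0 : ℝ)..h, f (R + y * Complex.I) := by
        simp only [smul_eq_mul] at key
        linear_combination key
      rw [e]
      refine (norm_sub_le _ _).trans ?_
      rw [norm_mul, norm_mul, Complex.norm_I, one_mul, one_mul]
      linarith
    · have : Tendsto (fun R : ℝ => Real.exp (-ε * R)) atTop (𝓝 0) :=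
        Real.tendsto_exp_atBot.comp ((tendsto_const_mul_atBot_of_neg (by linarith)).mpr tendsto_id)
      simpa using ((this.const_mul C).mul_const h).const_mul 2
  exact sub_eq_zero.mp (tendsto_nhds_unique (t1.sub t2) t3)

section Slices

universe u

variable {ι : Type u} [Fintype ι] [DecidableEq ι]

/-- Integration over one coordinate first. -/
theorem exists_integral_eq (p : ι) : ∃ (X : Type u) (_ : MeasureSpace X) (y : X → ι → ℝ),
    ∀ F : (ι → ℝ) → ℂ, Integrable F →
      ∫ x, F x = ∫ b : X, ∫ t : ℝ, F (y b + Pi.single p t) := by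
  let e := MeasurableEquiv.piEquivPiSubtypeProd (fun _ : ι => ℝ) (fun i => i = p)
  have he : MeasurePreserving e volume volume := by
    convert volume_preserving_piEquivPiSubtypeProd (fun _ : ι => ℝ) (fun i => i = p) <;> rfl
  refine ⟨({i // ¬ i = p} → ℝ), inferInstance, fun b i => if h : i = p then 0 else b ⟨i, h⟩,
    fun F hF => ?_⟩
  have hF' : Integrable (fun q => F (e.symm q)) := he.symm.integrable_comp_of_integrable hF
  rw [← he.symm.integral_comp', Measure.volume_eq_prod, integral_prod_symm _ hF']
  refine integral_congr_ae (Eventually.of_forall fun b => ?_)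
  have hu : MeasurePreserving (MeasurableEquiv.funUnique {i // i = p} ℝ) volume volume := by
    convert volume_preserving_funUnique {i // i = p} ℝ
  beta_reduce
  rw [← hu.symm.integral_comp']
  refine integral_congr_ae (Eventually.of_forall fun t => ?_)
  simp only
  congr 1
  funext i
  by_cases hi : i = p
  · subst hi
    simp [e, MeasurableEquiv.piEquivPiSubtypeProd, Equiv.piEquivPiSubtypeProd,
      MeasurableEquiv.funUnique]
  · simp [e, hi, MeasurableEquiv.piEquivPiSubtypeProd, Equiv.piEquivPiSubtypeProd]

/-- A real vector, as a complex one. -/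
def ofRealVec (x : ι → ℝ) : ι → ℂ := fun i => x i

theorem absSum_add_single_ge (y : ι → ℝ) (p : ι) (t : ℝ) :
    |t| - |y p| ≤ absSum (y + Pi.single p t) := by
  refine le_trans ?_ (abs_le_absSum _ p)
  rw [Pi.add_apply, Pi.single_eq_same]
  have := abs_sub_abs_le_abs_sub t (-y p)
  rw [abs_neg, sub_neg_eq_add, add_comm] at this
  exact this

/-- The shift of the contour of integration of one variable. -/
theorem integral_eq_integral_add_single {Φ : (ι → ℂ) → ℂ} {p : ι} {h C ε : ℝ} (hh : 0 ≤ h)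
    (hε : 0 < ε)
    (hd : ∀ (x : ι → ℝ) (s : ℝ), 0 ≤ s → s ≤ h →
      DifferentiableAt ℂ Φ (ofRealVec x + Pi.single p (s * Complex.I)))
    (hC : ∀ (x : ι → ℝ) (s : ℝ), 0 ≤ s → s ≤ h →
      ‖Φ (ofRealVec x + Pi.single p (s * Complex.I))‖ ≤ C * Real.exp (-ε * absSum x)) :
    Integrable (fun x : ι → ℝ => Φ (ofRealVec x)) ∧
    Integrable (fun x : ι → ℝ => Φ (ofRealVec x + Pi.single p (h * Complex.I))) ∧
    ∫ x : ι → ℝ, Φ (ofRealVec x) = ∫ x : ι → ℝ, Φ (ofRealVec x + Pi.single p (h * Complex.I)) := by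
  have hcv : Continuous (ofRealVec : (ι → ℝ) → ι → ℂ) := by unfold ofRealVec; fun_prop
  have hint : ∀ s, 0 ≤ s → s ≤ h →
      Integrable (fun x : ι → ℝ => Φ (ofRealVec x + Pi.single p (s * Complex.I))) := by
    intro s h0 h1
    refine integrable_of_norm_le (Continuous.aestronglyMeasurable
      (continuous_iff_continuousAt.mpr fun x => ?_)) hε fun x => hC x s h0 h1
    exact ContinuousAt.comp (f := fun x : ι → ℝ => ofRealVec x + Pi.single p (s * Complex.I))
      (hd x s h0 h1).continuousAt (by fun_prop)
  have i0 : Integrable (fun x : ι → ℝ => Φ (ofRealVec x)) := by simpa using hint 0 le_rfl hh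
  refine ⟨i0, hint h hh le_rfl, ?_⟩
  obtain ⟨X, _, y, hX⟩ := exists_integral_eq p
  rw [hX _ i0, hX _ (hint h hh le_rfl)]
  refine integral_congr_ae (Eventually.of_forall fun b => ?_)
  have e1 : ∀ (t s : ℝ), ofRealVec (y b + Pi.single p t) + Pi.single p (s * Complex.I) =
      ofRealVec (y b) + Pi.single p (t + s * Complex.I) := by
    intro t s
    funext i
    by_cases hi : i = p
    · subst hi; simp [ofRealVec, add_assoc]
    · simp [ofRealVec, hi]
  have e2 : ∀ z : ℂ, ofRealVec (y b) + Pi.single p z =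
      ofRealVec (y b + Pi.single p z.re) + Pi.single p (z.im * Complex.I) := by
    intro z; rw [e1, Complex.re_add_im]
  -- Nothing is known about the coordinate p of the base point y b, so its effect on the decay in t
  -- is moved into the constant.
  have key := integral_eq_integral_add_mul_I (f := fun z => Φ (ofRealVec (y b) + Pi.single p z))
    (C := |C| * Real.exp (ε * |y b p|)) hh hε
    (fun z h0 h1 => by
      have h2 := hd (y b + Pi.single p z.re) z.im h0 h1
      rw [← e2] at h2
      refine DifferentiableAt.comp (f := fun z => ofRealVec (y b) + Pi.single p z) z h2 ?_
      refine DifferentiableAt.const_add _ ?_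
      rw [differentiableAt_pi]
      intro i
      by_cases hi : i = p
      · subst hi; simp
      · simp [hi])
    (fun z h0 h1 => by
      have h2 := hC (y b + Pi.single p z.re) z.im h0 h1
      rw [← e2] at h2
      refine h2.trans ?_
      rw [mul_assoc, ← Real.exp_add]
      refine mul_le_mul (le_abs_self C) (Real.exp_le_exp.mpr ?_) (Real.exp_nonneg _) (abs_nonneg _)
      have := mul_le_mul_of_nonneg_left (absSum_add_single_ge (y b) p z.re) hε.le
      linarith)
  simp only [e1]
  have e3 : ∀ t : ℝ, ofRealVec (y b + Pi.single p t) = ofRealVec (y b) + Pi.single p (t : ℂ) := by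
    intro t
    simpa using e1 t 0
  simp only [e3]
  exact key

end Slices

end

section

open MeasureTheory Set Filter Topology

/-! ### Completeness of the polynomials -/

section Completeness

theorem continuous_ofRealVec {ι : Type*} : Continuous (ofRealVec : (ι → ℝ) → ι → ℂ) := by
  unfold ofRealVec; fun_prop

theorem continuous_eval_ofRealVec {ι : Type*} (q : MvPolynomial ι ℂ) :
    Continuous fun x : ι → ℝ => MvPolynomial.eval (ofRealVec x) q :=
  q.continuous_eval.comp continuous_ofRealVec

variable {ι : Type*} [Fintype ι]

theorem expBound_ofRealVec (q : MvPolynomial ι ℂ) :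
    ExpBound absSum (fun x : ι → ℝ => MvPolynomial.eval (ofRealVec x) q) (fun _ => 0) :=
  ExpBound.eval absSum_nonneg (fun i => ExpBound.of_norm_le_linear (c := 0) (d := 1)
    absSum_nonneg fun x => by
      rw [ofRealVec, Complex.norm_real, Real.norm_eq_abs, zero_add, one_mul]
      exact abs_le_absSum x i) q

/-- The character `exp (i ∑ v_j x_j)`. -/
def waveFun (v x : ι → ℝ) : ℂ := Complex.exp ((∑ i, v i * x i : ℝ) * Complex.I)

theorem norm_waveFun (v x : ι → ℝ) : ‖waveFun v x‖ = 1 := Complex.norm_exp_ofReal_mul_I _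

theorem continuous_waveFun (v : ι → ℝ) : Continuous (waveFun v) := by
  unfold waveFun; fun_prop

variable {G : (ι → ℝ) → ℂ} {C ε : ℝ}

/-- Expand the additional character into its power series and integrate termwise: every term is a
moment against a polynomial. The bound on d keeps the absolute series below the decay of G. -/
theorem integral_waveFun_step (hG : Continuous G) (hε : 0 < ε)
    (hC : ∀ x, ‖G x‖ ≤ C * Real.exp (-ε * absSum x)) {v d : ι → ℝ} (hd : ∀ i, |d i| ≤ ε / 4)
    (h : ∀ q : MvPolynomial ι ℂ, ∫ x, G x * waveFun v x * MvPolynomial.eval (ofRealVec x) q = 0)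
    (q : MvPolynomial ι ℂ) :
    ∫ x, G x * waveFun (v + d) x * MvPolynomial.eval (ofRealVec x) q = 0 := by
  obtain ⟨D, hD, hq⟩ := expBound_ofRealVec q (ε / 2) (half_pos hε)
  let L : MvPolynomial ι ℂ := ∑ i, MvPolynomial.C ((d i : ℂ) * Complex.I) * MvPolynomial.X i
  have hL : ∀ x, MvPolynomial.eval (ofRealVec x) L = (∑ i, d i * x i : ℝ) * Complex.I := by
    intro x
    simp only [L, map_sum, map_mul, MvPolynomial.eval_C, MvPolynomial.eval_X, ofRealVec]
    push_cast
    rw [Finset.sum_mul]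
    exact Finset.sum_congr rfl fun i _ => by ring
  have hLn : ∀ x, ‖MvPolynomial.eval (ofRealVec x) L‖ ≤ ε / 4 * absSum x := by
    intro x
    rw [hL, norm_mul, Complex.norm_I, mul_one, Complex.norm_real, Real.norm_eq_abs, absSum,
      Finset.mul_sum]
    refine (Finset.abs_sum_le_sum_abs _ _).trans (Finset.sum_le_sum fun i _ => ?_)
    rw [abs_mul]
    exact mul_le_mul_of_nonneg_right (hd i) (abs_nonneg _)
  let F : ℕ → (ι → ℝ) → ℂ := fun k x => G x * waveFun v x *
    MvPolynomial.eval (ofRealVec x) (q * (MvPolynomial.C ((k.factorial : ℂ)⁻¹) * L ^ k))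
  -- Of the decay ε, the polynomial q uses ε/2 and the exponential series ε/4; the remaining ε/4
  -- makes the dominating function integrable.
  let bound : ℕ → (ι → ℝ) → ℝ := fun k x => |C| * D * Real.exp (-(ε / 2) * absSum x) *
    ((ε / 4 * absSum x) ^ k / k.factorial)
  have hsum : ∀ y : ℝ, HasSum (fun k : ℕ => y ^ k / k.factorial) (Real.exp y) := fun y => by
    rw [Real.exp_eq_exp_ℝ]; exact NormedSpace.expSeries_div_hasSum_exp y
  have hsumC : ∀ y : ℂ, HasSum (fun k : ℕ => y ^ k / k.factorial) (Complex.exp y) := fun y => by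
    rw [Complex.exp_eq_exp_ℂ]; exact NormedSpace.expSeries_div_hasSum_exp y
  have hb : ∀ x, HasSum (fun k => bound k x) (|C| * D * Real.exp (-(ε / 4) * absSum x)) := by
    intro x
    have h1 := (hsum (ε / 4 * absSum x)).mul_left (|C| * D * Real.exp (-(ε / 2) * absSum x))
    rw [mul_assoc _ (Real.exp _), ← Real.exp_add] at h1
    rw [show -(ε / 4) * absSum x = -(ε / 2) * absSum x + ε / 4 * absSum x by ring]
    exact h1
  have key := hasSum_integral_of_dominated_convergence (μ := volume) (F := F)
    (f := fun x => G x * waveFun (v + d) x * MvPolynomial.eval (ofRealVec x) q) bound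
    (fun k => ((hG.mul (continuous_waveFun v)).mul
      (continuous_eval_ofRealVec _)).aestronglyMeasurable)
    (fun k => Eventually.of_forall fun x => by
      simp only [F, bound, map_mul, map_pow, MvPolynomial.eval_C, norm_mul, norm_waveFun, mul_one,
        norm_pow, norm_inv, Complex.norm_natCast]
      have h1 : ‖G x‖ * ‖MvPolynomial.eval (ofRealVec x) q‖ ≤
          |C| * D * Real.exp (-(ε / 2) * absSum x) := by
        have h2 := mul_le_mul ((hC x).trans (mul_le_mul_of_nonneg_right (le_abs_self C)
          (Real.exp_nonneg _))) (hq x) (norm_nonneg _) (by positivity)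
        rw [mul_mul_mul_comm, ← Real.exp_add] at h2
        refine h2.trans (le_of_eq ?_)
        congr 2
        ring
      have h3 := pow_le_pow_left₀ (norm_nonneg _) (hLn x) k
      rw [← mul_assoc, inv_mul_eq_div]
      exact mul_le_mul h1 (div_le_div_of_nonneg_right h3 (by positivity)) (by positivity)
        (by positivity))
    (Eventually.of_forall fun x => (hb x).summable)
    (by
      simp only [(hb _).tsum_eq]
      exact (integrable_exp_neg_absSum (by linarith)).const_mul _)
    (Eventually.of_forall fun x => by
      have h1 := (hsumC (MvPolynomial.eval (ofRealVec x) L)).mul_left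
        (G x * waveFun v x * MvPolynomial.eval (ofRealVec x) q)
      have h2 : waveFun (v + d) x = waveFun v x * Complex.exp (MvPolynomial.eval (ofRealVec x) L) := by
        rw [hL, waveFun, waveFun, ← Complex.exp_add, ← add_mul, ← Complex.ofReal_add,
          ← Finset.sum_add_distrib]
        simp only [Pi.add_apply, add_mul]
      have e1 : ∀ k, F k x = G x * waveFun v x * MvPolynomial.eval (ofRealVec x) q *
          (MvPolynomial.eval (ofRealVec x) L ^ k / k.factorial) := fun k => by
        simp only [F, map_mul, map_pow, MvPolynomial.eval_C]
        ring
      have e2 : G x * waveFun (v + d) x * MvPolynomial.eval (ofRealVec x) q =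
          G x * waveFun v x * MvPolynomial.eval (ofRealVec x) q *
            Complex.exp (MvPolynomial.eval (ofRealVec x) L) := by
        rw [h2]
        ring
      simp only [e1, e2]
      exact h1)
  simp only [F, h] at key
  exact key.unique hasSum_zero

/-- A continuous function of exponential decay is zero if it is orthogonal to all polynomials. -/
theorem eq_zero_of_integral_eval (hG : Continuous G) (hε : 0 < ε)
    (hC : ∀ x, ‖G x‖ ≤ C * Real.exp (-ε * absSum x))
    (h : ∀ q : MvPolynomial ι ℂ, ∫ x, G x * MvPolynomial.eval (ofRealVec x) q = 0) (x : ι → ℝ) :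
    G x = 0 := by
  have hw : ∀ v, ∫ x, G x * waveFun v x = 0 := by
    intro v
    -- An arbitrary frequency v is reached from 0 in n steps of size at most ε/4 in each coordinate.
    obtain ⟨n, hn⟩ := exists_nat_gt (absSum v / (ε / 4))
    have hn0 : (0 : ℝ) < n := lt_of_le_of_lt (div_nonneg (absSum_nonneg v) (by linarith)) hn
    have hd : ∀ i, |((n : ℝ)⁻¹ • v) i| ≤ ε / 4 := by
      intro i
      rw [Pi.smul_apply, smul_eq_mul, abs_mul, abs_of_pos (inv_pos.mpr hn0), inv_mul_le_iff₀ hn0]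
      rw [div_lt_iff₀ (by linarith)] at hn
      linarith [abs_le_absSum v i]
    have ind : ∀ (k : ℕ) (q : MvPolynomial ι ℂ),
        ∫ x, G x * waveFun ((k : ℝ) • (n : ℝ)⁻¹ • v) x * MvPolynomial.eval (ofRealVec x) q = 0 := by
      intro k
      induction k with
      | zero =>
        intro q
        simpa [waveFun] using h q
      | succ k ih =>
        intro q
        have := integral_waveFun_step hG hε hC hd ih q
        rwa [Nat.cast_succ, add_smul, one_smul]
    have := ind n 1
    simpa [smul_smul, mul_inv_cancel₀ hn0.ne'] using this
  have hint : Integrable G := integrable_of_norm_le hG.aestronglyMeasurable hε hC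
  have hvol := PiLp.volume_preserving_ofLp ι
  let g : EuclideanSpace ℝ ι → ℂ := fun y => G (WithLp.ofLp y)
  have hg : Continuous g := hG.comp (PiLp.continuous_ofLp 2 _)
  have hgi : Integrable g := hvol.integrable_comp_of_integrable hint
  have hF : FourierTransform.fourier g = 0 := by
    funext w
    rw [Real.fourier_eq', Pi.zero_apply]
    have h1 := hvol.integral_comp (MeasurableEquiv.toLp 2 (ι → ℝ)).symm.measurableEmbedding
      fun x : ι → ℝ => G x * waveFun (-(2 * Real.pi) • WithLp.ofLp w) x
    rw [hw] at h1
    rw [← h1]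
    refine integral_congr_ae (Eventually.of_forall fun y => ?_)
    simp only [g, waveFun, smul_eq_mul, PiLp.inner_apply, Pi.smul_apply, RCLike.inner_apply,
      conj_trivial]
    rw [mul_comm, Finset.mul_sum]
    congr 5
    funext i
    ring
  have h2 := hg.fourierInv_fourier_eq hgi (by rw [hF]; exact integrable_zero _ _ _)
  rw [hF] at h2
  have h3 := congrFun h2 (WithLp.toLp 2 x)
  rw [Real.fourierInv_eq'] at h3
  simpa [g] using h3.symm

end Completeness

end

/-! ### Values, symmetry and decay of the integrand. -/

section

open Finset

/-! ### The Whittaker function -/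

section Values

variable {N : ℕ} (γN : Fin N → ℂ) (ħ : ℝ)

/-- The indicator of the position `(n, j)`. -/
def position (n j n' j' : ℕ) : ℂ := if n' = n ∧ j' = j then 1 else 0

theorem entryVal_add_single {n : ℕ} (h : n < N) (j : Fin n) (c : ℂ) (z : Label N → ℂ) (n' : ℕ)
    (i : Fin n') : entryVal γN (z + Pi.single ⟨⟨n, h⟩, j⟩ c) n' i =
      entryVal γN z n' i + c * position n j n' i := by
  have e : entryVal γN (z + Pi.single ⟨⟨n, h⟩, j⟩ c) n' i =
      (translateHom ⟨⟨n, h⟩, j⟩ c (entry γN n' i)).1 z := rfl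
  rw [e, position]
  by_cases hn : n' = n
  · subst hn
    by_cases hi : i = j
    · subst hi
      rw [translateHom_entry_self, if_pos ⟨rfl, rfl⟩, mul_one]
      rfl
    · rw [translateHom_entry_of_ne γN h j i hi, if_neg (fun h => hi (Fin.ext h.2)), mul_zero,
        add_zero]
      rfl
  · rw [translateHom_entry_of_level_ne γN h j c hn, if_neg (fun h => hn h.1), mul_zero, add_zero]
    rfl

/-- The value of an argument of the Gamma function. -/
def argVal (n : ℕ) (k : Fin n) (m : Fin (n + 1)) (z : Label N → ℂ) : ℂ :=
  (gammaArg ħ γN n k m).1 z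

theorem argVal_eq (n : ℕ) (k : Fin n) (m : Fin (n + 1)) (z : Label N → ℂ) :
    argVal γN ħ n k m z =
      -Complex.I * (ħ : ℂ)⁻¹ * (entryVal γN z n k - entryVal γN z (n + 1) m) + 1 / 2 :=
  gammaArg_apply γN ħ n k m z

theorem argVal_add_single (hħ : ħ ≠ 0) {n : ℕ} (h : n + 1 < N) (j : Fin (n + 1)) (t : ℂ)
    (z : Label N → ℂ) (n' : ℕ) (k : Fin n') (m : Fin (n' + 1)) :
    argVal γN ħ n' k m (z + Pi.single ⟨⟨n + 1, h⟩, j⟩ (Complex.I * ħ * t)) =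
      argVal γN ħ n' k m z + t * position (n + 1) j n' k - t * position n j n' m := by
  have h0 : (ħ : ℂ) * (ħ : ℂ)⁻¹ = 1 := mul_inv_cancel₀ (by exact_mod_cast hħ)
  have hp : position (n + 1) j (n' + 1) m = position n j n' m := by
    simp only [position, Nat.add_right_cancel_iff]
  rw [argVal_eq, argVal_eq, entryVal_add_single, entryVal_add_single, hp]
  linear_combination (t * position n j n' m - t * position (n + 1) j n' k) *
    (Complex.I ^ 2 * h0 + Complex.I_sq)

/-- The function `ħ ^ u Γ(u)`. -/
def gFun (u : ℂ) : ℂ := Complex.exp (Real.log ħ * u) * Complex.Gamma u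

theorem gFun_add_one (hħ : 0 < ħ) {u : ℂ} (hu : u ≠ 0) : gFun ħ (u + 1) = ħ * u * gFun ħ u := by
  rw [gFun, gFun, Complex.Gamma_add_one u hu, mul_add, mul_one, Complex.exp_add,
    ← Complex.ofReal_exp, Real.exp_log hħ]
  ring

theorem gFun_ne_zero {u : ℂ} (hu : 0 < u.re) : gFun ħ u ≠ 0 :=
  mul_ne_zero (Complex.exp_ne_zero _) (Complex.Gamma_ne_zero_of_re_pos hu)

/-- The product of the Gamma functions with given arguments. -/
def gammaProd (N : ℕ) (ζ : (n : ℕ) → Fin n → Fin (n + 1) → ℂ) : ℂ :=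
  ∏ n ∈ Ico 1 N, ∏ k, ∏ m, gFun ħ (ζ n k m)

/-- The value of the exponent of the Whittaker vector. -/
def expVal (z : Label N → ℂ) : ℂ := (whittakerExponent γN ħ).1 z

/-- The Whittaker function, the value of the Whittaker vector. -/
def whittakerFun (z : Label N → ℂ) : ℂ :=
  Complex.exp (expVal γN ħ z) * gammaProd ħ N fun n k m => argVal γN ħ n k m z

/-- The Whittaker function with the arguments `u` of the Gamma functions joining the variable
`(n + 1, j)` to the level `n` replaced by `u + 1`. -/
def raisedFun (n : ℕ) (j : Fin (n + 1)) (z : Label N → ℂ) : ℂ :=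
  Complex.exp (expVal γN ħ z) *
    gammaProd ħ N fun n' k m => argVal γN ħ n' k m z + position n j n' m

theorem expVal_add_single {n : ℕ} (h : n + 1 < N) (j : Fin (n + 1)) (c : ℂ) (z : Label N → ℂ) :
    expVal γN ħ (z + Pi.single ⟨⟨n + 1, h⟩, j⟩ c) =
      expVal γN ħ z + -(Real.pi / ħ) * n * c := by
  have e : expVal γN ħ (z + Pi.single ⟨⟨n + 1, h⟩, j⟩ c) =
      (translateHom ⟨⟨n + 1, h⟩, j⟩ c (whittakerExponent γN ħ)).1 z := rfl
  rw [e, translateHom_whittakerExponent]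
  rfl

theorem value_polyM (f : MvPolynomial (Label N) ℂ) (z : Label N → ℂ) :
    value (polyM f) z = MvPolynomial.eval z f := by
  have h := value_eq (polyE f) 1 z one_ne_zero
  rw [← polyE_apply, ← div_one ((polyE f).1 z)]
  have h1 : toMero (1 : Entire N) = 1 := map_one _
  rw [h1, div_one] at h
  exact h

/-- `1 / Γ`, composed with an argument. -/
def rgammaArg (n : ℕ) (k : Fin n) (m : Fin (n + 1)) : Entire N :=
  Entire.comp (fun s => (Complex.Gamma s)⁻¹) Complex.differentiable_one_div_Gamma
    (gammaArg ħ γN n k m)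

/-- The exponential factor belonging to an argument. -/
def expArg (n : ℕ) (k : Fin n) (m : Fin (n + 1)) : Entire N :=
  Entire.comp Complex.exp Complex.differentiable_exp ((Real.log ħ : ℂ) • gammaArg ħ γN n k m)

theorem whittakerVector_eq_div : whittakerVector ħ γN =
    toMero (Entire.comp Complex.exp Complex.differentiable_exp (whittakerExponent γN ħ) *
      ∏ n ∈ Ico 1 N, ∏ k, ∏ m, expArg γN ħ n k m) /
    toMero (∏ n ∈ Ico 1 N, ∏ k, ∏ m, rgammaArg γN ħ n k m) := by
  let φ : Entire N →ₐ[ℂ] Mero N := IsScalarTower.toAlgHom ℂ (Entire N) (Mero N)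
  have hφ : ∀ u, toMero u = φ u := fun _ => rfl
  have h1 : ∀ n, sFactor ħ γN n =
      φ (∏ k, ∏ m, expArg γN ħ n k m) * (φ (∏ k, ∏ m, rgammaArg γN ħ n k m))⁻¹ := by
    intro n
    simp only [map_prod, ← prod_inv_distrib, ← prod_mul_distrib]
    rfl
  rw [hφ, hφ, map_mul, div_eq_mul_inv, map_prod, map_prod, mul_assoc, ← prod_inv_distrib,
    ← prod_mul_distrib, ← prod_congr rfl fun n _ => h1 n]
  rfl

theorem value_polyM_mul_whittakerVector (f : MvPolynomial (Label N) ℂ) {z : Label N → ℂ}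
    (hz : ∀ n k m, 0 < (argVal γN ħ n k m z).re) :
    value (polyM f * whittakerVector ħ γN) z =
      MvPolynomial.eval z f * whittakerFun γN ħ z := by
  rw [whittakerVector_eq_div, polyM_apply, mul_div_assoc', ← toMero_mul, value_eq]
  · have e1 : ∀ n (k : Fin n) m, (rgammaArg γN ħ n k m).1 z =
      (Complex.Gamma (argVal γN ħ n k m z))⁻¹ := fun _ _ _ => rfl
    have e2 : ∀ n (k : Fin n) m, (expArg γN ħ n k m).1 z =
      Complex.exp (Real.log ħ * argVal γN ħ n k m z) := fun _ _ _ => rfl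
    simp only [← evalHom_apply, map_mul, map_prod]
    simp only [evalHom_apply, polyE_apply, e1, e2, prod_inv_distrib, div_inv_eq_mul]
    rw [whittakerFun, gammaProd, mul_assoc, mul_assoc]
    congr 2
    simp only [gFun, prod_mul_distrib]
  · rw [← evalHom_apply]
    simp only [map_prod]
    refine prod_ne_zero_iff.mpr fun n _ => prod_ne_zero_iff.mpr fun k _ =>
      prod_ne_zero_iff.mpr fun m _ => ?_
    exact inv_ne_zero (Complex.Gamma_ne_zero_of_re_pos (hz n k m))

theorem prod_position {n : ℕ} (h : n < N) (j : Fin (n + 1))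
    (f : (n' : ℕ) → Fin n' → Fin (n' + 1) → ℂ) :
    ∏ n' ∈ Ico 1 N, ∏ k, ∏ m : Fin (n' + 1), (if n' = n ∧ (m : ℕ) = j then f n' k m else 1) = ∏ k, f n k j := by
  have h1 : ∏ k, ∏ m : Fin (n + 1), (if n = n ∧ (m : ℕ) = j then f n k m else 1) = ∏ k, f n k j := by
    refine prod_congr rfl fun k _ => ?_
    rw [prod_eq_single j (fun m _ hm => if_neg fun h => hm (Fin.ext h.2)) (by simp)]
    exact if_pos ⟨rfl, rfl⟩
  rcases Nat.eq_zero_or_pos n with rfl | hn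
  · rw [univ_eq_empty, prod_empty]
    refine prod_eq_one fun n' hn' => prod_eq_one fun k _ => prod_eq_one fun m _ => ?_
    rw [mem_Ico] at hn'
    exact if_neg (by omega)
  · rw [prod_eq_single n (fun n' _ hn' => ?_) (fun hn' => absurd (mem_Ico.mpr ⟨hn, h⟩) hn'), h1]
    exact prod_eq_one fun k _ => prod_eq_one fun m _ => if_neg fun h => hn' h.1

theorem prod_position_succ {n : ℕ} (h : n < N) (j : Fin n)
    (f : (n' : ℕ) → Fin n' → Fin (n' + 1) → ℂ) :
    ∏ n' ∈ Ico 1 N, ∏ k : Fin n', ∏ m, (if n' = n ∧ (k : ℕ) = j then f n' k m else 1) = ∏ m, f n j m := by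
  have hn : 1 ≤ n := (Nat.zero_le _).trans_lt j.2
  rw [prod_eq_single n (fun n' _ hn' => ?_) (fun hn' => absurd (mem_Ico.mpr ⟨hn, h⟩) hn')]
  · rw [prod_eq_single j (fun k _ hk => prod_eq_one fun m _ => if_neg fun h => hk (Fin.ext h.2))
      (by simp)]
    exact prod_congr rfl fun m _ => if_pos ⟨rfl, rfl⟩
  · exact prod_eq_one fun k _ => prod_eq_one fun m _ => if_neg fun h => hn' h.1

/-- Together with `numA_mul_whittakerFun` this expresses the numerators of both operators through
the single function `raisedFun`, here at z and there at the point shifted by iħ. A contour shift can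
then identify the integrals. -/
theorem numB_mul_whittakerFun (hħ : 0 < ħ) {n : ℕ} (h : n + 1 < N) (j : Fin (n + 1))
    {z : Label N → ℂ} (hz : ∀ n k m, 0 < (argVal γN ħ n k m z).re) :
    numB γN (-(Complex.I * ħ)) n j z * whittakerFun γN ħ z =
      Complex.I⁻¹ ^ n * raisedFun γN ħ n j z := by
  have h1 : numB γN (-(Complex.I * ħ)) n j z =
      ∏ k : Fin n, (Complex.I⁻¹ * (ħ * argVal γN ħ n k j z)) :=
    prod_congr rfl fun k _ =>
      congrArg (fun f : Entire N => f.1 z) (gammaArg_prev_neg γN ħ hħ.ne' n k j)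
  have h2 : raisedFun γN ħ n j z =
      (∏ k : Fin n, (ħ * argVal γN ħ n k j z)) * whittakerFun γN ħ z := by
    rw [← prod_position (N := N) (by omega) j (fun n' k m => ħ * argVal γN ħ n' k m z),
      whittakerFun, raisedFun, gammaProd, gammaProd, mul_left_comm]
    congr 1
    simp only [← prod_mul_distrib]
    refine prod_congr rfl fun n' _ => prod_congr rfl fun k _ => prod_congr rfl fun m _ => ?_
    rw [position]
    split_ifs with hm
    · rw [gFun_add_one ħ hħ]
      intro h0
      have := hz n' k m
      rw [h0] at this
      exact lt_irrefl _ this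
    · rw [add_zero, one_mul]
  rw [h1, h2, prod_mul_distrib, prod_const, card_univ, Fintype.card_fin, mul_assoc]

theorem numA_mul_whittakerFun (hħ : 0 < ħ) {n : ℕ} (h : n + 1 < N) (j : Fin (n + 1))
    {z : Label N → ℂ} (hz : ∀ n k m, 0 < (argVal γN ħ n k m z).re) :
    numA γN (Complex.I * ħ) (n + 1) j z * whittakerFun γN ħ z =
      Complex.I ^ (n + 2) * Complex.exp (Real.pi / ħ * n * (Complex.I * ħ)) *
        raisedFun γN ħ n j (z + Pi.single ⟨⟨n + 1, h⟩, j⟩ (Complex.I * ħ)) := by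
  have h1 : numA γN (Complex.I * ħ) (n + 1) j z =
      ∏ m : Fin (n + 2), (Complex.I * (ħ * argVal γN ħ (n + 1) j m z)) :=
    prod_congr rfl fun m _ =>
      congrArg (fun f : Entire N => f.1 z) (gammaArg_next_pos γN ħ hħ.ne' (n + 1) j m)
  have h2 : Complex.exp (Real.pi / ħ * n * (Complex.I * ħ)) *
      raisedFun γN ħ n j (z + Pi.single ⟨⟨n + 1, h⟩, j⟩ (Complex.I * ħ)) =
      (∏ m : Fin (n + 2), (ħ * argVal γN ħ (n + 1) j m z)) * whittakerFun γN ħ z := by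
    rw [← prod_position_succ (N := N) h j (fun n' k m => ħ * argVal γN ħ n' k m z),
      whittakerFun, raisedFun, gammaProd, gammaProd, expVal_add_single, ← mul_assoc,
      ← Complex.exp_add]
    have e : (Real.pi : ℂ) / ħ * n * (Complex.I * ħ) +
        (expVal γN ħ z + -(Real.pi / ħ) * n * (Complex.I * ħ)) = expVal γN ħ z := by
      ring
    rw [e, mul_left_comm]
    congr 1
    simp only [← prod_mul_distrib]
    refine prod_congr rfl fun n' _ => prod_congr rfl fun k _ => prod_congr rfl fun m _ => ?_
    have e2 := argVal_add_single γN ħ hħ.ne' h j 1 z n' k m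
    rw [mul_one, one_mul, one_mul] at e2
    rw [e2, sub_add_cancel, position]
    split_ifs with hm
    · rw [gFun_add_one ħ hħ]
      intro h0
      have := hz n' k m
      rw [h0] at this
      exact lt_irrefl _ this
    · rw [add_zero, one_mul]
  rw [mul_assoc, h2, h1, prod_mul_distrib, prod_const, card_univ, Fintype.card_fin, mul_assoc]

theorem differentiableAt_argVal (n : ℕ) (k : Fin n) (m : Fin (n + 1)) (z : Label N → ℂ) :
    DifferentiableAt ℂ (argVal γN ħ n k m) z :=
  ((gammaArg ħ γN n k m).2 z (Set.mem_univ z)).differentiableAt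

theorem differentiableAt_gFun {u : ℂ} (hu : 0 < u.re) : DifferentiableAt ℂ (gFun ħ) u := by
  unfold gFun
  refine DifferentiableAt.mul (by fun_prop) (Complex.differentiableAt_Gamma u fun m h => ?_)
  rw [h] at hu
  simp at hu
  have : (0 : ℝ) ≤ m := m.cast_nonneg
  linarith

theorem differentiableAt_prod {E κ : Type*} [NormedAddCommGroup E] [NormedSpace ℂ E]
    (s : Finset κ) {f : κ → E → ℂ} {z : E} (h : ∀ i ∈ s, DifferentiableAt ℂ (f i) z) :
    DifferentiableAt ℂ (fun z => ∏ i ∈ s, f i z) z := by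
  classical
  exact (HasFDerivAt.finsetProd fun i hi => (h i hi).hasFDerivAt).differentiableAt

theorem differentiableAt_gammaProd {ζ : (Label N → ℂ) → (n : ℕ) → Fin n → Fin (n + 1) → ℂ}
    {z : Label N → ℂ} (h : ∀ n k m, DifferentiableAt ℂ (fun z => gFun ħ (ζ z n k m)) z) :
    DifferentiableAt ℂ (fun z => gammaProd ħ N (ζ z)) z := by
  unfold gammaProd
  exact differentiableAt_prod _ fun n _ => differentiableAt_prod _ fun k _ =>
    differentiableAt_prod _ fun m _ => h n k m

theorem differentiableAt_raisedFun (n : ℕ) (j : Fin (n + 1)) {z : Label N → ℂ}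
    (hz : ∀ n' k m, 0 < (argVal γN ħ n' k m z + position n j n' m).re) :
    DifferentiableAt ℂ (raisedFun γN ħ n j) z := by
  have h1 : DifferentiableAt ℂ (fun z => Complex.exp (expVal γN ħ z)) z :=
    ((whittakerExponent γN ħ).2 z (Set.mem_univ z)).differentiableAt.cexp
  refine h1.mul (differentiableAt_gammaProd ħ fun n' k m => ?_)
  exact DifferentiableAt.comp (f := fun z => argVal γN ħ n' k m z + position n j n' m) z
    (differentiableAt_gFun ħ (hz n' k m)) ((differentiableAt_argVal γN ħ n' k m z).add_const _)

theorem differentiableAt_whittakerFun {z : Label N → ℂ}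
    (hz : ∀ n k m, 0 < (argVal γN ħ n k m z).re) :
    DifferentiableAt ℂ (whittakerFun γN ħ) z := by
  have h1 : DifferentiableAt ℂ (fun z => Complex.exp (expVal γN ħ z)) z :=
    ((whittakerExponent γN ħ).2 z (Set.mem_univ z)).differentiableAt.cexp
  refine h1.mul (differentiableAt_gammaProd ħ fun n' k m => ?_)
  exact DifferentiableAt.comp (f := argVal γN ħ n' k m) z
    (differentiableAt_gFun ħ (hz n' k m)) (differentiableAt_argVal γN ħ n' k m z)

theorem whittakerFun_ne_zero {z : Label N → ℂ} (hz : ∀ n k m, 0 < (argVal γN ħ n k m z).re) :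
    whittakerFun γN ħ z ≠ 0 :=
  mul_ne_zero (Complex.exp_ne_zero _) (prod_ne_zero_iff.mpr fun n _ => prod_ne_zero_iff.mpr
    fun k _ => prod_ne_zero_iff.mpr fun m _ => gFun_ne_zero ħ (hz n k m))

end Values

end

section

open Finset

/-! ### The weight of the pairing -/

section Weight

variable {N : ℕ} (ħ : ℝ)

/-- The function `exp (2πz / ħ)`. -/
def periodExp (z : ℂ) : ℂ := Complex.exp (2 * Real.pi * z / ħ)

theorem periodExp_add (hħ : ħ ≠ 0) (z : ℂ) : periodExp ħ (z + Complex.I * ħ) = periodExp ħ z := by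
  have h : (ħ : ℂ) ≠ 0 := by exact_mod_cast hħ
  rw [periodExp, periodExp, ← Complex.exp_periodic (2 * Real.pi * z / ħ)]
  congr 1
  field_simp

theorem norm_periodExp (z : ℂ) : ‖periodExp ħ z‖ = Real.exp (2 * Real.pi * z.re / ħ) := by
  rw [periodExp, Complex.norm_exp, show (2 * Real.pi * z / ħ : ℂ) =
    ((2 * Real.pi / ħ : ℝ) : ℂ) * z by push_cast; ring, Complex.re_ofReal_mul]
  congr 1
  ring

/-- The factor of the weight belonging to two variables of a level. -/
def pairFun (a b : ℂ) : ℂ := (a - b) * (periodExp ħ b - periodExp ħ a)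

/-- The holomorphic extension of the weight `μ₀`. -/
def weightFun (z : Label N → ℂ) : ℂ :=
  ∏ n : Fin N, ∏ p : Fin (n : ℕ), ∏ s ∈ univ.filter (fun s => s < p),
    pairFun ħ (z ⟨n, s⟩) (z ⟨n, p⟩)

theorem ofReal_μ₀ (x : Label N → ℝ) : (μ₀ ħ x : ℂ) = weightFun ħ (ofRealVec x) := by
  simp only [μ₀, weightFun, pairFun, periodExp, ofRealVec]
  push_cast
  rfl

/-- A factor of the weight, divided by the difference of the variables if it involves the
variable `l`. -/
def reducedPair (l : Label N) (z : Label N → ℂ) (n : Fin N) (s p : Fin (n : ℕ)) : ℂ :=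
  if (⟨n, p⟩ : Label N) = l then periodExp ħ (z ⟨n, s⟩) - periodExp ħ (z l)
  else if (⟨n, s⟩ : Label N) = l then periodExp ħ (z ⟨n, p⟩) - periodExp ħ (z l)
  else pairFun ħ (z ⟨n, s⟩) (z ⟨n, p⟩)

/-- The weight, divided by the differences of the variable `l` and the others of its level. -/
def reducedWeight (l : Label N) (z : Label N → ℂ) : ℂ :=
  ∏ n : Fin N, ∏ p : Fin (n : ℕ), ∏ s ∈ univ.filter (fun s => s < p), reducedPair ħ l z n s p

theorem prod_pairs_eq_prod_erase {n : ℕ} (j : Fin n) (f : Fin n → ℂ) :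
    ∏ p, ∏ s ∈ univ.filter (fun s => s < p), (if p = j then f s else if s = j then f p else 1) =
      ∏ s ∈ univ.erase j, f s := by
  rw [← mul_prod_erase _ _ (mem_univ j), mul_comm,
    ← prod_filter_mul_prod_filter_not (univ.erase j) (j < ·) f]
  refine congrArg₂ _ ?_ ?_
  · rw [prod_filter]
    refine prod_congr rfl fun p hp => ?_
    have h1 : ∀ s ∈ univ.filter (fun s => s < p),
        (if p = j then f s else if s = j then f p else 1) = if s = j then f p else 1 :=
      fun s _ => if_neg (ne_of_mem_erase hp)
    rw [prod_congr rfl h1, prod_ite_eq']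
    simp only [mem_filter, mem_univ, true_and]
  · have h1 : ∀ s ∈ univ.filter (fun s => s < j),
        (if j = j then f s else if s = j then f j else 1) = f s := fun s _ => if_pos rfl
    rw [prod_congr rfl h1]
    refine prod_congr ?_ fun _ _ => rfl
    ext s
    simp only [mem_filter, mem_univ, true_and, mem_erase, and_true]
    omega

/-- Every pair containing l supplies a factor z l - z ⟨l.1, s⟩; the sign coming from the order of
the pair is absorbed by interchanging the two exponentials. -/
theorem weightFun_eq (l : Label N) (z : Label N → ℂ) :
    weightFun ħ z = reducedWeight ħ l z * ∏ s ∈ univ.erase l.2, (z l - z ⟨l.1, s⟩) := by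
  have h1 : ∀ (n : Fin N) (s p : Fin (n : ℕ)), s < p → pairFun ħ (z ⟨n, s⟩) (z ⟨n, p⟩) =
      reducedPair ħ l z n s p * (if (⟨n, p⟩ : Label N) = l then z l - z ⟨n, s⟩
        else if (⟨n, s⟩ : Label N) = l then z l - z ⟨n, p⟩ else 1) := by
    intro n s p _
    rw [reducedPair]
    split_ifs with h h'
    · rw [pairFun, h]; ring
    · rw [pairFun, h']; ring
    · rw [mul_one]
  have h2 : weightFun ħ z = reducedWeight ħ l z * ∏ n : Fin N, ∏ p : Fin (n : ℕ),
      ∏ s ∈ univ.filter (fun s => s < p), (if (⟨n, p⟩ : Label N) = l then z l - z ⟨n, s⟩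
        else if (⟨n, s⟩ : Label N) = l then z l - z ⟨n, p⟩ else 1) := by
    rw [weightFun, reducedWeight, ← prod_mul_distrib]
    refine prod_congr rfl fun n _ => ?_
    rw [← prod_mul_distrib]
    refine prod_congr rfl fun p _ => ?_
    rw [← prod_mul_distrib]
    exact prod_congr rfl fun s hs => h1 n s p (mem_filter.mp hs).2
  rw [h2]
  congr 1
  obtain ⟨n, j⟩ := l
  rw [prod_eq_single n (fun n' _ hn' => ?_) (by simp), ← prod_pairs_eq_prod_erase]
  · refine prod_congr rfl fun p _ => prod_congr rfl fun s _ => ?_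
    simp only [Sigma.mk.inj_iff, heq_eq_eq, true_and]
  · refine prod_eq_one fun p _ => prod_eq_one fun s _ => ?_
    rw [if_neg (fun h => hn' (congrArg Sigma.fst h)), if_neg (fun h => hn' (congrArg Sigma.fst h))]

/-- Once the differences are divided out, the variable l occurs only in exponentials of period iħ.
-/
theorem reducedWeight_add_single (hħ : ħ ≠ 0) (l : Label N) (z : Label N → ℂ) :
    reducedWeight ħ l (z + Pi.single l (Complex.I * ħ)) = reducedWeight ħ l z := by
  have h1 : ∀ k, k ≠ l → (z + Pi.single l (Complex.I * ħ) : Label N → ℂ) k = z k := fun k hk => by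
    rw [Pi.add_apply, Pi.single_eq_of_ne hk, add_zero]
  have h2 : periodExp ħ ((z + Pi.single l (Complex.I * ħ) : Label N → ℂ) l) = periodExp ħ (z l) := by
    rw [Pi.add_apply, Pi.single_eq_same, periodExp_add ħ hħ]
  refine prod_congr rfl fun n _ => prod_congr rfl fun p _ => prod_congr rfl fun s hs => ?_
  have hs' := (mem_filter.mp hs).2
  rw [reducedPair, reducedPair, h2]
  split_ifs with h h'
  · rw [h1]
    rintro rfl
    rw [Sigma.mk.inj_iff] at h
    exact hs'.ne' (eq_of_heq h.2)
  · rw [h1 _ h]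
  · rw [h1 _ h, h1 _ h']

theorem differentiable_reducedWeight (l : Label N) : Differentiable ℂ (reducedWeight ħ l) := by
  intro z
  refine differentiableAt_prod _ fun n _ => differentiableAt_prod _ fun p _ =>
    differentiableAt_prod _ fun s _ => ?_
  unfold reducedPair pairFun periodExp
  split_ifs <;> fun_prop

theorem differentiable_weightFun : Differentiable ℂ (weightFun ħ : (Label N → ℂ) → ℂ) := by
  intro z
  refine differentiableAt_prod _ fun n _ => differentiableAt_prod _ fun p _ =>
    differentiableAt_prod _ fun s _ => ?_
  unfold pairFun periodExp
  fun_prop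

/-- On each level the weight is, up to a fixed sign, a product of two Vandermonde determinants, in
the variables and in their exponentials. A permutation multiplies both by its sign. -/
theorem weightFun_comp_levelPerm (σ : (n : Fin N) → Equiv.Perm (Fin (n : ℕ))) (z : Label N → ℂ) :
    weightFun ħ (z ∘ levelPerm σ) = weightFun ħ z := by
  have h1 : ∀ (n : Fin N) (y : Label N → ℂ), ∏ p : Fin (n : ℕ),
      ∏ s ∈ univ.filter (fun s => s < p), pairFun ħ (y ⟨n, s⟩) (y ⟨n, p⟩) =
      (∏ p : Fin (n : ℕ), ∏ s ∈ univ.filter (fun s => s < p), (-1 : ℂ)) *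
        (Matrix.vandermonde fun k => y ⟨n, k⟩).det *
        (Matrix.vandermonde fun k => periodExp ħ (y ⟨n, k⟩)).det := by
    intro n y
    have h2 : ∀ f : Fin (n : ℕ) → Fin (n : ℕ) → ℂ, ∏ i, ∏ j ∈ Ioi i, f i j =
        ∏ p, ∏ s ∈ univ.filter (fun s => s < p), f s p := fun f => by
      rw [prod_comm' (t' := univ) (s' := fun p => univ.filter fun s => s < p) (by simp)]
    rw [Matrix.det_vandermonde, Matrix.det_vandermonde, h2, h2, ← prod_mul_distrib,
      ← prod_mul_distrib]
    refine prod_congr rfl fun p _ => ?_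
    rw [← prod_mul_distrib, ← prod_mul_distrib]
    refine prod_congr rfl fun s _ => ?_
    rw [pairFun]
    ring
  refine prod_congr rfl fun n _ => ?_
  rw [h1, h1]
  have h3 : ∀ f : Fin (n : ℕ) → ℂ, (Matrix.vandermonde fun k => f (σ n k)).det =
      Equiv.Perm.sign (σ n) * (Matrix.vandermonde f).det := fun f => by
    rw [← Matrix.det_permute]
    rfl
  have e1 : ∀ k : Fin (n : ℕ), (z ∘ levelPerm σ) ⟨n, k⟩ = z ⟨n, σ n k⟩ := fun _ => rfl
  simp only [e1]
  rw [h3 fun k => z ⟨n, k⟩, h3 fun k => periodExp ħ (z ⟨n, k⟩)]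
  have h4 : ((Equiv.Perm.sign (σ n) : ℤ) : ℂ) * ((Equiv.Perm.sign (σ n) : ℤ) : ℂ) = 1 := by
    rw [← Int.cast_mul, Int.units_coe_mul_self, Int.cast_one]
  linear_combination (∏ p : Fin (n : ℕ), ∏ s ∈ univ.filter (fun s => s < p), (-1 : ℂ)) *
    (Matrix.vandermonde fun k => z ⟨n, k⟩).det *
    (Matrix.vandermonde fun k => periodExp ħ (z ⟨n, k⟩)).det * h4

theorem pairFun_ofReal_ne_zero (hħ : 0 < ħ) {a b : ℝ} (h : a ≠ b) : pairFun ħ a b ≠ 0 := by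
  refine mul_ne_zero (sub_ne_zero.mpr (by exact_mod_cast h)) (sub_ne_zero.mpr fun h0 => h ?_)
  have h1 := congrArg norm h0
  rw [norm_periodExp, norm_periodExp, Complex.ofReal_re, Complex.ofReal_re, Real.exp_eq_exp,
    div_left_inj' hħ.ne'] at h1
  exact (mul_left_cancel₀ (by positivity) h1).symm

theorem weightFun_ofRealVec_ne_zero (hħ : 0 < ħ) {x : Label N → ℝ}
    (hx : ∀ (n : Fin N) (p s : Fin (n : ℕ)), s < p → x ⟨n, s⟩ ≠ x ⟨n, p⟩) :
    weightFun ħ (ofRealVec x) ≠ 0 :=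
  prod_ne_zero_iff.mpr fun n _ => prod_ne_zero_iff.mpr fun p _ => prod_ne_zero_iff.mpr fun s hs =>
    pairFun_ofReal_ne_zero ħ hħ (hx n p s (mem_filter.mp hs).2)

section Bounds

variable {X : Type*} {S : X → ℝ}

theorem expBound_periodExp_sub (hħ : 0 < ħ) (hS : ∀ x, 0 ≤ S x) (a b : X → ℂ) :
    ExpBound S (fun x => periodExp ħ (a x) - periodExp ħ (b x))
      (fun x => 2 * Real.pi / ħ * max (a x).re (b x).re) := by
  refine ExpBound.of_norm_le_exp hS (C := 2) fun x => (norm_sub_le _ _).trans ?_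
  rw [norm_periodExp, norm_periodExp]
  have h : ∀ u v : ℝ, u ≤ v → Real.exp (2 * Real.pi * u / ħ) ≤ Real.exp (2 * Real.pi / ħ * v) := by
    intro u v huv
    rw [Real.exp_le_exp, mul_div_right_comm]
    exact mul_le_mul_of_nonneg_left huv (by positivity)
  linarith [h _ _ (le_max_left (a x).re (b x).re), h _ _ (le_max_right (a x).re (b x).re)]

theorem expBound_pairFun (hħ : 0 < ħ) (hS : ∀ x, 0 ≤ S x) {a b : X → ℂ}
    (h : ExpBound S (fun x => a x - b x) fun _ => 0) :
    ExpBound S (fun x => pairFun ħ (a x) (b x))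
      (fun x => 2 * Real.pi / ħ * max (a x).re (b x).re) := by
  refine (h.mul (expBound_periodExp_sub ħ hħ hS b a)).mono (c := 0) fun x => ?_
  rw [zero_add, add_zero, max_comm]

/-- The exponent in the bound of the weight. -/
def weightExponent (z : Label N → ℂ) : ℝ :=
  ∑ n : Fin N, ∑ p : Fin (n : ℕ), ∑ s ∈ univ.filter (fun s => s < p),
    2 * Real.pi / ħ * max (z ⟨n, s⟩).re (z ⟨n, p⟩).re

theorem expBound_sub (hS : ∀ x, 0 ≤ S x) {a b : X → ℂ} (ha : ExpBound S a fun _ => 0)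
    (hb : ExpBound S b fun _ => 0) : ExpBound S (fun x => a x - b x) fun _ => 0 := by
  refine (ha.add (((ExpBound.const hS (-1)).mul hb).mono (B := fun _ => 0) (c := 0)
    fun _ => by simp)).of_norm_le fun x => le_of_eq ?_
  congr 1
  ring

theorem expBound_weightFun (hħ : 0 < ħ) (hS : ∀ x, 0 ≤ S x) {y : X → Label N → ℂ}
    (hy : ∀ l, ExpBound S (fun x => y x l) fun _ => 0) :
    ExpBound S (fun x => weightFun ħ (y x)) (fun x => weightExponent ħ (y x)) :=
  ExpBound.prod hS univ fun n _ => ExpBound.prod hS univ fun p _ => ExpBound.prod hS _ fun s _ =>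
    expBound_pairFun ħ hħ hS (expBound_sub hS (hy ⟨n, s⟩) (hy ⟨n, p⟩))

theorem expBound_reducedWeight (hħ : 0 < ħ) (hS : ∀ x, 0 ≤ S x) {y : X → Label N → ℂ}
    (hy : ∀ l, ExpBound S (fun x => y x l) fun _ => 0) (l : Label N) :
    ExpBound S (fun x => reducedWeight ħ l (y x)) (fun x => weightExponent ħ (y x)) := by
  refine ExpBound.prod hS univ fun n _ => ExpBound.prod hS univ fun p _ =>
    ExpBound.prod hS _ fun s _ => ?_
  unfold reducedPair
  split_ifs with h h'
  · rw [h]; exact expBound_periodExp_sub ħ hħ hS _ _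
  · rw [h']
    refine (expBound_periodExp_sub ħ hħ hS (fun x => y x ⟨n, p⟩) fun x => y x l).mono (c := 0)
      fun x => ?_
    rw [add_zero, max_comm]
  · exact expBound_pairFun ħ hħ hS (expBound_sub hS (hy ⟨n, s⟩) (hy ⟨n, p⟩))

theorem expBound_gFun (hS : ∀ x, 0 ≤ S x) {u : X → ℂ} (h1 : ∀ x, 1 / 2 ≤ (u x).re)
    (h2 : ∀ x, (u x).re ≤ 3 / 2) {c d : ℝ} (hd : 0 ≤ d) (h3 : ∀ x, |(u x).im| ≤ c + d * S x) :
    ExpBound S (fun x => gFun ħ (u x)) (fun x => -(Real.pi / 2) * |(u x).im|) := by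
  intro δ hδ
  obtain ⟨C, hC, h⟩ := exists_norm_Gamma_le (δ := δ / (d + 1)) (by positivity)
  refine ⟨Real.exp (|Real.log ħ| * (3 / 2)) * (C * Real.exp (δ / (d + 1) * |c|)), by positivity,
    fun x => ?_⟩
  change ‖Complex.exp _ * Complex.Gamma _‖ ≤ _
  rw [norm_mul, mul_assoc]
  refine mul_le_mul ?_ ((h _ (h1 x) (h2 x)).trans ?_) (norm_nonneg _) (by positivity)
  · rw [Complex.norm_exp, Complex.re_ofReal_mul, Real.exp_le_exp]
    refine (le_abs_self _).trans ?_
    rw [abs_mul]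
    refine mul_le_mul_of_nonneg_left ?_ (abs_nonneg _)
    rw [abs_of_nonneg (by linarith [h1 x])]
    exact h2 x
  · rw [mul_assoc, ← Real.exp_add]
    refine mul_le_mul_of_nonneg_left (Real.exp_le_exp.mpr ?_) hC
    have h4 : δ / (d + 1) * |(u x).im| ≤ δ / (d + 1) * (|c| + (d + 1) * S x) := by
      refine mul_le_mul_of_nonneg_left ?_ (by positivity)
      nlinarith [h3 x, le_abs_self c, hS x]
    rw [mul_add, ← mul_assoc, div_mul_cancel₀ _ (by positivity)] at h4
    linarith

theorem expBound_gammaProd (hS : ∀ x, 0 ≤ S x)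
    {ζ : X → (n : ℕ) → Fin n → Fin (n + 1) → ℂ} (h1 : ∀ x n k m, 1 / 2 ≤ (ζ x n k m).re)
    (h2 : ∀ x n k m, (ζ x n k m).re ≤ 3 / 2) {c d : ℝ} (hd : 0 ≤ d)
    (h3 : ∀ x n k m, |(ζ x n k m).im| ≤ c + d * S x) :
    ExpBound S (fun x => gammaProd ħ N (ζ x))
      (fun x => ∑ n ∈ Ico 1 N, ∑ k, ∑ m, -(Real.pi / 2) * |(ζ x n k m).im|) :=
  ExpBound.prod hS (Ico 1 N) fun n _ => ExpBound.prod hS univ fun k _ =>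
    ExpBound.prod hS univ fun m _ => expBound_gFun ħ hS (fun x => h1 x n k m)
      (fun x => h2 x n k m) hd fun x => h3 x n k m

end Bounds

end Weight

end

section

open Finset MeasureTheory

/-! ### Decay of the integrands -/

section Integrands

variable {N : ℕ} (γ : Fin N → ℝ) (ħ : ℝ)

/-- The entries of a real array. -/
def realEntry (x : Label N → ℝ) (n : ℕ) (j : Fin n) : ℝ :=
  if h : n < N then x ⟨⟨n, h⟩, j⟩ else if h' : n = N then γ (Fin.cast h' j) else 0

theorem entryVal_re (z : Label N → ℂ) (n : ℕ) (j : Fin n) :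
    (entryVal (ofRealVec γ) z n j).re = realEntry γ (fun l => (z l).re) n j := by
  rw [entryVal, entry, realEntry]
  split_ifs <;> rfl

theorem entryVal_im_ofRealVec (x : Label N → ℝ) (n : ℕ) (j : Fin n) :
    (entryVal (ofRealVec γ) (ofRealVec x) n j).im = 0 := by
  rw [entryVal, entry]
  split_ifs <;> rfl

theorem abs_realEntry_le (x : Label N → ℝ) (n : ℕ) (j : Fin n) :
    |realEntry γ x n j| ≤ absSum γ + absSum x := by
  rw [realEntry]
  split_ifs
  · linarith [abs_le_absSum x ⟨⟨n, by assumption⟩, j⟩, absSum_nonneg γ]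
  · linarith [abs_le_absSum γ (Fin.cast (by assumption) j), absSum_nonneg x]
  · rw [abs_zero]; linarith [absSum_nonneg γ, absSum_nonneg x]

theorem argVal_re (n : ℕ) (k : Fin n) (m : Fin (n + 1)) (z : Label N → ℂ) :
    (argVal (ofRealVec γ) ħ n k m z).re = ħ⁻¹ * ((entryVal (ofRealVec γ) z n k).im -
      (entryVal (ofRealVec γ) z (n + 1) m).im) + 1 / 2 := by
  rw [argVal_eq, ← Complex.ofReal_inv, mul_assoc, Complex.add_re, neg_mul, Complex.neg_re,
    Complex.I_mul_re, Complex.im_ofReal_mul, Complex.sub_im]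
  norm_num

theorem argVal_im (n : ℕ) (k : Fin n) (m : Fin (n + 1)) (z : Label N → ℂ) :
    (argVal (ofRealVec γ) ħ n k m z).im = -(ħ⁻¹ * (realEntry γ (fun l => (z l).re) n k -
      realEntry γ (fun l => (z l).re) (n + 1) m)) := by
  rw [argVal_eq, ← Complex.ofReal_inv, mul_assoc, Complex.add_im, neg_mul, Complex.neg_im,
    Complex.I_mul_im, Complex.re_ofReal_mul, Complex.sub_re, entryVal_re, entryVal_re]
  norm_num

theorem argVal_re_ofRealVec (n : ℕ) (k : Fin n) (m : Fin (n + 1)) (x : Label N → ℝ) :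
    (argVal (ofRealVec γ) ħ n k m (ofRealVec x)).re = 1 / 2 := by
  rw [argVal_re, entryVal_im_ofRealVec, entryVal_im_ofRealVec, sub_zero, mul_zero, zero_add]

theorem expVal_re (z : Label N → ℂ) : (expVal (ofRealVec γ) ħ z).re =
    -(Real.pi / ħ) * ∑ n ∈ Ico 1 N, ((n : ℝ) - 1) * ∑ j : Fin n,
      realEntry γ (fun l => (z l).re) n j := by
  have h : expVal (ofRealVec γ) ħ z = ((-(Real.pi / ħ) : ℝ) : ℂ) * ∑ n ∈ Ico 1 N,
      (((n : ℝ) - 1 : ℝ) : ℂ) * ∑ j : Fin n, entryVal (ofRealVec γ) z n j := by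
    rw [expVal, ← evalHom_apply, whittakerExponent, map_smul, map_sum, smul_eq_mul]
    push_cast
    congr 1
    refine sum_congr rfl fun n _ => ?_
    rw [map_smul, map_sum, smul_eq_mul]
    rfl
  rw [h, Complex.re_ofReal_mul, Complex.re_sum]
  congr 1
  refine sum_congr rfl fun n _ => ?_
  rw [Complex.re_ofReal_mul, Complex.re_sum]
  simp only [entryVal_re]

theorem sum_pairs_of_symm {n : ℕ} {g : Fin n → Fin n → ℝ} (hg : ∀ s p, g s p = g p s) :
    2 * ∑ p, ∑ s ∈ univ.filter (fun s => s < p), g s p = ∑ p, ∑ s, g s p - ∑ p, g p p := by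
  have h1 : ∀ p, ∑ s, g s p = ∑ s ∈ univ.filter (fun s => s < p), g s p +
      (g p p + ∑ s ∈ univ.filter (fun s => p < s), g s p) := by
    intro p
    rw [← sum_filter_add_sum_filter_not univ (fun s => s < p)]
    congr 1
    have h2 : univ.filter (fun s => ¬ s < p) = insert p (univ.filter fun s => p < s) := by
      ext s
      simp only [mem_filter, mem_univ, true_and, mem_insert]
      omega
    rw [h2, sum_insert (by simp)]
  have h3 : ∑ p, ∑ s ∈ univ.filter (fun s => p < s), g s p =
      ∑ p, ∑ s ∈ univ.filter (fun s => s < p), g s p := by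
    rw [sum_comm' (t' := univ) (s' := fun s => univ.filter fun p => p < s) (by simp)]
    exact sum_congr rfl fun _ _ => sum_congr rfl fun _ _ => hg _ _
  rw [sum_congr rfl fun p _ => h1 p, sum_add_distrib, sum_add_distrib, h3]
  ring

/-- From 2 max(a, b) = a + b + |a - b|. The linear part is exactly what the exponential prefactor of
w_N cancels. -/
theorem sum_pairs_max {n : ℕ} (a : Fin n → ℝ) :
    ∑ p, ∑ s ∈ univ.filter (fun s => s < p), 2 * max (a s) (a p) =
      ((n : ℝ) - 1) * ∑ j, a j + gap a a / 2 := by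
  have h1 : ∀ s p, 2 * max (a s) (a p) = a s + a p + |a s - a p| := fun s p => by
    rcases le_total (a s) (a p) with h | h
    · rw [max_eq_right h, abs_of_nonpos (sub_nonpos.mpr h)]; ring
    · rw [max_eq_left h, abs_of_nonneg (sub_nonneg.mpr h)]; ring
  simp only [h1]
  have h2 := sum_pairs_of_symm (g := fun s p => a s + a p + |a s - a p|) fun s p => by
    rw [abs_sub_comm, add_comm (a s)]
  have h3 : ∑ p, ∑ s, (a s + a p + |a s - a p|) = 2 * n * ∑ j, a j + gap a a := by
    simp only [sum_add_distrib, sum_const, card_univ, Fintype.card_fin, nsmul_eq_mul, ← mul_sum]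
    rw [gap, sum_comm]
    ring
  have h4 : ∑ p, (a p + a p + |a p - a p|) = 2 * ∑ j, a j := by
    simp only [sub_self, abs_zero, add_zero, sum_add_distrib]
    ring
  rw [h3, h4] at h2
  linarith

theorem weightExponent_eq (z : Label N → ℂ) : weightExponent ħ z =
    Real.pi / ħ * ∑ n ∈ Ico 1 N, (((n : ℝ) - 1) * ∑ j : Fin n,
      realEntry γ (fun l => (z l).re) n j + gap (realEntry γ (fun l => (z l).re) n)
        (realEntry γ (fun l => (z l).re) n) / 2) := by
  set a := realEntry γ (fun l => (z l).re)
  have h1 : ∀ n : Fin N, ∑ p : Fin (n : ℕ), ∑ s ∈ univ.filter (fun s => s < p),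
      2 * Real.pi / ħ * max (z ⟨n, s⟩).re (z ⟨n, p⟩).re =
      Real.pi / ħ * (((n : ℕ) : ℝ) - 1) * ∑ j, a n j + Real.pi / ħ * (gap (a n) (a n) / 2) := by
    intro n
    have h2 : ∀ s : Fin (n : ℕ), (z ⟨n, s⟩).re = a n s := fun s => by
      simp only [a, realEntry, n.2, dif_pos]
    have h3 := sum_pairs_max (a n)
    simp only [h2]
    rw [mul_assoc, ← mul_add, ← h3, mul_sum]
    refine sum_congr rfl fun p _ => ?_
    rw [mul_sum]
    refine sum_congr rfl fun s _ => ?_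
    ring
  have h4 : (range N).filter (fun n => 1 ≤ n) = Ico 1 N := by
    ext n
    simp only [mem_filter, mem_range, mem_Ico]
    omega
  rw [weightExponent, sum_congr rfl fun n _ => h1 n, Fin.sum_univ_eq_sum_range (fun n =>
    Real.pi / ħ * ((n : ℝ) - 1) * ∑ j, a n j + Real.pi / ħ * (gap (a n) (a n) / 2)), ← h4,
    sum_filter, mul_sum]
  refine sum_congr rfl fun n _ => ?_
  split_ifs with hn
  · ring
  · have : n = 0 := by omega
    subst this
    simp [gap]

/-- The exponent of the bounds of the integrands is at most a negative multiple of the norm. -/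
theorem exists_exponent_le (hħ : 0 < ħ) : ∃ κ > 0, ∃ c, ∀ z : Label N → ℂ,
    (expVal (ofRealVec γ) ħ z).re + weightExponent ħ z + ∑ n ∈ Ico 1 N, ∑ k, ∑ m,
      -(Real.pi / 2) * |(argVal (ofRealVec γ) ħ n k m z).im| ≤
        -κ * absSum (fun l => (z l).re) + c := by
  -- The bound for a single coordinate is summed over all labels; the extra 1 keeps L positive when
  -- there are no variables.
  set L : ℝ := Fintype.card (Label N) + 1
  have hL : 0 < L := by positivity
  refine ⟨Real.pi / (ħ * L), by positivity, Real.pi / ħ * absSum γ, fun z => ?_⟩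
  set x : Label N → ℝ := fun l => (z l).re
  set a := realEntry γ x
  set e := ∑ n ∈ Ico 1 N, energy (a n) (a (n + 1))
  have hen : ∀ n, 0 ≤ energy (a n) (a (n + 1)) := fun n => energy_nonneg (by simp) _ _
  have h1 : ∀ l, |x l| ≤ absSum γ + e / 2 := by
    rintro ⟨n, j⟩
    have h2 := abs_le_sum_energy (N := N) a (M := absSum γ) (fun k => by
      simp only [a, realEntry, lt_irrefl, dif_neg, not_false_eq_true, dif_pos, Fin.cast_eq_self]
      exact abs_le_absSum γ k) n.2.le j
    have h3 : a n j = x ⟨n, j⟩ := by simp only [a, realEntry, n.2, dif_pos]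
    have h4 : ∑ l ∈ Ico (n : ℕ) N, energy (a l) (a (l + 1)) ≤ e :=
      sum_le_sum_of_subset_of_nonneg (Ico_subset_Ico_left ((Nat.zero_le _).trans_lt j.2))
        fun l _ _ => hen l
    rw [h3] at h2
    linarith
  have h2 : absSum x ≤ L * (absSum γ + e / 2) := by
    have h0 : 0 ≤ absSum γ + e / 2 :=
      add_nonneg (absSum_nonneg γ) (div_nonneg (sum_nonneg fun n _ => hen n) two_pos.le)
    have h3 := sum_le_sum fun l (_ : l ∈ univ) => h1 l
    rw [sum_const, card_univ, nsmul_eq_mul] at h3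
    exact h3.trans (mul_le_mul_of_nonneg_right (by simp [L]) h0)
  have h3 : ∑ n ∈ Ico 1 N, ∑ k, ∑ m, -(Real.pi / 2) * |(argVal (ofRealVec γ) ħ n k m z).im| =
      -(Real.pi / ħ) * ∑ n ∈ Ico 1 N, gap (a n) (a (n + 1)) / 2 := by
    rw [mul_sum]
    refine sum_congr rfl fun n _ => ?_
    rw [gap, sum_div, mul_sum]
    refine sum_congr rfl fun k _ => ?_
    rw [sum_div, mul_sum]
    refine sum_congr rfl fun m _ => ?_
    rw [argVal_im, abs_neg, abs_mul, abs_of_pos (inv_pos.mpr hħ)]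
    ring
  -- After the linear terms cancel, the exponent is -π/(2ħ) times the excess of the gaps between
  -- levels over those within levels, hence at most -π/(2ħ) times the total energy e.
  have h4 := sum_energy_le (N := N) a
  rw [expVal_re, weightExponent_eq γ, h3, sum_add_distrib, ← sum_div, ← sum_div]
  change -(Real.pi / ħ) * ∑ n ∈ Ico 1 N, ((n : ℝ) - 1) * ∑ j : Fin n, a n j +
    Real.pi / ħ * (∑ n ∈ Ico 1 N, ((n : ℝ) - 1) * ∑ j : Fin n, a n j +
      (∑ n ∈ Ico 1 N, gap (a n) (a n)) / 2) +
    -(Real.pi / ħ) * ((∑ n ∈ Ico 1 N, gap (a n) (a (n + 1))) / 2) ≤ _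
  have h5 : Real.pi / (ħ * L) * absSum x ≤ Real.pi / ħ * (absSum γ + e / 2) := by
    refine (mul_le_mul_of_nonneg_left h2 (by positivity)).trans (le_of_eq ?_)
    field_simp
  have h6 : Real.pi / ħ * (e / 2) ≤ Real.pi / ħ * ((∑ n ∈ Ico 1 N, gap (a n) (a (n + 1)) -
      ∑ n ∈ Ico 1 N, gap (a n) (a n)) / 2) :=
    mul_le_mul_of_nonneg_left (by linarith) (by positivity)
  linarith

theorem abs_argVal_im_le (hħ : 0 < ħ) (n : ℕ) (k : Fin n) (m : Fin (n + 1)) (z : Label N → ℂ) :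
    |(argVal (ofRealVec γ) ħ n k m z).im| ≤
      2 * ħ⁻¹ * absSum γ + 2 * ħ⁻¹ * absSum (fun l => (z l).re) := by
  rw [argVal_im, abs_neg, abs_mul, abs_of_pos (inv_pos.mpr hħ), mul_comm 2, mul_assoc, mul_assoc,
    ← mul_add]
  refine mul_le_mul_of_nonneg_left ((abs_sub _ _).trans ?_) (inv_pos.mpr hħ).le
  linarith [abs_realEntry_le γ (fun l => (z l).re) n k,
    abs_realEntry_le γ (fun l => (z l).re) (n + 1) m]

theorem expBound_exp_expVal {X : Type*} (y : X → Label N → ℂ) :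
    ExpBound (fun x => absSum fun l => (y x l).re)
      (fun x => Complex.exp (expVal (ofRealVec γ) ħ (y x)))
      (fun x => (expVal (ofRealVec γ) ħ (y x)).re) :=
  ExpBound.of_norm_le_exp (fun _ => absSum_nonneg _) (C := 1) fun x => by
    rw [Complex.norm_exp, one_mul]

/-- The common bound of the integrands. -/
theorem exists_expBound (hħ : 0 < ħ) : ∃ κ > 0, ∀ {X : Type} (y : X → Label N → ℂ)
    (ζ : X → (n : ℕ) → Fin n → Fin (n + 1) → ℂ) (f : X → ℂ) (r : MvPolynomial (Label N) ℂ),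
    (∀ l, ExpBound (fun x => absSum fun l => (y x l).re) (fun x => y x l) fun _ => 0) →
    (∀ x n k m, 1 / 2 ≤ (ζ x n k m).re) → (∀ x n k m, (ζ x n k m).re ≤ 3 / 2) →
    (∀ x n k m, (ζ x n k m).im = (argVal (ofRealVec γ) ħ n k m (y x)).im) →
    ExpBound (fun x => absSum fun l => (y x l).re) f (fun x => weightExponent ħ (y x)) →
    ∃ C, ∀ x, ‖MvPolynomial.eval (y x) r * f x * (Complex.exp (expVal (ofRealVec γ) ħ (y x)) *
      gammaProd ħ N (ζ x))‖ ≤ C * Real.exp (-κ * absSum fun l => (y x l).re) := by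
  obtain ⟨κ, hκ, c, h⟩ := exists_exponent_le γ ħ hħ
  -- Half of the decay pays for all subexponential factors.
  refine ⟨κ / 2, half_pos hκ, fun {X} y ζ f r hy h1 h2 h3 hf => ?_⟩
  have hS : ∀ x, 0 ≤ absSum fun l => (y x l).re := fun _ => absSum_nonneg _
  have hb := ((ExpBound.eval hS hy r).mul hf).mul ((expBound_exp_expVal γ ħ y).mul
    (expBound_gammaProd (N := N) ħ hS h1 h2 (c := 2 * ħ⁻¹ * absSum γ) (d := 2 * ħ⁻¹) (by positivity)
      fun x n k m => by rw [h3]; exact abs_argVal_im_le γ ħ hħ n k m (y x)))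
  obtain ⟨C, -, hC⟩ := (hb.mono (B := fun x => -κ * absSum fun l => (y x l).re) (c := c)
    fun x => by
      simp only [h3]
      linarith [h (y x)]) (κ / 2) (half_pos hκ)
  refine ⟨C, fun x => (hC x).trans (le_of_eq ?_)⟩
  congr 2
  ring

/-- The decay of the integrands of the pairing. -/
theorem exists_norm_weight_mul_whittakerFun_le (hħ : 0 < ħ) (r : MvPolynomial (Label N) ℂ) :
    ∃ C, ∃ ε > 0, ∀ x : Label N → ℝ, ‖MvPolynomial.eval (ofRealVec x) r *
      weightFun ħ (ofRealVec x) * whittakerFun (ofRealVec γ) ħ (ofRealVec x)‖ ≤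
        C * Real.exp (-ε * absSum x) := by
  obtain ⟨κ, hκ, h⟩ := exists_expBound γ ħ hħ
  have hy : ∀ l, ExpBound absSum (fun x : Label N → ℝ => ofRealVec x l) fun _ => 0 := fun l => by
    simpa using expBound_ofRealVec (MvPolynomial.X l : MvPolynomial (Label N) ℂ)
  obtain ⟨C, hC⟩ := h (fun x : Label N → ℝ => ofRealVec x)
    (fun x n k m => argVal (ofRealVec γ) ħ n k m (ofRealVec x)) (fun x => weightFun ħ (ofRealVec x))
    r hy (fun x n k m => (argVal_re_ofRealVec γ ħ n k m x).ge)
    (fun x n k m => by rw [argVal_re_ofRealVec]; norm_num) (fun _ _ _ _ => rfl)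
    (expBound_weightFun ħ hħ absSum_nonneg hy)
  exact ⟨C, κ, hκ, hC⟩

theorem continuous_weight_mul_whittakerFun (r : MvPolynomial (Label N) ℂ) :
    Continuous fun x : Label N → ℝ => MvPolynomial.eval (ofRealVec x) r *
      weightFun ħ (ofRealVec x) * whittakerFun (ofRealVec γ) ħ (ofRealVec x) := by
  refine ((continuous_eval_ofRealVec r).mul
    ((differentiable_weightFun ħ).continuous.comp continuous_ofRealVec)).mul
    (continuous_iff_continuousAt.mpr fun x => ?_)
  exact ContinuousAt.comp (f := ofRealVec) (differentiableAt_whittakerFun (ofRealVec γ) ħ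
    fun n k m => by rw [argVal_re_ofRealVec]; norm_num).continuousAt continuous_ofRealVec.continuousAt

theorem integrable_weight_mul_whittakerFun (hħ : 0 < ħ) (r : MvPolynomial (Label N) ℂ) :
    Integrable fun x : Label N → ℝ => MvPolynomial.eval (ofRealVec x) r *
      weightFun ħ (ofRealVec x) * whittakerFun (ofRealVec γ) ħ (ofRealVec x) := by
  obtain ⟨C, ε, hε, h⟩ := exists_norm_weight_mul_whittakerFun_le γ ħ hħ r
  exact integrable_of_norm_le (continuous_weight_mul_whittakerFun γ ħ r).aestronglyMeasurable hε h

theorem position_re (n j n' j' : ℕ) :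
    (position n j n' j').re = if n' = n ∧ j' = j then 1 else 0 := by
  rw [position]; split_ifs <;> rfl

theorem position_im (n j n' j' : ℕ) : (position n j n' j').im = 0 := by
  rw [position]; split_ifs <;> rfl

/-- The shift of the contour for the integrands of the raising and lowering operators. -/
theorem integral_raisedFun_shift (hħ : 0 < ħ) {n : ℕ} (h : n + 1 < N) (j : Fin (n + 1))
    (r : MvPolynomial (Label N) ℂ) {Φ : (Label N → ℂ) → ℂ}
    (hΦ : ∀ z, Φ z = MvPolynomial.eval z r * reducedWeight ħ ⟨⟨n + 1, h⟩, j⟩ z *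
      raisedFun (ofRealVec γ) ħ n j z) :
    Integrable (fun x : Label N → ℝ => Φ (ofRealVec x)) ∧
    Integrable (fun x : Label N → ℝ =>
      Φ (ofRealVec x + Pi.single ⟨⟨n + 1, h⟩, j⟩ (Complex.I * ħ))) ∧
    ∫ x : Label N → ℝ, Φ (ofRealVec x) =
      ∫ x : Label N → ℝ, Φ (ofRealVec x + Pi.single ⟨⟨n + 1, h⟩, j⟩ (Complex.I * ħ)) := by
  set l : Label N := ⟨⟨n + 1, h⟩, j⟩ with hl
  have hΦ' : Φ = fun z => MvPolynomial.eval z r * reducedWeight ħ l z *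
      raisedFun (ofRealVec γ) ħ n j z := funext hΦ
  obtain ⟨κ, hκ, hb⟩ := exists_expBound γ ħ hħ
  -- The height of the contour is part of the parameter, so that one constant bounds the whole
  -- strip.
  let y : (Label N → ℝ) × Set.Icc 0 ħ → Label N → ℂ := fun x =>
    ofRealVec x.1 + Pi.single l (x.2 * Complex.I)
  have hre : ∀ x, (fun k => (y x k).re) = x.1 := by
    intro x
    funext k
    by_cases hk : k = l
    · subst hk
      simp [y, ofRealVec]
    · simp [y, ofRealVec, hk]
  have harg : ∀ (x : (Label N → ℝ) × Set.Icc 0 ħ) n' (k : Fin n') m,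
      argVal (ofRealVec γ) ħ n' k m (y x) = argVal (ofRealVec γ) ħ n' k m (ofRealVec x.1) +
        ((x.2 / ħ : ℝ) : ℂ) * position (n + 1) j n' k - ((x.2 / ħ : ℝ) : ℂ) * position n j n' m := by
    intro x n' k m
    rw [← argVal_add_single (ofRealVec γ) ħ hħ.ne' h j]
    have : (x.2 : ℂ) * Complex.I = Complex.I * ħ * ((x.2 / ħ : ℝ) : ℂ) := by
      have h0 : (ħ : ℂ) ≠ 0 := by exact_mod_cast hħ.ne'
      push_cast
      field_simp
    rw [← this]
  -- With t = s/ħ ∈ [0, 1], the real part is 1/2, 1/2 + t or 1/2 - t + 1, since an argument involves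
  -- the moved variable at most once. The added `position` keeps the last case away from the poles.
  have hζ : ∀ (x : (Label N → ℝ) × Set.Icc 0 ħ) n' (k : Fin n') m,
      1 / 2 ≤ (argVal (ofRealVec γ) ħ n' k m (y x) + position n j n' m).re ∧
      (argVal (ofRealVec γ) ħ n' k m (y x) + position n j n' m).re ≤ 3 / 2 := by
    intro x n' k m
    have h0 : 0 ≤ (x.2 : ℝ) / ħ := div_nonneg x.2.2.1 hħ.le
    have h1 : (x.2 : ℝ) / ħ ≤ 1 := div_le_one_of_le₀ x.2.2.2 hħ.le
    rw [harg, Complex.add_re, Complex.sub_re, Complex.add_re, Complex.re_ofReal_mul,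
      Complex.re_ofReal_mul, argVal_re_ofRealVec, position_re, position_re]
    split_ifs with h2 h3 h3
    · omega
    all_goals constructor <;> linarith
  have hyb : ∀ k, ExpBound (fun x => absSum fun k => (y x k).re) (fun x => y x k) fun _ => 0 := by
    intro k
    refine ExpBound.of_norm_le_linear (c := ħ) (d := 1) (fun _ => absSum_nonneg _) fun x => ?_
    rw [hre, one_mul]
    have h1 : ‖(Pi.single l ((x.2 : ℂ) * Complex.I) : Label N → ℂ) k‖ ≤ ħ := by
      by_cases hk : k = l
      · subst hk
        rw [Pi.single_eq_same, norm_mul, Complex.norm_I, mul_one, Complex.norm_real,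
          Real.norm_eq_abs, abs_of_nonneg x.2.2.1]
        exact x.2.2.2
      · rw [Pi.single_eq_of_ne hk, norm_zero]
        exact hħ.le
    have h2 : ‖ofRealVec x.1 k‖ ≤ absSum x.1 := by
      rw [ofRealVec, Complex.norm_real]
      exact abs_le_absSum x.1 k
    have h3 := norm_add_le (ofRealVec x.1 k) ((Pi.single l ((x.2 : ℂ) * Complex.I) : Label N → ℂ) k)
    exact h3.trans (by linarith)
  obtain ⟨C, hC⟩ := hb y (fun x n' k m => argVal (ofRealVec γ) ħ n' k m (y x) + position n j n' m)
    (fun x => reducedWeight ħ l (y x)) r hyb (fun x n' k m => (hζ x n' k m).1)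
    (fun x n' k m => (hζ x n' k m).2)
    (fun x n' k m => by rw [Complex.add_im, position_im, add_zero])
    (expBound_reducedWeight ħ hħ (fun _ => absSum_nonneg _) hyb l)
  have key := integral_eq_integral_add_single (Φ := Φ) (p := l) (h := ħ) (C := C) (ε := κ) hħ.le hκ
    (fun x s h0 h1 => by
      rw [hΦ']
      refine (DifferentiableAt.mul ?_ (differentiable_reducedWeight ħ l _)).mul
        (differentiableAt_raisedFun (ofRealVec γ) ħ n j fun n' k m =>
          lt_of_lt_of_le (by norm_num) (hζ (x, ⟨s, h0, h1⟩) n' k m).1)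
      have h2 := ((polyE r).2 (ofRealVec x + Pi.single l (s * Complex.I))
        (Set.mem_univ _)).differentiableAt
      have h3 : (polyE r).1 = fun z => MvPolynomial.eval z r := funext (polyE_apply r)
      rwa [h3] at h2)
    (fun x s h0 h1 => by
      have h2 := hC (x, ⟨s, h0, h1⟩)
      rw [hre] at h2
      rw [hΦ]
      exact h2)
  rwa [mul_comm (ħ : ℂ) Complex.I] at key

end Integrands

end

/-! ### Adjointness, skewness and non-degeneracy of the pairing. -/

section

open Finset MeasureTheory

/-! ### Adjointness of the difference operators -/

section Adjoint

/-- The polynomial with the conjugate coefficients. -/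
def conjPoly {κ : Type*} : MvPolynomial κ ℂ →+* MvPolynomial κ ℂ :=
  MvPolynomial.map (starRingEnd ℂ)

theorem conj_eval {κ : Type*} (f : MvPolynomial κ ℂ) (z : κ → ℂ) :
    conj (MvPolynomial.eval z f) = MvPolynomial.eval (fun i => conj (z i)) (conjPoly f) := by
  rw [conjPoly, MvPolynomial.eval_map, MvPolynomial.eval, MvPolynomial.coe_eval₂Hom,
    MvPolynomial.hom_eval₂, RingHom.comp_id]

theorem conj_ofRealVec {κ : Type*} (x : κ → ℝ) : (fun i => conj (ofRealVec x i)) = ofRealVec x :=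
  funext fun i => Complex.conj_ofReal (x i)

theorem conj_eval_ofRealVec {κ : Type*} (f : MvPolynomial κ ℂ) (x : κ → ℝ) :
    conj (MvPolynomial.eval (ofRealVec x) f) = MvPolynomial.eval (ofRealVec x) (conjPoly f) := by
  rw [conj_eval, conj_ofRealVec]

theorem conjPoly_conjPoly {κ : Type*} (f : MvPolynomial κ ℂ) : conjPoly (conjPoly f) = f := by
  rw [conjPoly, MvPolynomial.map_map]
  have : (starRingEnd ℂ).comp (starRingEnd ℂ) = RingHom.id ℂ := by
    ext z; exact Complex.conj_conj z
  rw [this, MvPolynomial.map_id]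

theorem conjPoly_smul {κ : Type*} (a : ℂ) (f : MvPolynomial κ ℂ) :
    conjPoly (a • f) = conj a • conjPoly f := by
  rw [MvPolynomial.smul_eq_C_mul, MvPolynomial.smul_eq_C_mul, map_mul, conjPoly,
    MvPolynomial.map_C]

variable {N : ℕ} (γ : Fin N → ℝ) (ħ : ℝ)

/-- The translation of a polynomial, `f(γ) ↦ f(γ + c e_l)`. -/
def translatePoly (l : Label N) (c : ℂ) : MvPolynomial (Label N) ℂ →ₐ[ℂ] MvPolynomial (Label N) ℂ :=
  MvPolynomial.aeval fun i => MvPolynomial.X i + MvPolynomial.C ((Pi.single l c : Label N → ℂ) i)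

theorem eval_translatePoly (l : Label N) (c : ℂ) (f : MvPolynomial (Label N) ℂ) (z : Label N → ℂ) :
    MvPolynomial.eval z (translatePoly l c f) = MvPolynomial.eval (z + Pi.single l c) f := by
  induction f using MvPolynomial.induction_on with
  | C a => simp [translatePoly]
  | add p q hp hq => rw [map_add, map_add, map_add, hp, hq]
  | mul_X p i hp =>
    rw [map_mul, map_mul, map_mul, hp, translatePoly, MvPolynomial.aeval_X, map_add,
      MvPolynomial.eval_X, MvPolynomial.eval_C, MvPolynomial.eval_X, Pi.add_apply]

/-- A factor of the reduced weight still contains a difference of exponentials or a full pair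
factor, which vanishes when two variables of a level coincide. Identities with the weight therefore
hold at every point, not merely off the diagonals. -/
theorem reducedWeight_eq_zero (l : Label N) {z : Label N → ℂ} {n : Fin N} {a b : Fin (n : ℕ)}
    (hab : a ≠ b) (h : z ⟨n, a⟩ = z ⟨n, b⟩) : reducedWeight ħ l z = 0 := by
  wlog hlt : a < b generalizing a b
  · exact this hab.symm h.symm (lt_of_le_of_ne (not_lt.mp hlt) hab.symm)
  refine prod_eq_zero (mem_univ n) (prod_eq_zero (mem_univ b)
    (prod_eq_zero (mem_filter.mpr ⟨mem_univ a, hlt⟩) ?_))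
  rw [reducedPair]
  split_ifs with h1 h2
  · rw [← h1, h, sub_self]
  · rw [← h2, h, sub_self]
  · rw [pairFun, h, sub_self, zero_mul]

theorem denVal_eq (γN : Fin N → ℂ) {n : ℕ} (h : n < N) (j : Fin n) (z : Label N → ℂ) :
    denVal γN n j z = ∏ s ∈ univ.erase j, (z ⟨⟨n, h⟩, j⟩ - z ⟨⟨n, h⟩, s⟩) := by
  refine prod_congr rfl fun s _ => ?_
  rw [entryVal, entryVal, entry_apply_of_lt γN h, entry_apply_of_lt γN h]

/-- Multiplication by the weight removes the denominators of a difference operator. -/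
theorem mul_weightFun_of_eq_sum_div (γN : Fin N → ℂ) {n : ℕ} (h : n < N) {z : Label N → ℂ} {a : ℂ}
    {f : Fin n → ℂ} (ha : (∀ j, denVal γN n j z ≠ 0) → a = ∑ j, f j / denVal γN n j z) :
    a * weightFun ħ z = ∑ j, f j * reducedWeight ħ ⟨⟨n, h⟩, j⟩ z := by
  by_cases hz : ∀ j, denVal γN n j z ≠ 0
  · rw [ha hz, sum_mul]
    refine sum_congr rfl fun j _ => ?_
    rw [weightFun_eq ħ ⟨⟨n, h⟩, j⟩, ← denVal_eq γN h]
    have := hz j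
    field_simp
  · push Not at hz
    obtain ⟨j, hj⟩ := hz
    rw [weightFun_eq ħ ⟨⟨n, h⟩, j⟩, ← denVal_eq γN h, hj, mul_zero, mul_zero]
    rw [denVal_eq γN h, prod_eq_zero_iff] at hj
    obtain ⟨s, hs, hj⟩ := hj
    refine (sum_eq_zero fun i _ => ?_).symm
    rw [reducedWeight_eq_zero ħ _ (ne_of_mem_erase hs).symm (sub_eq_zero.mp hj), mul_zero]

variable {γ ħ}

/-- The integrands connecting a difference operator and its adjoint. -/
def shiftIntegrand (γ : Fin N → ℝ) (ħ : ℝ) {n : ℕ} (h : n + 1 < N) (f g : MvPolynomial (Label N) ℂ)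
    (j : Fin (n + 1)) (z : Label N → ℂ) : ℂ :=
  MvPolynomial.eval z (translatePoly ⟨⟨n + 1, h⟩, j⟩ (-(Complex.I * ħ)) f * g) *
    reducedWeight ħ ⟨⟨n + 1, h⟩, j⟩ z * raisedFun (ofRealVec γ) ħ n j z

theorem eval_mul_weight_of_numB (hħ : 0 < ħ) {n : ℕ} (h : n + 1 < N)
    {f g F : MvPolynomial (Label N) ℂ} (x : Label N → ℝ)
    (hF : (∀ j, denVal (ofRealVec γ) (n + 1) j (ofRealVec x) ≠ 0) →
      MvPolynomial.eval (ofRealVec x) F = ∑ j, numB (ofRealVec γ) (-(Complex.I * ħ)) n j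
        (ofRealVec x) * MvPolynomial.eval (ofRealVec x +
          Pi.single ⟨⟨n + 1, h⟩, j⟩ (-(Complex.I * ħ))) f /
          denVal (ofRealVec γ) (n + 1) j (ofRealVec x)) :
    MvPolynomial.eval (ofRealVec x) (F * g) * weightFun ħ (ofRealVec x) *
      whittakerFun (ofRealVec γ) ħ (ofRealVec x) =
      Complex.I⁻¹ ^ n * ∑ j, shiftIntegrand γ ħ h f g j (ofRealVec x) := by
  have h1 := mul_weightFun_of_eq_sum_div ħ (ofRealVec γ) h hF
  rw [map_mul, mul_right_comm (MvPolynomial.eval _ F), h1, sum_mul, sum_mul, mul_sum]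
  refine sum_congr rfl fun j _ => ?_
  have h2 := numB_mul_whittakerFun (ofRealVec γ) ħ hħ h j (z := ofRealVec x) fun n k m => by
    rw [argVal_re_ofRealVec]; norm_num
  rw [shiftIntegrand, map_mul, eval_translatePoly]
  linear_combination MvPolynomial.eval (ofRealVec x +
    Pi.single ⟨⟨n + 1, h⟩, j⟩ (-(Complex.I * ħ))) f * MvPolynomial.eval (ofRealVec x) g *
    reducedWeight ħ ⟨⟨n + 1, h⟩, j⟩ (ofRealVec x) * h2

theorem eval_mul_weight_of_numA (hħ : 0 < ħ) {n : ℕ} (h : n + 1 < N)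
    {f g G : MvPolynomial (Label N) ℂ} (x : Label N → ℝ)
    (hG : (∀ j, denVal (ofRealVec γ) (n + 1) j (ofRealVec x) ≠ 0) →
      MvPolynomial.eval (ofRealVec x) G = ∑ j, numA (ofRealVec γ) (Complex.I * ħ) (n + 1) j
        (ofRealVec x) * MvPolynomial.eval (ofRealVec x +
          Pi.single ⟨⟨n + 1, h⟩, j⟩ (Complex.I * ħ)) g /
          denVal (ofRealVec γ) (n + 1) j (ofRealVec x)) :
    MvPolynomial.eval (ofRealVec x) (f * G) * weightFun ħ (ofRealVec x) *
      whittakerFun (ofRealVec γ) ħ (ofRealVec x) =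
      Complex.I ^ (n + 2) * Complex.exp (Real.pi / ħ * n * (Complex.I * ħ)) *
        ∑ j, shiftIntegrand γ ħ h f g j
          (ofRealVec x + Pi.single ⟨⟨n + 1, h⟩, j⟩ (Complex.I * ħ)) := by
  have h1 := mul_weightFun_of_eq_sum_div ħ (ofRealVec γ) h hG
  rw [map_mul, mul_assoc (MvPolynomial.eval _ f), h1, mul_sum, sum_mul, mul_sum]
  refine sum_congr rfl fun j _ => ?_
  have h2 := numA_mul_whittakerFun (ofRealVec γ) ħ hħ h j (z := ofRealVec x) fun n k m => by
    rw [argVal_re_ofRealVec]; norm_num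
  have h3 : ofRealVec x + Pi.single (⟨⟨n + 1, h⟩, j⟩ : Label N) (Complex.I * ħ) +
      Pi.single ⟨⟨n + 1, h⟩, j⟩ (-(Complex.I * ħ)) = ofRealVec x := by
    rw [add_assoc, ← Pi.single_add, add_neg_cancel, Pi.single_zero, add_zero]
  rw [shiftIntegrand, map_mul, eval_translatePoly, h3, reducedWeight_add_single ħ hħ.ne']
  linear_combination MvPolynomial.eval (ofRealVec x) f * MvPolynomial.eval (ofRealVec x +
    Pi.single ⟨⟨n + 1, h⟩, j⟩ (Complex.I * ħ)) g *
    reducedWeight ħ ⟨⟨n + 1, h⟩, j⟩ (ofRealVec x) * h2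

/-- The integral against the weight and the Whittaker function. -/
def whittakerIntegral (γ : Fin N → ℝ) (ħ : ℝ) (f : MvPolynomial (Label N) ℂ) : ℂ :=
  ∫ x : Label N → ℝ, MvPolynomial.eval (ofRealVec x) f * weightFun ħ (ofRealVec x) *
    whittakerFun (ofRealVec γ) ħ (ofRealVec x)

/-- The adjointness of the difference operators with coefficients `numB` and `numA`. -/
theorem whittakerIntegral_adjoint (hħ : 0 < ħ) {n : ℕ} (h : n + 1 < N)
    {f g F G : MvPolynomial (Label N) ℂ}
    (hF : ∀ x : Label N → ℝ, (∀ j, denVal (ofRealVec γ) (n + 1) j (ofRealVec x) ≠ 0) →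
      MvPolynomial.eval (ofRealVec x) F = ∑ j, numB (ofRealVec γ) (-(Complex.I * ħ)) n j
        (ofRealVec x) * MvPolynomial.eval (ofRealVec x +
          Pi.single ⟨⟨n + 1, h⟩, j⟩ (-(Complex.I * ħ))) f /
          denVal (ofRealVec γ) (n + 1) j (ofRealVec x))
    (hG : ∀ x : Label N → ℝ, (∀ j, denVal (ofRealVec γ) (n + 1) j (ofRealVec x) ≠ 0) →
      MvPolynomial.eval (ofRealVec x) G = ∑ j, numA (ofRealVec γ) (Complex.I * ħ) (n + 1) j
        (ofRealVec x) * MvPolynomial.eval (ofRealVec x +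
          Pi.single ⟨⟨n + 1, h⟩, j⟩ (Complex.I * ħ)) g /
          denVal (ofRealVec γ) (n + 1) j (ofRealVec x)) :
    upConst ħ n * whittakerIntegral γ ħ (F * g) = whittakerIntegral γ ħ (f * G) := by
  have key := fun j => integral_raisedFun_shift γ ħ hħ h j
    (translatePoly ⟨⟨n + 1, h⟩, j⟩ (-(Complex.I * ħ)) f * g)
    (Φ := shiftIntegrand γ ħ h f g j) fun z => rfl
  simp only [whittakerIntegral, eval_mul_weight_of_numB hħ h _ (hF _),
    eval_mul_weight_of_numA hħ h _ (hG _)]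
  rw [integral_const_mul, integral_const_mul, integral_finsetSum _ fun j _ => (key j).1,
    integral_finsetSum _ fun j _ => (key j).2.1, ← mul_assoc]
  congr 1
  · rw [upConst, mul_right_comm, mul_assoc (Complex.I ^ (n + 2)), ← mul_pow,
      mul_inv_cancel₀ Complex.I_ne_zero, one_pow, mul_one]
    congr 2
    ring
  · exact sum_congr rfl fun j _ => (key j).2.2

theorem upConst_mul_downConst (n : ℕ) : upConst ħ n * downConst ħ n = 1 := by
  have h1 : Complex.I * Complex.I⁻¹ = 1 := mul_inv_cancel₀ Complex.I_ne_zero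
  have h2 : Complex.exp (-(Real.pi / ħ) * n * -(Complex.I * ħ)) *
      Complex.exp (-(Real.pi / ħ) * n * (Complex.I * ħ)) = 1 := by
    rw [← Complex.exp_add, ← mul_add, neg_add_cancel, mul_zero, Complex.exp_zero]
  calc upConst ħ n * downConst ħ n = (Complex.I * Complex.I⁻¹) ^ (n + 2) *
      (Complex.I * Complex.I⁻¹) ^ n * (Complex.exp (-(Real.pi / ħ) * n * -(Complex.I * ħ)) *
      Complex.exp (-(Real.pi / ħ) * n * (Complex.I * ħ))) := by
        rw [upConst, downConst, mul_pow, mul_pow]; ring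
    _ = 1 := by rw [h1, h2, one_pow, one_pow, mul_one, mul_one]

theorem conj_entryVal (x : Label N → ℝ) (n : ℕ) (j : Fin n) :
    conj (entryVal (ofRealVec γ) (ofRealVec x) n j) = entryVal (ofRealVec γ) (ofRealVec x) n j :=
  Complex.conj_eq_iff_im.mpr (entryVal_im_ofRealVec γ x n j)

theorem conj_denVal (x : Label N → ℝ) (n : ℕ) (j : Fin n) :
    conj (denVal (ofRealVec γ) n j (ofRealVec x)) = denVal (ofRealVec γ) n j (ofRealVec x) := by
  simp only [denVal, map_prod, map_sub, conj_entryVal]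

theorem conj_two : conj (2 : ℂ) = 2 := Complex.conj_ofNat 2

theorem conj_numA (b : ℂ) (n : ℕ) (j : Fin n) (x : Label N → ℝ) :
    conj (numA (ofRealVec γ) b n j (ofRealVec x)) =
      numA (ofRealVec γ) (conj b) n j (ofRealVec x) := by
  simp only [numA, map_prod, map_add, map_sub, conj_entryVal, map_div₀, conj_two]

theorem conj_numB (b : ℂ) (n : ℕ) (j : Fin (n + 1)) (x : Label N → ℝ) :
    conj (numB (ofRealVec γ) b n j (ofRealVec x)) =
      numB (ofRealVec γ) (conj b) n j (ofRealVec x) := by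
  simp only [numB, map_prod, map_add, map_sub, conj_entryVal, map_div₀, conj_two]

theorem conj_add_single (x : Label N → ℝ) (l : Label N) (b : ℂ) :
    (fun i => conj ((ofRealVec x + Pi.single l b : Label N → ℂ) i)) =
      ofRealVec x + Pi.single l (conj b) := by
  funext i
  by_cases hi : i = l
  · subst hi
    simp [ofRealVec]
  · simp [ofRealVec, hi]

theorem conj_I_mul : conj (Complex.I * (ħ : ℂ)) = -(Complex.I * ħ) := by
  rw [map_mul, Complex.conj_I, Complex.conj_ofReal, neg_mul]

theorem conj_neg_I_mul : conj (-(Complex.I * (ħ : ℂ))) = Complex.I * ħ := by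
  rw [map_neg, conj_I_mul, neg_neg]

end Adjoint

end

section

open Finset MeasureTheory

/-! ### The pairing of the Whittaker modules -/

section Pairing

variable {N : ℕ} {γ : Fin N → ℝ} {ħ : ℝ}

theorem whittakerIntegral_add (hħ : 0 < ħ) (f g : MvPolynomial (Label N) ℂ) :
    whittakerIntegral γ ħ (f + g) = whittakerIntegral γ ħ f + whittakerIntegral γ ħ g := by
  simp only [whittakerIntegral, map_add, add_mul]
  exact integral_add (integrable_weight_mul_whittakerFun γ ħ hħ f)
    (integrable_weight_mul_whittakerFun γ ħ hħ g)

theorem whittakerIntegral_smul (a : ℂ) (f : MvPolynomial (Label N) ℂ) :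
    whittakerIntegral γ ħ (a • f) = a * whittakerIntegral γ ħ f := by
  simp only [whittakerIntegral, MvPolynomial.smul_eval, mul_assoc]
  exact integral_const_mul a _

/-- On real points, conjugating a polynomial means conjugating its coefficients, so the integrand is
the restriction of a function holomorphic near the real points and contours can be moved. -/
theorem integrand_polyM (p q : MvPolynomial (Label N) ℂ) (x : Label N → ℝ) :
    integrand ħ (polyM p) (polyM q * whittakerVector ħ (ofRealVec γ)) x =
      MvPolynomial.eval (ofRealVec x) (conjPoly p * q) * weightFun ħ (ofRealVec x) *
        whittakerFun (ofRealVec γ) ħ (ofRealVec x) := by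
  have hre (n k m) : 0 < (argVal (ofRealVec γ) ħ n k m (ofRealVec x)).re := by
    rw [argVal_re_ofRealVec]
    norm_num
  have h : integrand ħ (polyM p) (polyM q * whittakerVector ħ (ofRealVec γ)) x =
    (μ₀ ħ x : ℂ) * conj (value (polyM p) (ofRealVec x)) *
      value (polyM q * whittakerVector ħ (ofRealVec γ)) (ofRealVec x) := rfl
  have h1 := value_polyM_mul_whittakerVector (ofRealVec γ) ħ q hre
  rw [h, h1, value_polyM, conj_eval_ofRealVec, ofReal_μ₀, map_mul (MvPolynomial.eval _)]
  ring

/-- The pairing, defined by the integral. -/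
def pairing (ħ : ℝ) (φ ψ : Mero N) : ℂ := ∫ x : Label N → ℝ, integrand ħ φ ψ x

theorem pairing_polyM (p q : MvPolynomial (Label N) ℂ) :
    pairing ħ (polyM p) (polyM q * whittakerVector ħ (ofRealVec γ)) =
      whittakerIntegral γ ħ (conjPoly p * q) := by
  simp only [pairing, integrand_polyM, whittakerIntegral]

theorem exists_polyM_of_mem_W' (hħ : 0 < ħ) {φ : Mero N} (hφ : φ ∈ W' ħ (ofRealVec γ)) :
    ∃ p, IsLevelSymmetric p ∧ φ = polyM p := by
  rw [W'_eq _ _ hħ.ne'] at hφ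
  exact exists_polyM_of_mem _ hφ

theorem exists_polyM_of_mem_W (hħ : 0 < ħ) {ψ : Mero N} (hψ : ψ ∈ W ħ (ofRealVec γ)) :
    ∃ q, IsLevelSymmetric q ∧ polyM q ∈ symmMero (ofRealVec γ) ∧
      ψ = polyM q * whittakerVector ħ (ofRealVec γ) := by
  rw [W_eq _ _ hħ] at hψ
  obtain ⟨F, hF, rfl⟩ := hψ
  obtain ⟨q, hq, rfl⟩ := exists_polyM_of_mem _ hF
  exact ⟨q, hq, hF, rfl⟩

variable {φ φ' ψ ψ' : Mero N}

theorem integrable_integrand (hħ : 0 < ħ) (hφ : φ ∈ W' ħ (ofRealVec γ))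
    (hψ : ψ ∈ W ħ (ofRealVec γ)) : Integrable (integrand ħ φ ψ) := by
  obtain ⟨p, -, rfl⟩ := exists_polyM_of_mem_W' hħ hφ
  obtain ⟨q, -, -, rfl⟩ := exists_polyM_of_mem_W hħ hψ
  rw [funext (integrand_polyM p q)]
  exact integrable_weight_mul_whittakerFun γ ħ hħ _

theorem pairing_add_left (hħ : 0 < ħ) (hφ : φ ∈ W' ħ (ofRealVec γ))
    (hφ' : φ' ∈ W' ħ (ofRealVec γ)) (hψ : ψ ∈ W ħ (ofRealVec γ)) :
    pairing ħ (φ + φ') ψ = pairing ħ φ ψ + pairing ħ φ' ψ := by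
  obtain ⟨p, -, rfl⟩ := exists_polyM_of_mem_W' hħ hφ
  obtain ⟨p', -, rfl⟩ := exists_polyM_of_mem_W' hħ hφ'
  obtain ⟨q, -, -, rfl⟩ := exists_polyM_of_mem_W hħ hψ
  rw [← map_add, pairing_polyM, pairing_polyM, pairing_polyM, map_add, add_mul,
    whittakerIntegral_add hħ]

theorem pairing_smul_left (hħ : 0 < ħ) (a : ℂ) (hφ : φ ∈ W' ħ (ofRealVec γ))
    (hψ : ψ ∈ W ħ (ofRealVec γ)) : pairing ħ (a • φ) ψ = conj a * pairing ħ φ ψ := by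
  obtain ⟨p, -, rfl⟩ := exists_polyM_of_mem_W' hħ hφ
  obtain ⟨q, -, -, rfl⟩ := exists_polyM_of_mem_W hħ hψ
  rw [← map_smul, pairing_polyM, pairing_polyM, conjPoly_smul, smul_mul_assoc,
    whittakerIntegral_smul]

theorem pairing_add_right (hħ : 0 < ħ) (hφ : φ ∈ W' ħ (ofRealVec γ))
    (hψ : ψ ∈ W ħ (ofRealVec γ)) (hψ' : ψ' ∈ W ħ (ofRealVec γ)) :
    pairing ħ φ (ψ + ψ') = pairing ħ φ ψ + pairing ħ φ ψ' := by
  obtain ⟨p, -, rfl⟩ := exists_polyM_of_mem_W' hħ hφ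
  obtain ⟨q, -, -, rfl⟩ := exists_polyM_of_mem_W hħ hψ
  obtain ⟨q', -, -, rfl⟩ := exists_polyM_of_mem_W hħ hψ'
  rw [← add_mul, ← map_add, pairing_polyM, pairing_polyM, pairing_polyM, mul_add,
    whittakerIntegral_add hħ]

theorem pairing_smul_right (hħ : 0 < ħ) (a : ℂ) (hφ : φ ∈ W' ħ (ofRealVec γ))
    (hψ : ψ ∈ W ħ (ofRealVec γ)) : pairing ħ φ (a • ψ) = a * pairing ħ φ ψ := by
  obtain ⟨p, -, rfl⟩ := exists_polyM_of_mem_W' hħ hφ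
  obtain ⟨q, -, -, rfl⟩ := exists_polyM_of_mem_W hħ hψ
  rw [← smul_mul_assoc, ← map_smul, pairing_polyM, pairing_polyM, mul_smul_comm,
    whittakerIntegral_smul]

theorem pairing_sub_left (hħ : 0 < ħ) (hφ : φ ∈ W' ħ (ofRealVec γ))
    (hφ' : φ' ∈ W' ħ (ofRealVec γ)) (hψ : ψ ∈ W ħ (ofRealVec γ)) :
    pairing ħ (φ - φ') ψ = pairing ħ φ ψ - pairing ħ φ' ψ := by
  have h := pairing_add_left hħ (sub_mem hφ hφ') hφ' hψ
  rw [sub_add_cancel] at h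
  rw [h, add_sub_cancel_right]

theorem pairing_sub_right (hħ : 0 < ħ) (hφ : φ ∈ W' ħ (ofRealVec γ))
    (hψ : ψ ∈ W ħ (ofRealVec γ)) (hψ' : ψ' ∈ W ħ (ofRealVec γ)) :
    pairing ħ φ (ψ - ψ') = pairing ħ φ ψ - pairing ħ φ ψ' := by
  have h := pairing_add_right hħ hφ (sub_mem hψ hψ') hψ'
  rw [sub_add_cancel] at h
  rw [h, add_sub_cancel_right]

/-! ### Skew operators -/

/-- The operators preserving both Whittaker modules which are skew for the pairing. -/
structure IsSkew (γ : Fin N → ℝ) (ħ : ℝ) (T : Module.End ℂ (Mero N)) : Prop where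
  mem_W' : ∀ φ ∈ W' ħ (ofRealVec γ), T φ ∈ W' ħ (ofRealVec γ)
  mem_W : ∀ ψ ∈ W ħ (ofRealVec γ), T ψ ∈ W ħ (ofRealVec γ)
  pairing_eq : ∀ φ ∈ W' ħ (ofRealVec γ), ∀ ψ ∈ W ħ (ofRealVec γ),
    pairing ħ φ (T ψ) = -pairing ħ (T φ) ψ

variable {S T : Module.End ℂ (Mero N)}

theorem isSkew_zero (hħ : 0 < ħ) : IsSkew γ ħ (0 : Module.End ℂ (Mero N)) where
  mem_W' _ _ := zero_mem _
  mem_W _ _ := zero_mem _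
  pairing_eq φ hφ ψ hψ := by
    have h1 := pairing_smul_right hħ 0 hφ hψ
    have h2 := pairing_smul_left hħ 0 hφ hψ
    rw [zero_smul, zero_mul] at h1
    rw [zero_smul, map_zero, zero_mul] at h2
    rw [LinearMap.zero_apply, LinearMap.zero_apply, h1, h2, neg_zero]

theorem IsSkew.add (hħ : 0 < ħ) (hS : IsSkew γ ħ S) (hT : IsSkew γ ħ T) : IsSkew γ ħ (S + T) where
  mem_W' φ hφ := add_mem (hS.mem_W' φ hφ) (hT.mem_W' φ hφ)
  mem_W ψ hψ := add_mem (hS.mem_W ψ hψ) (hT.mem_W ψ hψ)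
  pairing_eq φ hφ ψ hψ := by
    rw [LinearMap.add_apply, LinearMap.add_apply, pairing_add_right hħ hφ (hS.mem_W ψ hψ)
      (hT.mem_W ψ hψ), pairing_add_left hħ (hS.mem_W' φ hφ) (hT.mem_W' φ hφ) hψ,
      hS.pairing_eq φ hφ ψ hψ, hT.pairing_eq φ hφ ψ hψ]
    ring

/-- The scalar must be real because the pairing is conjugate-linear on the left; this is where the
real form of the Lie algebra enters. -/
theorem IsSkew.smul (hħ : 0 < ħ) (hT : IsSkew γ ħ T) (a : ℝ) : IsSkew γ ħ ((a : ℂ) • T) where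
  mem_W' φ hφ := Submodule.smul_mem _ _ (hT.mem_W' φ hφ)
  mem_W ψ hψ := Submodule.smul_mem _ _ (hT.mem_W ψ hψ)
  pairing_eq φ hφ ψ hψ := by
    rw [LinearMap.smul_apply, LinearMap.smul_apply, pairing_smul_right hħ _ hφ (hT.mem_W ψ hψ),
      pairing_smul_left hħ _ (hT.mem_W' φ hφ) hψ, hT.pairing_eq φ hφ ψ hψ, Complex.conj_ofReal]
    ring

theorem IsSkew.sum (hħ : 0 < ħ) {κ : Type*} (s : Finset κ) {f : κ → Module.End ℂ (Mero N)}
    (h : ∀ i ∈ s, IsSkew γ ħ (f i)) : IsSkew γ ħ (∑ i ∈ s, f i) :=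
  sum_induction f (IsSkew γ ħ) (fun _ _ hS hT => hS.add hħ hT) (isSkew_zero hħ) h

/-- Moving both operators across changes the sign twice and reverses their order, which amounts to
one sign for the commutator. Stability of both modules is needed for the intermediate vectors. -/
theorem IsSkew.lie (hħ : 0 < ħ) (hS : IsSkew γ ħ S) (hT : IsSkew γ ħ T) : IsSkew γ ħ ⁅S, T⁆ where
  mem_W' φ hφ := sub_mem (hS.mem_W' _ (hT.mem_W' φ hφ)) (hT.mem_W' _ (hS.mem_W' φ hφ))
  mem_W ψ hψ := sub_mem (hS.mem_W _ (hT.mem_W ψ hψ)) (hT.mem_W _ (hS.mem_W ψ hψ))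
  pairing_eq φ hφ ψ hψ := by
    change pairing ħ φ (S (T ψ) - T (S ψ)) = -pairing ħ (S (T φ) - T (S φ)) ψ
    have h1 := hS.mem_W' φ hφ
    have h2 := hT.mem_W' φ hφ
    have h3 := hS.mem_W ψ hψ
    have h4 := hT.mem_W ψ hψ
    rw [pairing_sub_right hħ hφ (hS.mem_W _ h4) (hT.mem_W _ h3),
      pairing_sub_left hħ (hS.mem_W' _ h2) (hT.mem_W' _ h1) hψ, hS.pairing_eq φ hφ _ h4,
      hT.pairing_eq _ h1 ψ hψ, hT.pairing_eq φ hφ _ h3, hS.pairing_eq _ h2 ψ hψ]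
    ring

/-- The raising operator acts by `opB` on the symmetric factor of ψ and by `opA` on φ, and
conjugation changes the shift of the latter to iħ, as the adjointness requires. The minus sign comes
from the imaginary prefactor. For lowering operators the roles of the two arguments are exchanged.
-/
theorem isSkew_upE_succ (hħ : 0 < ħ) {n : ℕ} (h : n + 1 < N) :
    IsSkew γ ħ (upE ħ (ofRealVec γ) (n + 1)) where
  mem_W' φ hφ := upE_mem_cyclic _ ħ _ h hφ
  mem_W ψ hψ := upE_mem_cyclic _ ħ _ h hψ
  pairing_eq φ hφ ψ hψ := by
    have hφ' := hφ
    rw [W'_eq _ _ hħ.ne'] at hφ'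
    obtain ⟨p, -, rfl⟩ := exists_polyM_of_mem_W' hħ hφ
    obtain ⟨q, -, hq, rfl⟩ := exists_polyM_of_mem_W hħ hψ
    obtain ⟨p', -, hp'⟩ := exists_polyM_of_mem (ofRealVec γ)
      ((gzArray (ofRealVec γ) (-(Complex.I * ħ))).opA_mem h hφ')
    obtain ⟨q', -, hq'⟩ := exists_polyM_of_mem (ofRealVec γ)
      ((gzArray (ofRealVec γ) (-(Complex.I * ħ))).opB_mem h hq)
    have key := whittakerIntegral_adjoint (γ := γ) hħ h (f := q) (g := conjPoly p) (F := q')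
      (G := conjPoly p') (fun x hx => eval_opB (ofRealVec γ) h hq' _ hx) (fun x hx => by
        have h1 := congrArg conj (eval_opA (ofRealVec γ) h hp' _ hx)
        rw [conj_eval_ofRealVec, map_sum] at h1
        rw [h1]
        refine sum_congr rfl fun j _ => ?_
        rw [map_div₀, map_mul, conj_denVal, conj_numA, conj_eval, conj_add_single, conj_neg_I_mul])
    rw [upE_apply _ _ h, upE_apply _ _ h, opA_mul_whittakerVector _ _ hħ h, hp', hq',
      ← smul_mul_assoc, ← smul_mul_assoc, ← map_smul, ← map_smul, ← map_smul, pairing_polyM,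
      pairing_polyM, mul_smul_comm, mul_smul_comm, whittakerIntegral_smul, whittakerIntegral_smul,
      conjPoly_smul, smul_mul_assoc, whittakerIntegral_smul, mul_comm (conjPoly p),
      mul_comm (conjPoly p'), ← key, map_neg, map_div₀, map_one, conj_I_mul]
    ring

theorem isSkew_downE_succ (hħ : 0 < ħ) {n : ℕ} (h : n + 1 < N) :
    IsSkew γ ħ (downE ħ (ofRealVec γ) (n + 1)) where
  mem_W' φ hφ := downE_mem_cyclic _ ħ _ h hφ
  mem_W ψ hψ := downE_mem_cyclic _ ħ _ h hψ
  pairing_eq φ hφ ψ hψ := by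
    have hφ' := hφ
    rw [W'_eq _ _ hħ.ne'] at hφ'
    obtain ⟨p, -, rfl⟩ := exists_polyM_of_mem_W' hħ hφ
    obtain ⟨q, -, hq, rfl⟩ := exists_polyM_of_mem_W hħ hψ
    obtain ⟨p', -, hp'⟩ := exists_polyM_of_mem (ofRealVec γ)
      ((gzArray (ofRealVec γ) (Complex.I * ħ)).opB_mem h hφ')
    obtain ⟨q', -, hq'⟩ := exists_polyM_of_mem (ofRealVec γ)
      ((gzArray (ofRealVec γ) (Complex.I * ħ)).opA_mem h hq)
    have key := whittakerIntegral_adjoint (γ := γ) hħ h (f := conjPoly p) (g := q)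
      (F := conjPoly p') (G := q') (fun x hx => by
        have h1 := congrArg conj (eval_opB (ofRealVec γ) h hp' _ hx)
        rw [conj_eval_ofRealVec, map_sum] at h1
        rw [h1]
        refine sum_congr rfl fun j _ => ?_
        rw [map_div₀, map_mul, conj_denVal, conj_numB, conj_eval, conj_add_single, conj_I_mul])
      (fun x hx => eval_opA (ofRealVec γ) h hq' _ hx)
    have h1 : downConst ħ n * whittakerIntegral γ ħ (conjPoly p * q') =
        whittakerIntegral γ ħ (conjPoly p' * q) := by
      rw [← key, ← mul_assoc, mul_comm (downConst ħ n), upConst_mul_downConst, one_mul]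
    rw [downE_apply _ _ h, downE_apply _ _ h, opB_mul_whittakerVector _ _ hħ h, hp', hq',
      ← smul_mul_assoc, ← smul_mul_assoc, ← map_smul, ← map_smul, ← map_smul, pairing_polyM,
      pairing_polyM, mul_smul_comm, mul_smul_comm, whittakerIntegral_smul, whittakerIntegral_smul,
      conjPoly_smul, smul_mul_assoc, whittakerIntegral_smul, h1, map_div₀, map_one, conj_I_mul]
    ring

theorem isSkew_upE (hħ : 0 < ħ) (n : ℕ) : IsSkew γ ħ (upE ħ (ofRealVec γ) n) := by
  by_cases h : n < N
  · rcases n with _ | n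
    · have : upE ħ (ofRealVec γ) 0 = 0 := by
        rw [upE, dif_pos h, univ_eq_empty, sum_empty, smul_zero]
      rw [this]
      exact isSkew_zero hħ
    · exact isSkew_upE_succ hħ h
  · rw [upE, dif_neg h]
    exact isSkew_zero hħ

theorem isSkew_downE (hħ : 0 < ħ) (n : ℕ) : IsSkew γ ħ (downE ħ (ofRealVec γ) n) := by
  by_cases h : n < N
  · rcases n with _ | n
    · have : downE ħ (ofRealVec γ) 0 = 0 := by
        rw [downE, dif_pos h, univ_eq_empty, sum_empty, smul_zero]
      rw [this]
      exact isSkew_zero hħ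
    · exact isSkew_downE_succ hħ h
  · rw [downE, dif_neg h]
    exact isSkew_zero hħ

/-- The operator is multiplication by a function real on real points, times the imaginary constant
1/(iħ). -/
theorem pairing_diagE (hħ : 0 < ħ) (n : ℕ) (hφ : φ ∈ W' ħ (ofRealVec γ))
    (hψ : ψ ∈ W ħ (ofRealVec γ)) :
    pairing ħ φ (diagE ħ (ofRealVec γ) n ψ) = -pairing ħ (diagE ħ (ofRealVec γ) n φ) ψ := by
  obtain ⟨p, -, rfl⟩ := exists_polyM_of_mem_W' hħ hφ
  obtain ⟨q, -, -, rfl⟩ := exists_polyM_of_mem_W hħ hψ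
  obtain ⟨d, -, hd⟩ := exists_polyM_of_mem (ofRealVec γ) (sub_mem
    ((gzArray (ofRealVec γ) 0).p_mem_symm n 1) ((gzArray (ofRealVec γ) 0).p_mem_symm (n - 1) 1))
  have h1 : polyE d = ∑ j : Fin n, entry (ofRealVec γ) n j -
      ∑ j : Fin (n - 1), entry (ofRealVec γ) (n - 1) j := by
    let θ : Entire N →ₐ[ℂ] Mero N := IsScalarTower.toAlgHom ℂ (Entire N) (Mero N)
    apply toMero_injective
    change toMero (polyE d) = θ _
    rw [← polyM_apply, ← hd, map_sub, map_sum, map_sum]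
    simp only [ShiftArray.p, powerSum, pow_one]
    rfl
  have h2 : ∀ x : Label N → ℝ, MvPolynomial.eval (ofRealVec x) (conjPoly d) =
      MvPolynomial.eval (ofRealVec x) d := by
    intro x
    rw [← conj_eval_ofRealVec, ← polyE_apply, h1, ← evalHom_apply, map_sub, map_sum, map_sum,
      map_sub, map_sum, map_sum]
    exact congrArg₂ _ (sum_congr rfl fun j _ => conj_entryVal x n j)
      (sum_congr rfl fun j _ => conj_entryVal x (n - 1) j)
  have h3 : whittakerIntegral γ ħ (conjPoly p * (d * q)) =
      whittakerIntegral γ ħ (conjPoly d * conjPoly p * q) := by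
    simp only [whittakerIntegral, map_mul, h2]
    refine integral_congr_ae (Filter.Eventually.of_forall fun x => ?_)
    simp only
    ring
  rw [diagE_apply, diagE_apply, hd, ← mul_assoc, ← map_mul, ← map_mul, ← smul_mul_assoc,
    ← map_smul, ← map_smul, pairing_polyM, pairing_polyM, mul_smul_comm, conjPoly_smul,
    smul_mul_assoc, whittakerIntegral_smul, whittakerIntegral_smul, h3, map_mul, map_div₀, map_one,
    conj_I_mul]
  ring

theorem isSkew_unitE (hħ : 0 < ħ) (j k : Fin N) : IsSkew γ ħ (unitE ħ (ofRealVec γ) j k) where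
  mem_W' φ hφ := unitE_mem_cyclic _ ħ _ j k hφ
  mem_W ψ hψ := unitE_mem_cyclic _ ħ _ j k hψ
  pairing_eq := by
    have hu : ∀ n d, IsSkew γ ħ (upperE ħ (ofRealVec γ) n d) := by
      intro n d
      induction d with
      | zero => exact isSkew_upE hħ n
      | succ d ih => exact ih.lie hħ (isSkew_upE hħ _)
    have hl : ∀ n d, IsSkew γ ħ (lowerE ħ (ofRealVec γ) n d) := by
      intro n d
      induction d with
      | zero => exact isSkew_downE hħ n
      | succ d ih => exact (isSkew_downE hħ _).lie hħ ih
    intro φ hφ ψ hψ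
    rw [unitE]
    split_ifs
    · exact (hu _ _).pairing_eq φ hφ ψ hψ
    · exact (hl _ _).pairing_eq φ hφ ψ hψ
    · exact pairing_diagE hħ _ hφ hψ

theorem isSkew_act (hħ : 0 < ħ) (X : Matrix (Fin N) (Fin N) ℝ) :
    IsSkew γ ħ (act ħ (ofRealVec γ) X) :=
  IsSkew.sum hħ _ fun j _ => IsSkew.sum hħ _ fun k _ => (isSkew_unitE hħ j k).smul hħ (X j k)

/-! ### Nondegeneracy -/

theorem entryVal_comp_levelPerm (γN : Fin N → ℂ) (σ : (n : Fin N) → Equiv.Perm (Fin (n : ℕ)))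
    (n : ℕ) : ∃ τ : Equiv.Perm (Fin n), ∀ (z : Label N → ℂ) (j : Fin n),
      entryVal γN (z ∘ levelPerm σ) n j = entryVal γN z n (τ j) := by
  rcases Nat.lt_or_ge n N with h | h
  · refine ⟨σ ⟨n, h⟩, fun z j => ?_⟩
    rw [entryVal, entryVal, entry_apply_of_lt γN h, entry_apply_of_lt γN h]
    rfl
  · refine ⟨1, fun z j => ?_⟩
    obtain ⟨a, ha⟩ := exists_entry_eq_cst γN h j
    rw [entryVal, entryVal, Equiv.Perm.one_apply, ha]
    rfl

theorem whittakerFun_comp_levelPerm (γN : Fin N → ℂ)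
    (σ : (n : Fin N) → Equiv.Perm (Fin (n : ℕ))) (z : Label N → ℂ) :
    whittakerFun γN ħ (z ∘ levelPerm σ) = whittakerFun γN ħ z := by
  choose τ hτ using entryVal_comp_levelPerm γN σ
  have h1 : ∀ y : Label N → ℂ, expVal γN ħ y = -(Real.pi / ħ) * ∑ n ∈ Ico 1 N,
      ((n : ℂ) - 1) * ∑ j : Fin n, entryVal γN y n j := by
    intro y
    rw [expVal, ← evalHom_apply, whittakerExponent, map_smul, map_sum, smul_eq_mul]
    congr 1
    refine sum_congr rfl fun n _ => ?_
    rw [map_smul, map_sum, smul_eq_mul]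
    rfl
  have h2 : expVal γN ħ (z ∘ levelPerm σ) = expVal γN ħ z := by
    rw [h1, h1]
    congr 1
    refine sum_congr rfl fun n _ => ?_
    congr 1
    simp only [hτ]
    exact Equiv.sum_comp (τ n) fun j => entryVal γN z n j
  rw [whittakerFun, whittakerFun, h2]
  congr 1
  refine prod_congr rfl fun n _ => ?_
  have h3 : ∀ (k : Fin n) (m : Fin (n + 1)), argVal γN ħ n k m (z ∘ levelPerm σ) =
      argVal γN ħ n (τ n k) (τ (n + 1) m) z := fun k m => by
    rw [argVal_eq, argVal_eq, hτ, hτ]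
  simp only [h3]
  rw [Equiv.prod_comp (τ n) fun k => ∏ m, gFun ħ (argVal γN ħ n k (τ (n + 1) m) z)]
  exact prod_congr rfl fun k _ =>
    Equiv.prod_comp (τ (n + 1)) fun m => gFun ħ (argVal γN ħ n k m z)

theorem whittakerIntegral_mul_rename {f : MvPolynomial (Label N) ℂ} (hf : IsLevelSymmetric f)
    (σ : (n : Fin N) → Equiv.Perm (Fin (n : ℕ))) (q : MvPolynomial (Label N) ℂ) :
    whittakerIntegral γ ħ (f * MvPolynomial.rename (levelPerm σ) q) =
      whittakerIntegral γ ħ (f * q) := by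
  have h1 := (volume_measurePreserving_piCongrLeft (fun _ : Label N => ℝ)
    (levelPerm σ).symm).integral_comp' (fun x : Label N → ℝ =>
      MvPolynomial.eval (ofRealVec x) (f * q) * weightFun ħ (ofRealVec x) *
        whittakerFun (ofRealVec γ) ħ (ofRealVec x))
  rw [whittakerIntegral, whittakerIntegral, ← h1]
  refine integral_congr_ae (Filter.Eventually.of_forall fun x => ?_)
  have h2 : ofRealVec (MeasurableEquiv.piCongrLeft (fun _ : Label N => ℝ) (levelPerm σ).symm x) =
      ofRealVec x ∘ levelPerm σ := by
    funext l
    have h3 := Equiv.piCongrLeft_apply_apply (fun _ : Label N => ℝ) (levelPerm σ).symm x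
      (levelPerm σ l)
    rw [Equiv.symm_apply_apply] at h3
    exact congrArg Complex.ofReal h3
  simp only [h2]
  rw [weightFun_comp_levelPerm, whittakerFun_comp_levelPerm, map_mul, map_mul, hf.eval,
    MvPolynomial.eval_rename]

/-- Weight, Whittaker function and f are invariant, so all summands of the symmetrization contribute
equally. -/
theorem whittakerIntegral_mul_levelSum (hħ : 0 < ħ) {f : MvPolynomial (Label N) ℂ}
    (hf : IsLevelSymmetric f) (q : MvPolynomial (Label N) ℂ) :
    whittakerIntegral γ ħ (f * levelSum q) =
      Fintype.card ((n : Fin N) → Equiv.Perm (Fin (n : ℕ))) * whittakerIntegral γ ħ (f * q) := by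
  have h1 : ∀ (s : Finset ((n : Fin N) → Equiv.Perm (Fin (n : ℕ)))),
      whittakerIntegral γ ħ (f * ∑ σ ∈ s, MvPolynomial.rename (levelPerm σ) q) =
        s.card * whittakerIntegral γ ħ (f * q) := by
    classical
    intro s
    induction s using Finset.induction_on with
    | empty =>
      have := whittakerIntegral_smul (γ := γ) (ħ := ħ) 0 f
      simpa using this
    | insert σ s hσ ih =>
      rw [sum_insert hσ, mul_add, whittakerIntegral_add hħ, ih, whittakerIntegral_mul_rename hf,
        card_insert_of_notMem hσ]
      push_cast
      ring
  rw [levelSum, h1, card_univ]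

/-- A symmetric polynomial is zero if it is orthogonal to the symmetrizations of all polynomials. -/
theorem eq_zero_of_whittakerIntegral (hħ : 0 < ħ) {f : MvPolynomial (Label N) ℂ}
    (hf : IsLevelSymmetric f) (h : ∀ q, whittakerIntegral γ ħ (f * levelSum q) = 0) : f = 0 := by
  have h1 : ∀ q, whittakerIntegral γ ħ (f * q) = 0 := by
    intro q
    have h2 := h q
    rw [whittakerIntegral_mul_levelSum hħ hf] at h2
    exact (mul_eq_zero.mp h2).resolve_left (by exact_mod_cast Fintype.card_ne_zero)
  obtain ⟨C, ε, hε, hC⟩ := exists_norm_weight_mul_whittakerFun_le γ ħ hħ f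
  have h3 := eq_zero_of_integral_eval (continuous_weight_mul_whittakerFun γ ħ f) hε hC fun q => by
    rw [← h1 q, whittakerIntegral]
    refine integral_congr_ae (Filter.Eventually.of_forall fun x => ?_)
    simp only [map_mul]
    ring
  -- Where D does not vanish at a real point, neither does the weight. So f D vanishes on all real
  -- points, hence identically, and D can be cancelled in the polynomial ring.
  let D : MvPolynomial (Label N) ℂ := ∏ n : Fin N, ∏ p : Fin (n : ℕ),
    ∏ s ∈ univ.filter (fun s => s < p), (MvPolynomial.X ⟨n, s⟩ - MvPolynomial.X ⟨n, p⟩)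
  have hD : D ≠ 0 := prod_ne_zero_iff.mpr fun n _ => prod_ne_zero_iff.mpr fun p _ =>
    prod_ne_zero_iff.mpr fun s hs => sub_ne_zero.mpr fun h0 => by
      have h4 := MvPolynomial.X_injective h0
      rw [Sigma.mk.inj_iff] at h4
      exact (mem_filter.mp hs).2.ne (eq_of_heq h4.2)
  have h5 : f * D = 0 := by
    refine MvPolynomial.funext_set (fun _ => Set.range Complex.ofReal)
      (fun _ => Set.infinite_range_of_injective Complex.ofReal_injective) fun z hz => ?_
    choose x hx using fun i => hz i (Set.mem_univ i)
    have hz' : z = ofRealVec x := funext fun i => (hx i).symm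
    rw [hz', map_mul, map_zero]
    have h6 := h3 x
    rw [mul_eq_zero, or_iff_left (whittakerFun_ne_zero (ofRealVec γ) ħ fun n k m => by
      rw [argVal_re_ofRealVec]; norm_num), mul_eq_zero] at h6
    rcases h6 with h6 | h6
    · rw [h6, zero_mul]
    · by_contra h7
      refine weightFun_ofRealVec_ne_zero ħ hħ (fun n p s hsp hx => h7 ?_) h6
      rw [map_prod, prod_eq_zero (mem_univ n), mul_zero]
      rw [map_prod, prod_eq_zero (mem_univ p)]
      rw [map_prod, prod_eq_zero (mem_filter.mpr ⟨mem_univ s, hsp⟩)]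
      rw [map_sub, MvPolynomial.eval_X, MvPolynomial.eval_X, ofRealVec, ofRealVec, hx, sub_self]
  exact (mul_eq_zero.mp h5).resolve_right hD

theorem IsLevelSymmetric.conjPoly {f : MvPolynomial (Label N) ℂ} (hf : IsLevelSymmetric f) :
    IsLevelSymmetric (conjPoly f) := by
  intro σ
  conv_rhs => rw [← hf σ]
  exact (MvPolynomial.map_rename _ _ _).symm

theorem conjPoly_levelSum (q : MvPolynomial (Label N) ℂ) :
    conjPoly (levelSum q) = levelSum (conjPoly q) := by
  rw [levelSum, levelSum, map_sum]
  exact sum_congr rfl fun σ _ => MvPolynomial.map_rename _ _ _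

/-- The pairing of the Whittaker modules, as a sesquilinear map. -/
def pairingMap (hħ : 0 < ħ) :
    W' ħ (ofRealVec γ) →ₗ⋆[ℂ] W ħ (ofRealVec γ) →ₗ[ℂ] ℂ :=
  LinearMap.mk₂'ₛₗ (starRingEnd ℂ) (RingHom.id ℂ) (fun φ ψ => pairing ħ φ.1 ψ.1)
    (fun φ φ' ψ => pairing_add_left hħ φ.2 φ'.2 ψ.2)
    (fun a φ ψ => pairing_smul_left hħ a φ.2 ψ.2)
    (fun φ ψ ψ' => pairing_add_right hħ φ.2 ψ.2 ψ'.2)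
    (fun a φ ψ => pairing_smul_right hħ a φ.2 ψ.2)

theorem pairingMap_apply (hħ : 0 < ħ) (φ : W' ħ (ofRealVec γ)) (ψ : W ħ (ofRealVec γ)) :
    pairingMap hħ φ ψ = pairing ħ φ.1 ψ.1 := rfl

theorem polyM_levelSum_mul_mem_W (hħ : 0 < ħ) (q : MvPolynomial (Label N) ℂ) :
    polyM (levelSum q) * whittakerVector ħ (ofRealVec γ) ∈ W ħ (ofRealVec γ) := by
  have h := W_eq (ofRealVec γ) ħ hħ
  rw [h]
  exact ⟨polyM (levelSum q), polyM_levelSum_mem _ q, rfl⟩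

theorem polyM_levelSum_mem_W' (hħ : 0 < ħ) (q : MvPolynomial (Label N) ℂ) :
    polyM (levelSum q) ∈ W' ħ (ofRealVec γ) := by
  have h := W'_eq (ofRealVec γ) ħ hħ.ne'
  rw [h]
  exact polyM_levelSum_mem _ q

theorem pairingMap_nondegenerate (hħ : 0 < ħ) :
    (pairingMap (γ := γ) hħ).Nondegenerate := by
  constructor
  · rintro ⟨φ, hφ⟩ h
    apply Subtype.ext
    obtain ⟨p, hp, rfl⟩ := exists_polyM_of_mem_W' hħ hφ
    have h1 : conjPoly p = 0 := eq_zero_of_whittakerIntegral (γ := γ) hħ hp.conjPoly fun q => by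
      rw [← pairing_polyM]
      have h2 := h ⟨_, polyM_levelSum_mul_mem_W hħ q⟩
      rwa [pairingMap_apply] at h2
    change polyM p = 0
    rw [← conjPoly_conjPoly p, h1, map_zero, map_zero]
  · rintro ⟨ψ, hψ⟩ h
    apply Subtype.ext
    obtain ⟨q, hq, -, rfl⟩ := exists_polyM_of_mem_W hħ hψ
    have h1 : q = 0 := eq_zero_of_whittakerIntegral (γ := γ) hħ hq fun p => by
      rw [mul_comm, ← conjPoly_conjPoly p, ← conjPoly_levelSum, ← pairing_polyM]
      have h2 := h ⟨_, polyM_levelSum_mem_W' hħ (conjPoly p)⟩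
      rwa [pairingMap_apply] at h2
    change polyM q * _ = 0
    rw [h1, map_zero, zero_mul]

end Pairing

end

end GelfandZetlin

end

open GelfandZetlin MeasureTheory in
/-- The Whittaker modules `W` and `W'` are dual: the integral converges absolutely on `W' × W` and
defines there a pairing, conjugate-linear in the first argument and linear in the second, which is
non-degenerate and for which every `X ∈ 𝔤𝔩(N, ℝ)` is skew. -/
theorem proposition2p5 (N : ℕ) (ħ : ℝ) (hħ : 0 < ħ) (γN : Fin N → ℝ) :
    ∃ B : W' ħ (fun j => (γN j : ℂ)) →ₗ⋆[ℂ] W ħ (fun j => (γN j : ℂ)) →ₗ[ℂ] ℂ,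
      (∀ φ ψ, Integrable (integrand ħ φ.1 ψ.1) volume ∧
        B φ ψ = ∫ x : Label N → ℝ, integrand ħ φ.1 ψ.1 x) ∧
      B.Nondegenerate ∧
      ∀ (X : Matrix (Fin N) (Fin N) ℝ) (φ : W' ħ (fun j => (γN j : ℂ)))
        (ψ : W ħ (fun j => (γN j : ℂ))),
        B φ (actOn ħ (fun j => (γN j : ℂ)) (whittakerVector ħ (fun j => (γN j : ℂ))) X ψ) =
          -B (actOn ħ (fun j => (γN j : ℂ)) 1 X φ) ψ :=
  ⟨pairingMap (γ := γN) hħ,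
    fun φ ψ => ⟨integrable_integrand (γ := γN) hħ φ.2 ψ.2, rfl⟩,
    pairingMap_nondegenerate (γ := γN) hħ,
    fun X φ ψ => (isSkew_act (γ := γN) hħ X).pairing_eq φ.1 φ.2 ψ.1 ψ.2⟩
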